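/- **Flat limit of fixed-size L-ensembles.** Let $d\ge 1$, let $x_1,\dots,x_n\in\mathbb R^d$ be distinct points, and let $1\le m\le n$. *Kernel.* Let $\kappa(x,y)=f(\|x-y\|_2)$ be a stationary positive semidefinite kernel on $\mathbb R^d$ with $f$ analytic at $0$. Write $f_i=f^{(i)}(0)/i!$, and let $r=\min\{s\ge 1: f_{2s-1}\ne 0\}\in\{1,2,\dots\}\cup\{\infty\}$ be its smoothness order ($r=\infty$ if all odd derivatives of $f$ at $0$ vanish). For $\varepsilon>0$ put $L_\varepsilon=[f(\varepsilon\|x_i-x_j\|)]_{i,j}$, and let $D^{(p)}=[\|x_i-x_j\|^p]_{i,j}$. *Polynomials.* Let $\mathscr P_{k,d}=\binom{k+d}{d}$ be the number of monomials of degree at most $k$ in $d$ variables, with $\mathscr P_{\infty,d}=\infty$. The numbers $\mathscr P_{k,d}$, $k\in\mathbb N$, are called magic. Let $V_k$ (resp. $V_{\le k}$, $V_{<k}$) be the matrix with $n$ rows containing the values at $x_1,\dots,x_n$ of all monomials of degree exactly $k$ (resp. at most $k$, less than $k$). *Wronskian.* Let $$W_{\le k}=\left[\frac{\partial_x^\alpha\partial_y^\beta\kappa(0,0)}{\alpha!\,\beta!}\right]_{|\alpha|,|\beta|\le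 k}=\begin{bmatrix}W_{<k}&W_{\urcorner}\\W_{\llcorner}&W_{\lrcorner}\end{bmatrix},\qquad \bar W=W_{\lrcorner}-W_{\llcorner}W_{<k}^{-1}W_{\urcorner},$$ where the blocks separate the multi-indices of degree $<k$ from those of degree $k$. *Processes.* $|DPP|_m(L)$ is the random subset $\mathcal X$ of $\{1,\dots,n\}$ with $|\mathcal X|=m$ and $\mathbb P(\mathcal X=X)\propto\det L_X$ for $|X|=m$. A nonnegative pair $\langle L;V\rangle$ consists of a matrix $V$ of full column rank and a symmetric matrix $L$ with $c^\top Lc\ge 0$ whenever $V^\top c=0$; $|DPP|_m\langle L;V\rangle$ is the random subset with $|\mathcal X|=m$ and $\mathbb P(\mathcal X=X)\propto\det\begin{pmatrix}L_X&V_{X,:}\\V_{X,:}^\top&0\end{pmatrix}$ for $|X|=m$. Convergence is in law, as $\varepsilon\to 0^+$: $\mathbb P(\mathcal X_\varepsilon=A)\to\mathbb P(\mathcal X_\star=A)$ for every $A$. In each case below it is part of the claim that the laws are well defined (nonzero normalising constants, nonnegative masses), for all small $\varepsilon>0$ and in the limit. Let $\mathcal X_\varepsilon\sim|DPP|_m(L_\varepsilon)$.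 1. Suppose $m=\mathscr P_{k,d}$ for an integer $0\le k\le r-1$, that $V_{\le k}$ has full column rank and, if $r=\infty$, that $W_{\le k}$ is invertible. Then $\mathcal X_\varepsilon$ converges to $\mathcal X_\star\sim|DPP|_m(V_{\le k}V_{\le k}^\top)$. Equivalently, $\mathcal X_\star\sim|DPP|_m(QQ^\top)$ for any $Q\in\mathbb R^{n\times m}$ whose columns form an orthonormal basis of the column span of $V_{\le k}$. 2. Suppose $m\le\mathscr P_{r-1,d}$ is not magic. Then there is a unique integer $1\le k\le r-1$ with $\mathscr P_{k-1,d}<m<\mathscr P_{k,d}$. If $V_{<k}$ has full column rank, $\operatorname{rank}V_{\le k}\ge m$ and, in case $r=\infty$, $W_{\le k}$ is invertible, then $\langle V_k\bar WV_k^\top;V_{<k}\rangle$ is a nonnegative pair and $\mathcal X_\varepsilon$ converges to $\mathcal X_\star\sim|DPP|_m\langle V_k\bar WV_k^\top;V_{<k}\rangle$. 3. Suppose $r<\infty$, $m>\mathscr P_{r-1,d}$, and $V_{<r}$ has full column rank. Then $\langle(-1)^rD^{(2r-1)};V_{<r}\rangle$ is a nonnegative pair and $\mathcal X_\varepsilon$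 converges to $\mathcal X_\star\sim|DPP|_m\langle(-1)^rD^{(2r-1)};V_{<r}\rangle$. -/

import Mathlib

open Filter Topology
open scoped Matrix

/-! ### Stationary kernels -/

/-- The radial kernel `κ(x, y) = f(‖x - y‖₂)` on `ℝ^d`. -/
noncomputable def stationaryKernel (d : ℕ) (f : ℝ → ℝ)
    (x y : EuclideanSpace ℝ (Fin d)) : ℝ :=
  f ‖x - y‖

/-- Positive (semi)definiteness of a real kernel: all its finite quadratic forms are nonnegative. -/
def IsPosSemidefKernel {E : Type*} (κ : E → E → ℝ) : Prop :=
  ∀ (s : Finset E) (c : E → ℝ), 0 ≤ ∑ x ∈ s, ∑ y ∈ s, c x * c y * κ x y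

/-- The smoothness order `min {r ≥ 1 | f_{2r-1} ≠ 0}`, where `f_i = f^{(i)}(0) / i!`; it is `⊤`
if all odd derivatives of `f` at `0` vanish. -/
noncomputable def smoothnessOrder (f : ℝ → ℝ) : ℕ∞ :=
  ⨅ (r : ℕ) (_ : 1 ≤ r ∧ iteratedDeriv (2 * r - 1) f 0 ≠ 0), (r : ℕ∞)

/-- The kernel matrix `[κ_ε(x_i, x_j)] = [f(ε ‖x_i - x_j‖)]`. -/
noncomputable def kernelMatrix {d n : ℕ} (f : ℝ → ℝ) (x : Fin n → EuclideanSpace ℝ (Fin d))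
    (ε : ℝ) : Matrix (Fin n) (Fin n) ℝ :=
  Matrix.of fun i j => f (ε * ‖x i - x j‖)

/-- The matrix `D^{(p)} = [‖x_i - x_j‖^p]`. -/
noncomputable def distPowMatrix {d n : ℕ} (x : Fin n → EuclideanSpace ℝ (Fin d)) (p : ℕ) :
    Matrix (Fin n) (Fin n) ℝ :=
  Matrix.of fun i j => ‖x i - x j‖ ^ p

/-! ### Multi-indices, Vandermonde matrices, magic numbers -/

/-- The multi-indices of total degree `< k`. -/
def multiIdxLT (d k : ℕ) : Finset (Fin d → ℕ) :=
  (Fintype.piFinset fun _ : Fin d => Finset.range k).filter fun α => ∑ i, α i < k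

/-- The multi-indices of total degree exactly `k`. -/
def multiIdxEq (d k : ℕ) : Finset (Fin d → ℕ) :=
  (multiIdxLT d (k + 1)).filter fun α => ∑ i, α i = k

theorem mem_multiIdxLT {d k : ℕ} {α : Fin d → ℕ} : α ∈ multiIdxLT d k ↔ ∑ i, α i < k := by
  simp only [multiIdxLT, Finset.mem_filter, Fintype.mem_piFinset, Finset.mem_range,
    and_iff_right_iff_imp]
  exact fun h i => lt_of_le_of_lt
    (Finset.single_le_sum (f := α) (fun j _ => Nat.zero_le _) (Finset.mem_univ i)) h

theorem mem_multiIdxEq {d k : ℕ} {α : Fin d → ℕ} : α ∈ multiIdxEq d k ↔ ∑ i, α i = k := by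
  simp only [multiIdxEq, Finset.mem_filter, mem_multiIdxLT]
  omega

/-- The block of the Vandermonde matrix of the points `x` with columns (monomials) in `S`. -/
noncomputable def vandermondeBlock {d n : ℕ} (x : Fin n → EuclideanSpace ℝ (Fin d))
    (S : Finset (Fin d → ℕ)) : Matrix (Fin n) S ℝ :=
  Matrix.of fun i α => ∏ j, x i j ^ α.1 j

/-- `V_{<k}`; in particular `V_{≤k}` is `vandermondeLT x (k + 1)`. -/
noncomputable def vandermondeLT {d n : ℕ} (x : Fin n → EuclideanSpace ℝ (Fin d)) (k : ℕ) :
    Matrix (Fin n) (multiIdxLT d k) ℝ :=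
  vandermondeBlock x (multiIdxLT d k)

/-- `V_k`. -/
noncomputable def vandermondeEq {d n : ℕ} (x : Fin n → EuclideanSpace ℝ (Fin d)) (k : ℕ) :
    Matrix (Fin n) (multiIdxEq d k) ℝ :=
  vandermondeBlock x (multiIdxEq d k)

/-- `P_{k,d}`, the number of monomials of degree at most `k` in `d` variables. -/
def polyDim (d k : ℕ) : ℕ := (k + d).choose d

/-- `P_{r-1,d}` for a smoothness order `r ∈ {1, 2, …, ∞}`, with `P_{∞,d} = ∞`. -/
noncomputable def polyDimBelow (d : ℕ) (r : ℕ∞) : ℕ∞ :=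
  ENat.recTopCoe (C := fun _ => ℕ∞) ⊤ (fun s : ℕ => (polyDim d (s - 1) : ℕ∞)) r

/-- The magic numbers in dimension `d`. -/
def magicNumbers (d : ℕ) : Set ℕ := Set.range (polyDim d)

/-! ### The Wronskian matrix -/

/-- The partial derivative `∂^α g = ∂₁^{α₁} ⋯ ∂_d^{α_d} g`. -/
noncomputable def multiDeriv {d : ℕ} (α : Fin d → ℕ) (g : EuclideanSpace ℝ (Fin d) → ℝ) :
    EuclideanSpace ℝ (Fin d) → ℝ :=
  (List.finRange d).foldr
    (fun i h => (fun (u : EuclideanSpace ℝ (Fin d) → ℝ) y =>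
      lineDeriv ℝ u y (EuclideanSpace.single i 1))^[α i] h) g

/-- The block `[κ^{(α,β)}(0,0) / (α! β!)]` of the Wronskian matrix with rows in `S` and columns in
`T`; here `α` refers to the first argument of `κ` and `β` to the second one. -/
noncomputable def wronskianBlock {d : ℕ}
    (κ : EuclideanSpace ℝ (Fin d) → EuclideanSpace ℝ (Fin d) → ℝ) (S T : Finset (Fin d → ℕ)) :
    Matrix S T ℝ :=
  Matrix.of fun α β =>
    multiDeriv α.1 (fun x => multiDeriv β.1 (fun y => κ x y) 0) 0 /
      ((∏ i, ((α.1 i).factorial : ℝ)) * ∏ i, ((β.1 i).factorial : ℝ))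

/-- `W_{<k}`; in particular `W_{≤k}` is `wronskianLT κ (k + 1)`. -/
noncomputable def wronskianLT {d : ℕ}
    (κ : EuclideanSpace ℝ (Fin d) → EuclideanSpace ℝ (Fin d) → ℝ) (k : ℕ) :
    Matrix (multiIdxLT d k) (multiIdxLT d k) ℝ :=
  wronskianBlock κ (multiIdxLT d k) (multiIdxLT d k)

/-- The Schur complement of the block `W_{<k}` in `W_{≤k}`. -/
noncomputable def wronskianSchur {d : ℕ}
    (κ : EuclideanSpace ℝ (Fin d) → EuclideanSpace ℝ (Fin d) → ℝ) (k : ℕ) :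
    Matrix (multiIdxEq d k) (multiIdxEq d k) ℝ :=
  wronskianBlock κ (multiIdxEq d k) (multiIdxEq d k) -
    wronskianBlock κ (multiIdxEq d k) (multiIdxLT d k) * (wronskianLT κ k)⁻¹ *
      wronskianBlock κ (multiIdxLT d k) (multiIdxEq d k)

/-! ### Fixed-size (extended) L-ensembles

The law of a random subset of `Fin n` is given by its probability mass function
`Finset (Fin n) → ℝ`. -/

/-- `p` is a probability mass function. -/
def IsProbMass {n : ℕ} (p : Finset (Fin n) → ℝ) : Prop :=
  (∀ A, 0 ≤ p A) ∧ ∑ A, p A = 1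

/-- The mass function proportional to `w` on the subsets of size `m`. If the sum of the weights
vanishes this is not a probability mass function, see `IsProbMass`. -/
noncomputable def fixedSizeMass {n : ℕ} (m : ℕ) (w : Finset (Fin n) → ℝ) (X : Finset (Fin n)) : ℝ :=
  if X.card = m then w X / ∑ Y ∈ Finset.univ.powersetCard m, w Y else 0

/-- The fixed-size L-ensemble `|DPP|_m(L)`: the mass of a set `X` of size `m` is proportional to
`det L_X`. -/
noncomputable def fixedSizeLEnsemble {n : ℕ} (m : ℕ) (L : Matrix (Fin n) (Fin n) ℝ) :
    Finset (Fin n) → ℝ :=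
  fixedSizeMass m fun X => (L.submatrix (Subtype.val : X → Fin n) (Subtype.val : X → Fin n)).det

/-- The fixed-size extended L-ensemble `|DPP|_m ⟨L ; V⟩`: the mass of a set `X` of size `m` is
proportional to the determinant of the block matrix `[L_X, V_X; V_Xᵀ, 0]`. -/
noncomputable def fixedSizeExtLEnsemble {n : ℕ} {ι : Type*} [Fintype ι] [DecidableEq ι] (m : ℕ)
    (L : Matrix (Fin n) (Fin n) ℝ) (V : Matrix (Fin n) ι ℝ) : Finset (Fin n) → ℝ :=
  fixedSizeMass m fun X =>
    (Matrix.fromBlocks (L.submatrix (Subtype.val : X → Fin n) (Subtype.val : X → Fin n))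
      (V.submatrix (Subtype.val : X → Fin n) id)
      (V.submatrix (Subtype.val : X → Fin n) id)ᵀ 0).det

/-- A nonnegative pair `⟨L ; V⟩`: `V` has full column rank, and `L` is symmetric and conditionally
positive semidefinite with respect to `V`. -/
def IsNonnegPair {n : ℕ} {ι : Type*} (L : Matrix (Fin n) (Fin n) ℝ)
    (V : Matrix (Fin n) ι ℝ) : Prop :=
  LinearIndependent ℝ V.col ∧ L.IsSymm ∧
    ∀ c : Fin n → ℝ, Vᵀ *ᵥ c = 0 → 0 ≤ c ⬝ᵥ (L *ᵥ c)

/-- Convergence in law of random subsets as `ε → 0`, `ε > 0`. All laws involved (for small `ε`) are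
required to be genuine probability laws. -/
def ConvergesInLaw {n : ℕ} (p : ℝ → Finset (Fin n) → ℝ) (q : Finset (Fin n) → ℝ) : Prop :=
  (∀ᶠ ε in 𝓝[>] (0 : ℝ), IsProbMass (p ε)) ∧ IsProbMass q ∧
    ∀ A, Tendsto (fun ε => p ε A) (𝓝[>] (0 : ℝ)) (𝓝 (q A))

/-! ### Convergence of fixed-size laws -/

/-! Everything rests on one expansion. Even powers of `‖x - y‖` are polynomials in `x` and `y`, and
for `R ≤ r` the odd powers below `2R - 1` are absent. So `f ‖x - y‖` is a polynomial of total degree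
`< 2R - 1`, whose coefficients are the Wronskian entries, plus `‖x - y‖ ^ (2R - 1) * ψ ‖x - y‖` with
`ψ 0 = f_{2R-1}` (`exists_kernelExpansion`). At the points `ε x_i`, completing the square over the
monomials of degree `< R` gives `L_ε = A M Aᵀ + ε ^ (2R - 1) T`, where `A → V_{<R}`, `M = Δ W_{<R}
Δ` with `Δ = diag (ε ^ |α|)`, and `T → f_{2R-1} D^{(2R-1)}`
(`KernelExpansion.exists_decomposition`).

For an `m`-subset `X`, the determinant of `A M Aᵀ + η T` restricted to `X` is a factor independent
of `X` times a bordered determinant with corner `-η M⁻¹` (`det_low_rank_add_smul`). The factor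
cancels on normalisation and the corner tends to `0`, so the laws converge to the extended ensemble
as soon as one limiting weight is nonzero (`convergesInLaw_of_low_rank_add`). For that it suffices
that the rows of `V` in `X` determine the coefficients and that the limiting form is definite on the
weights supported on `X` and annihilated by `Vᵀ` (`extWeight_ne_zero`). At a magic number `R = k +
1`, the border is square and the determinant forgets `T`. Between magic numbers `R = k + 1` again,
but block elimination in `W_{≤k}` moves the Schur complement into `T` and `η = ε ^ (2k)`. Above
`P_{r-1,d}` one takes `R = r`.

For finite `r`, three facts must be extracted from positive semidefiniteness of the kernel alone:
the sign of `f_{2r-1}`, strict conditional definiteness of `D^{(2r-1)}`, and definiteness of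
`W_{<r}`. The tool is to test the kernel on weighted points `ε y_i`: the form is a truncated
Wronskian form in the scaled moments plus `ε ^ (2R - 1)` times a distance form, and one compares
orders as `ε → 0` (`KernelExpansion.nonneg_of_truncForm_eq`).

The sign comes from weights on a line, where the distance form is a finite difference of `|t| ^ (2r
- 1)`, positive because it is a value of a B-spline. Strictness is Cauchy–Schwarz: a null weight `c`
pairs to zero with all fine differences, so `∑ c_i ‖y_i - ·‖ ^ (2r - 1)` cannot be singular at any
`y_i`. For the Wronskian, a null vector of top degree `l` would make the distance form nonnegative
on weights whose moments of degree `l` are nonzero. Concentrating these near the origin against a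
difference along a line forces the degree-`l` term of `∑ c_i ‖δ y_i - X‖ ^ (2r - 1)` to vanish on
the unit sphere. That term is a positive definite zonal pairing, so the moments of degree `l`
vanish, a contradiction (`KernelExpansion.eq_zero_of_wronskian_eq_zero`). -/

theorem sum_fixedSizeMass {n m : ℕ} (w : Finset (Fin n) → ℝ)
    (h : ∑ Y ∈ Finset.univ.powersetCard m, w Y ≠ 0) : ∑ A, fixedSizeMass m w A = 1 := by
  have h1 : ∑ A, fixedSizeMass m w A = ∑ A ∈ Finset.univ.powersetCard m,
      w A / ∑ Y ∈ Finset.univ.powersetCard m, w Y := by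
    unfold fixedSizeMass
    rw [← Finset.sum_filter]
    refine Finset.sum_congr ?_ fun _ _ => rfl
    ext A
    simp [Finset.mem_powersetCard]
  rw [h1, ← Finset.sum_div, div_self h]

/-- The prefactor `c ε` cancels on normalisation, so its sign may be unknown. What survives of `0 ≤
w` is that products `b X * b Y = w X * w Y / c ^ 2` are nonnegative; hence all limit weights share
one sign, and a single nonzero one keeps the normaliser away from `0`. -/
theorem convergesInLaw_fixedSizeMass {n m : ℕ} {w b : ℝ → Finset (Fin n) → ℝ}
    {b₀ : Finset (Fin n) → ℝ} (c : ℝ → ℝ)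
    (hw : ∀ᶠ ε in 𝓝[>] (0 : ℝ), ∀ X, 0 ≤ w ε X)
    (hwb : ∀ᶠ ε in 𝓝[>] (0 : ℝ), c ε ≠ 0 ∧ ∀ X, X.card = m → w ε X = c ε * b ε X)
    (hb : ∀ X, X.card = m → Tendsto (fun ε => b ε X) (𝓝[>] (0 : ℝ)) (𝓝 (b₀ X)))
    (hX : ∃ X : Finset (Fin n), X.card = m ∧ b₀ X ≠ 0) :
    ConvergesInLaw (fun ε => fixedSizeMass m (w ε)) (fixedSizeMass m b₀) := by
  classical
  set S : Finset (Finset (Fin n)) := Finset.univ.powersetCard m with hS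
  have hmem : ∀ X, X ∈ S ↔ X.card = m := by intro X; simp [hS, Finset.mem_powersetCard]
  have hbb : ∀ X Y, X.card = m → Y.card = m → 0 ≤ b₀ X * b₀ Y := by
    intro X Y hX hY
    refine ge_of_tendsto ((hb X hX).mul (hb Y hY)) ?_
    filter_upwards [hw, hwb] with ε h1 h2
    have hx := h2.2 X hX ▸ h1 X
    have hy := h2.2 Y hY ▸ h1 Y
    have hc : 0 < c ε ^ 2 := by have := h2.1; positivity
    have : 0 ≤ c ε ^ 2 * (b ε X * b ε Y) := by
      have := mul_nonneg hx hy
      nlinarith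
    exact nonneg_of_mul_nonneg_right this hc
  have hsum : Tendsto (fun ε => ∑ Y ∈ S, b ε Y) (𝓝[>] (0 : ℝ)) (𝓝 (∑ Y ∈ S, b₀ Y)) :=
    tendsto_finsetSum _ fun Y hY => hb Y ((hmem Y).1 hY)
  have hne : ∑ Y ∈ S, b₀ Y ≠ 0 := by
    obtain ⟨X, hXm, hX0⟩ := hX
    intro h0
    have h1 : 0 < ∑ Y ∈ S, b₀ X * b₀ Y :=
      Finset.sum_pos' (fun Y hY => hbb X Y hXm ((hmem Y).1 hY))
        ⟨X, (hmem X).2 hXm, mul_self_pos.2 hX0⟩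
    rw [← Finset.mul_sum, h0, mul_zero] at h1
    exact lt_irrefl _ h1
  have hev := hsum.eventually_ne hne
  have hprob : ∀ᶠ ε in 𝓝[>] (0 : ℝ), IsProbMass (fixedSizeMass m (w ε)) := by
    filter_upwards [hw, hwb, hev] with ε h1 h2 h3
    refine ⟨fun A => ?_, sum_fixedSizeMass _ ?_⟩
    · unfold fixedSizeMass
      split_ifs
      · exact div_nonneg (h1 A) (Finset.sum_nonneg fun Y _ => h1 Y)
      · exact le_rfl
    · rw [Finset.sum_congr rfl fun Y hY => h2.2 Y ((hmem Y).1 hY), ← Finset.mul_sum]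
      exact mul_ne_zero h2.1 h3
  have hlim : ∀ A, Tendsto (fun ε => fixedSizeMass m (w ε) A) (𝓝[>] (0 : ℝ))
      (𝓝 (fixedSizeMass m b₀ A)) := by
    intro A
    by_cases hA : A.card = m
    · simp only [fixedSizeMass, hA, if_true]
      refine ((hb A hA).div hsum hne).congr' ?_
      filter_upwards [hwb, hev] with ε h2 h3
      rw [Finset.sum_congr rfl fun Y hY => h2.2 Y ((hmem Y).1 hY), ← Finset.mul_sum, h2.2 A hA]
      simp only [Pi.div_apply]
      rw [mul_div_mul_left _ _ h2.1]
    · simp only [fixedSizeMass, hA, if_false]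
      exact tendsto_const_nhds
  refine ⟨hprob, ⟨fun A => ge_of_tendsto (hlim A) ?_, sum_fixedSizeMass _ hne⟩, hlim⟩
  filter_upwards [hprob] with ε h using h.1 A

theorem fixedSizeMass_congr {n m : ℕ} {w w' : Finset (Fin n) → ℝ} {c : ℝ} (hc : c ≠ 0)
    (h : ∀ X, X.card = m → w X = c * w' X) : fixedSizeMass m w = fixedSizeMass m w' := by
  funext X
  unfold fixedSizeMass
  split_ifs with hX
  · have : ∑ Y ∈ Finset.univ.powersetCard m, w Y
        = c * ∑ Y ∈ Finset.univ.powersetCard m, w' Y := by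
      rw [Finset.mul_sum]
      exact Finset.sum_congr rfl fun Y hY => h Y (Finset.mem_powersetCard.1 hY).2
    rw [this, h X hX, mul_div_mul_left _ _ hc]
  · rfl

/-! ### Bordered determinants -/

/-- This is the Schur complement with respect to the corner `-(η • M⁻¹)`, whose inverse is `-(η⁻¹ •
M)`. The degenerate scale is isolated in `det M` and powers of `η`; the remaining determinant is
still meaningful when the corner is `0`. -/
theorem det_low_rank_add_smul {κ ι : Type*} [Fintype κ] [DecidableEq κ] [Fintype ι] [DecidableEq ι]
    (A : Matrix κ ι ℝ) (M : Matrix ι ι ℝ) (hM : IsUnit M.det) (T : Matrix κ κ ℝ) {η : ℝ}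
    (hη : η ≠ 0) :
    (A * M * Aᵀ + η • T).det =
      (-1) ^ Fintype.card ι * M.det * η ^ Fintype.card κ * (η ^ Fintype.card ι)⁻¹ *
        (Matrix.fromBlocks T A Aᵀ (-(η • M⁻¹))).det := by
  have hD : IsUnit (-(η • M⁻¹)).det := by
    rw [Matrix.det_neg, Matrix.det_smul, Matrix.det_nonsing_inv, Ring.inverse_eq_inv']
    have : M.det ≠ 0 := hM.ne_zero
    refine IsUnit.mk0 _ ?_
    positivity
  let _ : Invertible (-(η • M⁻¹)) := Matrix.invertibleOfIsUnitDet _ hD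
  have hinv : ⅟(-(η • M⁻¹)) = -(η⁻¹ • M) := by
    refine invOf_eq_right_inv ?_
    rw [neg_mul_neg, Matrix.smul_mul, Matrix.mul_smul, smul_smul, mul_inv_cancel₀ hη, one_smul,
      Matrix.nonsing_inv_mul _ hM]
  rw [Matrix.det_fromBlocks₂₂, hinv]
  have h1 : T - A * (-(η⁻¹ • M)) * Aᵀ = η⁻¹ • (A * M * Aᵀ + η • T) := by
    rw [smul_add, smul_smul, inv_mul_cancel₀ hη, one_smul]
    simp [Matrix.mul_neg, Matrix.neg_mul, add_comm]
  rw [h1, Matrix.det_neg, Matrix.det_smul, Matrix.det_smul, Matrix.det_nonsing_inv,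
    Ring.inverse_eq_inv']
  have hM0 : M.det ≠ 0 := hM.ne_zero
  have h2 : ((-1 : ℝ) ^ Fintype.card ι) * (-1) ^ Fintype.card ι = 1 := by
    rw [← mul_pow]; simp
  field_simp
  rw [pow_two, h2, mul_one, one_div, inv_pow, mul_assoc, mul_inv_cancel₀ (pow_ne_zero _ hη),
    mul_one]

/-- The weights of an extended L-ensemble. -/
noncomputable def extWeight {n : ℕ} {ι : Type*} [Fintype ι] [DecidableEq ι]
    (L : Matrix (Fin n) (Fin n) ℝ) (V : Matrix (Fin n) ι ℝ) (X : Finset (Fin n)) : ℝ :=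
  (Matrix.fromBlocks (L.submatrix (Subtype.val : X → Fin n) (Subtype.val : X → Fin n))
      (V.submatrix (Subtype.val : X → Fin n) id)
      (V.submatrix (Subtype.val : X → Fin n) id)ᵀ 0).det

/-- The engine behind all three regimes: the low-rank part dominates `η` on the range of `V`, and
`H` is what is left at scale `η`. -/
theorem convergesInLaw_of_low_rank_add {n m : ℕ} {ι : Type*} [Fintype ι] [DecidableEq ι]
    {L T : ℝ → Matrix (Fin n) (Fin n) ℝ} {A : ℝ → Matrix (Fin n) ι ℝ} {M : ℝ → Matrix ι ι ℝ}
    {η : ℝ → ℝ} {H : Matrix (Fin n) (Fin n) ℝ} {V : Matrix (Fin n) ι ℝ}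
    (hL : ∀ᶠ ε in 𝓝[>] (0 : ℝ), (L ε).PosSemidef)
    (hdec : ∀ᶠ ε in 𝓝[>] (0 : ℝ), L ε = A ε * M ε * (A ε)ᵀ + η ε • T ε)
    (hM : ∀ᶠ ε in 𝓝[>] (0 : ℝ), IsUnit (M ε).det ∧ η ε ≠ 0)
    (hA : Tendsto A (𝓝[>] 0) (𝓝 V)) (hT : Tendsto T (𝓝[>] 0) (𝓝 H))
    (hηM : Tendsto (fun ε => η ε • (M ε)⁻¹) (𝓝[>] 0) (𝓝 0))
    (hX : ∃ X : Finset (Fin n), X.card = m ∧ extWeight H V X ≠ 0) :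
    ConvergesInLaw (fun ε => fixedSizeLEnsemble m (L ε)) (fixedSizeMass m (extWeight H V)) := by
  refine convergesInLaw_fixedSizeMass
    (b := fun ε X => (Matrix.fromBlocks
      ((T ε).submatrix (Subtype.val : X → Fin n) (Subtype.val : X → Fin n))
      ((A ε).submatrix (Subtype.val : X → Fin n) id)
      ((A ε).submatrix (Subtype.val : X → Fin n) id)ᵀ (-(η ε • (M ε)⁻¹))).det)
    (fun ε => (-1) ^ Fintype.card ι * (M ε).det * η ε ^ m * (η ε ^ Fintype.card ι)⁻¹) ?_ ?_ ?_ hX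
  · filter_upwards [hL] with ε h X
    exact (h.submatrix _).det_nonneg
  · filter_upwards [hdec, hM] with ε h1 h2
    refine ⟨?_, fun X hX => ?_⟩
    · have := h2.1.ne_zero
      have := h2.2
      positivity
    · have := det_low_rank_add_smul ((A ε).submatrix (Subtype.val : X → Fin n) id) (M ε) h2.1
        ((T ε).submatrix (Subtype.val : X → Fin n) (Subtype.val : X → Fin n)) h2.2
      rw [Fintype.card_coe, hX] at this
      rw [← this, h1]
      rfl
  · intro X _
    have hc : Continuous fun p : Matrix (Fin n) (Fin n) ℝ × Matrix (Fin n) ι ℝ × Matrix ι ι ℝ =>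
        (Matrix.fromBlocks
          (p.1.submatrix (Subtype.val : X → Fin n) (Subtype.val : X → Fin n))
          (p.2.1.submatrix (Subtype.val : X → Fin n) id)
          (p.2.1.submatrix (Subtype.val : X → Fin n) id)ᵀ (-p.2.2)).det := by
      refine Continuous.matrix_det (Continuous.matrix_fromBlocks ?_ ?_ ?_ ?_)
      · exact continuous_fst.matrix_submatrix _ _
      · exact (continuous_fst.comp continuous_snd).matrix_submatrix _ _
      · exact ((continuous_fst.comp continuous_snd).matrix_submatrix _ _).matrix_transpose
      · exact (continuous_snd.comp continuous_snd).neg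
    have := (hc.tendsto (H, V, 0)).comp (hT.prodMk_nhds (hA.prodMk_nhds hηM))
    simpa [extWeight, Function.comp_def] using this

/-- For a kernel vector `(c, a)` one has `Vᵀ c = 0`, and `H c + V a = 0` on `X`. Pairing with `c`
removes `a`, so the form of `H` vanishes at `c`; then `c = 0`, and `V a = 0` on `X` gives `a = 0`.
-/
theorem extWeight_ne_zero {n : ℕ} {ι : Type*} [Fintype ι] [DecidableEq ι]
    {H : Matrix (Fin n) (Fin n) ℝ} {V : Matrix (Fin n) ι ℝ} {X : Finset (Fin n)}
    (hV : ∀ a : ι → ℝ, (∀ i ∈ X, (V *ᵥ a) i = 0) → a = 0)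
    (hH : ∀ c : Fin n → ℝ, (∀ i ∉ X, c i = 0) → Vᵀ *ᵥ c = 0 → c ⬝ᵥ (H *ᵥ c) = 0 → c = 0) :
    extWeight H V X ≠ 0 := by
  classical
  unfold extWeight
  intro h0
  obtain ⟨v, hv0, hv⟩ := Matrix.exists_mulVec_eq_zero_iff.2 h0
  apply hv0
  obtain ⟨c, a, rfl⟩ : ∃ (c : X → ℝ) (a : ι → ℝ), v = Sum.elim c a :=
    ⟨v ∘ Sum.inl, v ∘ Sum.inr, by simp⟩
  rw [Matrix.fromBlocks_mulVec] at hv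
  have h1 := congrArg (fun u => u ∘ Sum.inl) hv
  have h2 := congrArg (fun u => u ∘ Sum.inr) hv
  simp only [Sum.elim_comp_inl, Sum.elim_comp_inr, Sum.elim_comp_inl, Matrix.zero_mulVec,
    add_zero] at h1 h2
  set c' : Fin n → ℝ := fun i => if h : i ∈ X then c ⟨i, h⟩ else 0 with hc'
  have hsum : ∀ g : Fin n → ℝ, ∑ i, g i * c' i = ∑ i : X, g i * c i := by
    intro g
    rw [← Finset.sum_subset (Finset.subset_univ X) (fun i _ hi => by simp [hc', hi]),
      ← Finset.sum_coe_sort X]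
    refine Finset.sum_congr rfl fun i _ => ?_
    simp [hc']
  have hV' : Vᵀ *ᵥ c' = 0 := by
    funext j
    have := congrFun h2 j
    simp only [Matrix.mulVec, dotProduct, Matrix.transpose_apply, Matrix.submatrix_apply, id,
      Function.comp, Pi.zero_apply] at this ⊢
    rw [hsum, this]
  have hrow : ∀ i : X, (H *ᵥ c') i + (V *ᵥ a) i = 0 := by
    intro i
    have := congrFun h1 i
    simp only [Matrix.mulVec, dotProduct, Matrix.submatrix_apply, id,
      Function.comp, Pi.zero_apply, Pi.add_apply] at this ⊢
    rw [hsum, this]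
  have hq : c' ⬝ᵥ (H *ᵥ c') = 0 := by
    have e1 : c' ⬝ᵥ (H *ᵥ c') = - (c' ⬝ᵥ (V *ᵥ a)) := by
      simp only [dotProduct]
      rw [← Finset.sum_neg_distrib]
      refine Finset.sum_congr rfl fun i _ => ?_
      by_cases hi : i ∈ X
      · have := hrow ⟨i, hi⟩
        simp only at this
        rw [eq_neg_of_add_eq_zero_left this]; ring
      · simp [hc', hi]
    rw [e1, Matrix.dotProduct_mulVec, ← Matrix.mulVec_transpose, hV', zero_dotProduct, neg_zero]
  have hc0 : c' = 0 := hH c' (fun i hi => by simp [hc', hi]) hV' hq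
  have hcz : c = 0 := by
    funext i
    have := congrFun hc0 i
    simpa [hc'] using this
  have ha : a = 0 := by
    refine hV a fun i hi => ?_
    have := hrow ⟨i, hi⟩
    simpa [hc0] using this
  rw [hcz, ha]
  ext (i | i) <;> rfl

/-! ### Selection of rows -/

/-- A maximal independent set of rows spans the row space; a vector orthogonal to these rows is
orthogonal to all rows. -/
theorem exists_rows_of_linearIndependent_col {n : ℕ} {ι : Type*} [Fintype ι] [DecidableEq ι]
    (V : Matrix (Fin n) ι ℝ) (hV : LinearIndependent ℝ V.col) :
    ∃ s : Finset (Fin n), s.card = Fintype.card ι ∧ LinearIndepOn ℝ V.row s ∧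
      ∀ a : ι → ℝ, (∀ i ∈ s, (V *ᵥ a) i = 0) → a = 0 := by
  classical
  obtain ⟨b, -, -, hspan, hb⟩ := exists_linearIndepOn_extension
    (linearIndepOn_empty ℝ V.row) (Set.empty_subset Set.univ)
  have hle : ∀ i, V.row i ∈ Submodule.span ℝ (V.row '' b) := fun i =>
    hspan ⟨i, trivial, rfl⟩
  refine ⟨b.toFinset, ?_, by simpa using hb, fun a ha => ?_⟩
  · have h1 : V.rank = Fintype.card ι := by
      rw [Matrix.rank_eq_finrank_span_cols, finrank_span_eq_card hV]
    have h2 : Submodule.span ℝ (Set.range V.row) = Submodule.span ℝ (V.row '' b) := by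
      refine le_antisymm (Submodule.span_le.2 ?_) (Submodule.span_mono (Set.image_subset_range _ _))
      rintro _ ⟨i, rfl⟩
      exact hle i
    rw [Matrix.rank_eq_finrank_span_row, h2] at h1
    have h3 := finrank_span_eq_card hb
    rw [← h1, Set.toFinset_card, ← h3, Set.image_eq_range]
  · have h0 : ∀ i, V.row i ⬝ᵥ a = 0 := by
      intro i
      have : V.row i ∈ LinearMap.ker (LinearMap.flip (dotProductBilin ℝ ℝ) a) := by
        refine (Submodule.span_le.2 ?_) (hle i)
        rintro _ ⟨j, hj, rfl⟩
        exact ha j (by simpa using hj)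
      simpa using this
    exact (Matrix.mulVec_injective_iff.2 hV) (by funext i; rw [Matrix.mulVec_zero]; exact h0 i)

/-- The columns of `V` occur among those of `W`, so rows independent in `V` stay independent in `W`.
Extend such a choice to a basis of the row space of `W`, then trim it to size `m` while keeping the
original rows. -/
theorem exists_rows_of_le_rank {n m : ℕ} {ι κ : Type*} [Fintype ι] [DecidableEq ι] [Fintype κ]
    [DecidableEq κ] (V : Matrix (Fin n) ι ℝ) (W : Matrix (Fin n) κ ℝ) (g : ι → κ)
    (hg : ∀ i j, V i j = W i (g j)) (hV : LinearIndependent ℝ V.col)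
    (hm : Fintype.card ι ≤ m) (hmW : m ≤ W.rank) :
    ∃ X : Finset (Fin n), X.card = m ∧ LinearIndepOn ℝ W.row X ∧
      ∀ a : ι → ℝ, (∀ i ∈ X, (V *ᵥ a) i = 0) → a = 0 := by
  classical
  obtain ⟨s, hs, hsi, hsa⟩ := exists_rows_of_linearIndependent_col V hV
  have hsW : LinearIndepOn ℝ W.row s := by
    refine LinearIndependent.of_comp (LinearMap.funLeft ℝ ℝ g) ?_
    have h1 : LinearMap.funLeft ℝ ℝ g ∘ (fun x : (s : Set (Fin n)) => W.row x)
        = fun x : (s : Set (Fin n)) => V.row x := by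
      ext i j
      exact (hg i j).symm
    rw [h1]
    exact hsi
  obtain ⟨b, -, hsb, hspan, hb⟩ := exists_linearIndepOn_extension hsW (Set.subset_univ _)
  have h2 : Submodule.span ℝ (Set.range W.row) = Submodule.span ℝ (W.row '' b) := by
    refine le_antisymm (Submodule.span_le.2 ?_) (Submodule.span_mono (Set.image_subset_range _ _))
    rintro _ ⟨i, rfl⟩
    exact hspan ⟨i, trivial, rfl⟩
  have hcard : b.toFinset.card = W.rank := by
    have h3 := finrank_span_eq_card hb
    rw [Matrix.rank_eq_finrank_span_row, h2, Set.toFinset_card, ← h3, Set.image_eq_range]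
  obtain ⟨X, hsX, hXb, hX⟩ := Finset.exists_subsuperset_card_eq (s := s) (t := b.toFinset)
    (by intro i hi; simpa using hsb hi) (hs.trans_le hm) (hmW.trans hcard.ge)
  refine ⟨X, hX, hb.mono (by intro i hi; simpa using hXb hi), fun a ha => hsa a fun i hi => ?_⟩
  exact ha i (hsX hi)

theorem exists_rows_superset {n m : ℕ} {ι : Type*} [Fintype ι] [DecidableEq ι]
    (V : Matrix (Fin n) ι ℝ) (hV : LinearIndependent ℝ V.col) (hm : Fintype.card ι ≤ m)
    (hmn : m ≤ n) :
    ∃ X : Finset (Fin n), X.card = m ∧ ∀ a : ι → ℝ, (∀ i ∈ X, (V *ᵥ a) i = 0) → a = 0 := by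
  obtain ⟨s, hs, -, hsa⟩ := exists_rows_of_linearIndependent_col V hV
  obtain ⟨X, hsX, -, hX⟩ := Finset.exists_subsuperset_card_eq (Finset.subset_univ s)
    (hs.trans_le hm) (by simpa using hmn)
  exact ⟨X, hX, fun a ha => hsa a fun i hi => ha i (hsX hi)⟩

/-! ### Square bordered determinants -/

/-- Swapping the two block columns makes the matrix block triangular, and `H` drops out of the
determinant. This is why the limit at a magic number does not depend on the kernel. -/
theorem det_fromBlocks_mul_zero {κ : Type*} [Fintype κ] [DecidableEq κ] (H U : Matrix κ κ ℝ) :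
    (Matrix.fromBlocks H U Uᵀ 0).det = (-1) ^ Fintype.card κ * (U * Uᵀ).det := by
  have h1 : Matrix.fromBlocks H U Uᵀ 0 * Matrix.fromBlocks 0 (1 : Matrix κ κ ℝ) 1 (0 : Matrix κ κ ℝ)
      = Matrix.fromBlocks U H 0 Uᵀ := by
    simp [Matrix.fromBlocks_multiply]
  have h2 : (Matrix.fromBlocks 0 (1 : Matrix κ κ ℝ) 1 (0 : Matrix κ κ ℝ)).det = (-1) ^ Fintype.card κ := by
    -- The determinant of the block swap: a unipotent factor turns it into a matrix with identity
    -- upper left block, whose Schur complement is `-1`.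
    have h3 : Matrix.fromBlocks (1 : Matrix κ κ ℝ) (1 : Matrix κ κ ℝ) 0 (1 : Matrix κ κ ℝ) *
        Matrix.fromBlocks 0 (1 : Matrix κ κ ℝ) (1 : Matrix κ κ ℝ) (0 : Matrix κ κ ℝ)
        = Matrix.fromBlocks 1 1 1 (0 : Matrix κ κ ℝ) := by
      simp [Matrix.fromBlocks_multiply]
    have h4 := congrArg Matrix.det h3
    rw [Matrix.det_mul, Matrix.det_fromBlocks_zero₂₁, Matrix.det_fromBlocks_one₁₁] at h4
    simpa [Matrix.det_neg] using h4
  have h5 := congrArg Matrix.det h1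
  rw [Matrix.det_mul, h2, Matrix.det_fromBlocks_zero₂₁] at h5
  have h6 : ((-1 : ℝ) ^ Fintype.card κ) * (-1) ^ Fintype.card κ = 1 := by rw [← mul_pow]; simp
  rw [Matrix.det_mul, ← h5, mul_comm, mul_assoc, h6, mul_one]

theorem extWeight_of_card_eq {n : ℕ} {ι : Type*} [Fintype ι] [DecidableEq ι]
    (H : Matrix (Fin n) (Fin n) ℝ) (V : Matrix (Fin n) ι ℝ) (X : Finset (Fin n))
    (hX : X.card = Fintype.card ι) :
    extWeight H V X = (-1) ^ Fintype.card ι *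
      ((V * Vᵀ).submatrix (Subtype.val : X → Fin n) (Subtype.val : X → Fin n)).det := by
  let e : X ≃ ι := Fintype.equivOfCardEq (by simpa using hX)
  set U : Matrix X X ℝ := V.submatrix Subtype.val e with hU
  have h1 : extWeight H V X = (Matrix.fromBlocks
      (H.submatrix (Subtype.val : X → Fin n) (Subtype.val : X → Fin n)) U Uᵀ 0).det := by
    unfold extWeight
    rw [← Matrix.det_submatrix_equiv_self ((Equiv.refl X).sumCongr e)]
    congr 1
    ext (i | i) (j | j) <;> simp [hU]
  have h2 : (V * Vᵀ).submatrix (Subtype.val : X → Fin n) (Subtype.val : X → Fin n) = U * Uᵀ := by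
    ext i j
    simp only [Matrix.submatrix_apply, Matrix.mul_apply, Matrix.transpose_apply, hU]
    exact (Equiv.sum_comp e fun k => V i k * V j k).symm
  rw [h1, h2, det_fromBlocks_mul_zero, Fintype.card_coe, hX]

/-- Up to a reindexing of columns `V = Q R` with `R` invertible, so every maximal minor is
multiplied by `R.det` and every weight by `R.det ^ 2`. -/
theorem fixedSizeLEnsemble_mul_transpose_of_span_eq {n m : ℕ} {ι : Type*} [Fintype ι]
    [DecidableEq ι] (V : Matrix (Fin n) ι ℝ) (Q : Matrix (Fin n) (Fin m) ℝ)
    (hV : LinearIndependent ℝ V.col) (hm : Fintype.card ι = m)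
    (h : Submodule.span ℝ (Set.range Q.col) = Submodule.span ℝ (Set.range V.col)) :
    fixedSizeLEnsemble m (V * Vᵀ) = fixedSizeLEnsemble m (Q * Qᵀ) := by
  let e : Fin m ≃ ι := (Fintype.equivFinOfCardEq hm).symm
  have hmem : ∀ j : Fin m, ∃ a : Fin m → ℝ, ∑ k, a k • Q.col k = V.col (e j) := by
    intro j
    have : V.col (e j) ∈ Submodule.span ℝ (Set.range Q.col) := by
      rw [h]; exact Submodule.subset_span ⟨_, rfl⟩
    exact (Submodule.mem_span_range_iff_exists_fun ℝ).1 this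
  choose a ha using hmem
  set R : Matrix (Fin m) (Fin m) ℝ := Matrix.of fun k j => a j k with hR
  have hVQ : V.submatrix id e = Q * R := by
    ext i j
    have := congrFun (ha j) i
    simp only [Finset.sum_apply, Pi.smul_apply, smul_eq_mul, Matrix.col_apply] at this
    simp only [Matrix.submatrix_apply, id, Matrix.mul_apply, hR, Matrix.of_apply, ← this]
    exact Finset.sum_congr rfl fun k _ => mul_comm _ _
  have hRdet : R.det ≠ 0 := by
    intro h0
    obtain ⟨v, hv0, hv⟩ := Matrix.exists_mulVec_eq_zero_iff.2 h0
    have h1 : (V.submatrix id e) *ᵥ v = 0 := by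
      rw [hVQ, ← Matrix.mulVec_mulVec, hv, Matrix.mulVec_zero]
    have h2 : LinearIndependent ℝ (V.submatrix id e).col := hV.comp e e.injective
    exact hv0 ((Matrix.mulVec_injective_iff.2 h2) (by simpa using h1))
  refine fixedSizeMass_congr (c := R.det ^ 2) (by positivity) fun X hX => ?_
  let g : X ≃ Fin m := Fintype.equivFinOfCardEq (by simpa using hX)
  have key : ∀ U : Matrix (Fin n) (Fin m) ℝ,
      ((U * Uᵀ).submatrix (Subtype.val : X → Fin n) (Subtype.val : X → Fin n)).det
        = (U.submatrix (fun j => ((g.symm j : X) : Fin n)) id).det ^ 2 := by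
    intro U
    have h1 : ((U * Uᵀ).submatrix (Subtype.val : X → Fin n) Subtype.val).submatrix g.symm g.symm
        = U.submatrix (fun j => ((g.symm j : X) : Fin n)) id *
          (U.submatrix (fun j => ((g.symm j : X) : Fin n)) id)ᵀ := rfl
    rw [← Matrix.det_submatrix_equiv_self g.symm, h1, Matrix.det_mul, Matrix.det_transpose,
      pow_two]
  have e1 : V * Vᵀ = V.submatrix id e * (V.submatrix id e)ᵀ := by
    ext i j
    simp only [Matrix.mul_apply, Matrix.transpose_apply, Matrix.submatrix_apply, id]
    exact (Equiv.sum_comp e fun k => V i k * V j k).symm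
  have e2 : (Q * R).submatrix (fun j => ((g.symm j : X) : Fin n)) id
      = Q.submatrix (fun j => ((g.symm j : X) : Fin n)) id * R := rfl
  rw [e1, key, key, hVQ, e2, Matrix.det_mul]
  ring

/-! ### Monomials and divided powers -/

/-- The monomial function `x ↦ x^α`. -/
noncomputable def monomialFun {d : ℕ} (α : Fin d → ℕ) (x : EuclideanSpace ℝ (Fin d)) : ℝ :=
  ∏ j, x j ^ α j

/-- The divided power `x ↦ x^α / α!`. -/
noncomputable def divPow {d : ℕ} (α : Fin d → ℕ) (x : EuclideanSpace ℝ (Fin d)) : ℝ :=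
  ∏ j, (x j ^ α j / (α j).factorial)

/-- The polynomial with Taylor coefficients `q`, truncated to total degree `< N`. -/
noncomputable def jetPoly {d : ℕ} (N : ℕ) (q : (Fin d → ℕ) → ℝ) (z : EuclideanSpace ℝ (Fin d)) :
    ℝ :=
  ∑ γ ∈ multiIdxLT d N, q γ * divPow γ z

theorem divPow_eq {d : ℕ} (α : Fin d → ℕ) (x : EuclideanSpace ℝ (Fin d)) :
    divPow α x = monomialFun α x / ∏ j, ((α j).factorial : ℝ) := by
  simp [divPow, monomialFun, Finset.prod_div_distrib]

theorem divPow_zero_left {d : ℕ} (x : EuclideanSpace ℝ (Fin d)) : divPow 0 x = 1 := by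
  simp [divPow]

theorem divPow_zero_right {d : ℕ} {α : Fin d → ℕ} (hα : α ≠ 0) :
    divPow α (0 : EuclideanSpace ℝ (Fin d)) = 0 := by
  obtain ⟨i, hi⟩ : ∃ i, α i ≠ 0 := by
    by_contra! h
    exact hα (funext h)
  exact Finset.prod_eq_zero (Finset.mem_univ i) (by simp [hi])

theorem sum_add_single {d : ℕ} (γ : Fin d → ℕ) (i : Fin d) :
    ∑ j, (γ + Pi.single i 1 : Fin d → ℕ) j = ∑ j, γ j + 1 := by
  simp [Finset.sum_add_distrib]

theorem sub_single_add_single {d : ℕ} {γ : Fin d → ℕ} {i : Fin d} (h : γ i ≠ 0) :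
    γ - Pi.single i 1 + Pi.single i 1 = γ := by
  funext j
  rcases eq_or_ne j i with rfl | hj
  · simp only [Pi.add_apply, Pi.sub_apply, Pi.single_eq_same]; omega
  · simp [hj]

theorem coord_mul_divPow {d : ℕ} (γ : Fin d → ℕ) (i : Fin d) (z : EuclideanSpace ℝ (Fin d)) :
    z i * divPow γ z = (γ i + 1) * divPow (γ + Pi.single i 1) z := by
  unfold divPow
  rw [← Finset.mul_prod_erase _ _ (Finset.mem_univ i), ← Finset.mul_prod_erase _ _
    (Finset.mem_univ i)]
  have : ∏ j ∈ Finset.univ.erase i, (z j ^ (γ + Pi.single i 1 : Fin d → ℕ) j /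
      (((γ + Pi.single i 1 : Fin d → ℕ) j).factorial : ℝ))
      = ∏ j ∈ Finset.univ.erase i, (z j ^ γ j / ((γ j).factorial : ℝ)) := by
    refine Finset.prod_congr rfl fun j hj => ?_
    simp [Finset.ne_of_mem_erase hj]
  rw [this]
  simp only [Pi.add_apply, Pi.single_eq_same, Nat.factorial_succ]
  push_cast
  have : ((γ i).factorial : ℝ) ≠ 0 := by positivity
  field_simp
  ring

theorem abs_divPow_le {d : ℕ} (γ : Fin d → ℕ) (z : EuclideanSpace ℝ (Fin d)) :
    |divPow γ z| ≤ ‖z‖ ^ ∑ j, γ j := by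
  unfold divPow
  rw [Finset.abs_prod, ← Finset.prod_pow_eq_pow_sum]
  refine Finset.prod_le_prod (fun _ _ => abs_nonneg _) fun j _ => ?_
  rw [abs_div, abs_pow, Nat.abs_cast]
  have h1 : |z j| ≤ ‖z‖ := by simpa using PiLp.norm_apply_le z j
  have h2 : (1 : ℝ) ≤ ((γ j).factorial : ℝ) := by exact_mod_cast (γ j).factorial_pos
  calc |z j| ^ γ j / ((γ j).factorial : ℝ) ≤ |z j| ^ γ j := div_le_self (by positivity) h2
    _ ≤ ‖z‖ ^ γ j := by gcongr

theorem hasDerivAt_add_pow_div_factorial (a : ℝ) (n : ℕ) :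
    HasDerivAt (fun t : ℝ => (a + t) ^ n / (n.factorial : ℝ))
      (if n = 0 then 0 else a ^ (n - 1) / ((n - 1).factorial : ℝ)) 0 := by
  rcases n with _ | n
  · simpa using hasDerivAt_const (0 : ℝ) (1 : ℝ)
  · have h1 : HasDerivAt (fun t : ℝ => a + t) 1 0 := by simpa using (hasDerivAt_id (0 : ℝ)).const_add a
    have h2 := (h1.fun_pow (n + 1)).div_const ((n + 1).factorial : ℝ)
    refine h2.congr_deriv ?_
    simp only [Nat.add_eq_zero_iff, one_ne_zero, and_false, if_false, add_tsub_cancel_right,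
      add_zero, mul_one, Nat.factorial_succ]
    have : (n.factorial : ℝ) ≠ 0 := by positivity
    push_cast
    field_simp

theorem hasLineDerivAt_divPow {d : ℕ} (γ : Fin d → ℕ) (i : Fin d) (z : EuclideanSpace ℝ (Fin d)) :
    HasLineDerivAt ℝ (divPow γ) (if γ i = 0 then 0 else divPow (γ - Pi.single i 1) z) z
      (EuclideanSpace.single i 1) := by
  unfold HasLineDerivAt
  have h1 : (fun t : ℝ => divPow γ (z + t • EuclideanSpace.single i 1)) = fun t : ℝ =>
      ((z i + t) ^ γ i / ((γ i).factorial : ℝ)) *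
        ∏ j ∈ Finset.univ.erase i, (z j ^ γ j / ((γ j).factorial : ℝ)) := by
    funext t
    unfold divPow
    rw [← Finset.mul_prod_erase _ _ (Finset.mem_univ i)]
    congr 1
    · simp
    · refine Finset.prod_congr rfl fun j hj => ?_
      simp [Finset.ne_of_mem_erase hj]
  rw [h1]
  refine ((hasDerivAt_add_pow_div_factorial (z i) (γ i)).mul_const _).congr_deriv ?_
  split_ifs with h
  · simp
  · unfold divPow
    rw [← Finset.mul_prod_erase _ _ (Finset.mem_univ i)]
    congr 1
    · simp
    · refine Finset.prod_congr rfl fun j hj => ?_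
      simp [Finset.ne_of_mem_erase hj]

/-- With divided powers, differentiation is a shift of the coefficient array. The hypothesis on `q`
makes the shifted coefficients of top degree vanish, so the same truncation `N` serves before and
after. -/
theorem hasLineDerivAt_jetPoly {d N : ℕ} {q : (Fin d → ℕ) → ℝ}
    (hq : ∀ γ, N ≤ ∑ j, γ j → q γ = 0) (i : Fin d) (z : EuclideanSpace ℝ (Fin d)) :
    HasLineDerivAt ℝ (jetPoly N q) (jetPoly N (fun γ => q (γ + Pi.single i 1)) z) z
      (EuclideanSpace.single i 1) := by
  have h1 : HasLineDerivAt ℝ (jetPoly N q) (∑ γ ∈ multiIdxLT d N,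
      q γ * (if γ i = 0 then 0 else divPow (γ - Pi.single i 1) z)) z
      (EuclideanSpace.single i 1) :=
    HasDerivAt.fun_sum fun γ _ => (hasLineDerivAt_divPow γ i z).const_mul (q γ)
  refine HasDerivAt.congr_deriv h1 ?_
  have h2 : ∑ γ ∈ multiIdxLT d N, q γ * (if γ i = 0 then 0 else divPow (γ - Pi.single i 1) z)
      = ∑ γ ∈ (multiIdxLT d N).filter (fun γ => γ i ≠ 0), q γ * divPow (γ - Pi.single i 1) z := by
    rw [Finset.sum_filter]
    refine Finset.sum_congr rfl fun γ _ => ?_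
    by_cases h : γ i = 0 <;> simp [h]
  have h3 : jetPoly N (fun γ => q (γ + Pi.single i 1)) z
      = ∑ γ ∈ (multiIdxLT d N).filter (fun γ => ∑ j, γ j + 1 < N),
        q (γ + Pi.single i 1) * divPow γ z := by
    unfold jetPoly
    refine (Finset.sum_subset (Finset.filter_subset _ _) fun γ hγ hγ' => ?_).symm
    show q _ * _ = 0
    rw [hq, zero_mul]
    rw [sum_add_single]
    simp only [Finset.mem_filter, not_and, not_lt] at hγ'
    exact hγ' hγ
  rw [h2, h3]
  symm
  refine Finset.sum_nbij' (fun γ => γ + Pi.single i 1) (fun γ => γ - Pi.single i 1) ?_ ?_ ?_ ?_ ?_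
  · intro γ hγ
    simp only [Finset.mem_filter, mem_multiIdxLT] at hγ ⊢
    rw [sum_add_single]
    exact ⟨hγ.2, by simp⟩
  · intro γ hγ
    simp only [Finset.mem_filter, mem_multiIdxLT] at hγ ⊢
    have := sum_add_single (γ - Pi.single i 1) i
    rw [sub_single_add_single hγ.2] at this
    omega
  · intro γ _
    simp
  · intro γ hγ
    exact sub_single_add_single (Finset.mem_filter.1 hγ).2
  · intro γ _
    simp

theorem jetPoly_zero {d N : ℕ} (hN : 0 < N) (q : (Fin d → ℕ) → ℝ) :
    jetPoly N q (0 : EuclideanSpace ℝ (Fin d)) = q 0 := by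
  unfold jetPoly
  rw [Finset.sum_eq_single 0]
  · simp [divPow_zero_left]
  · intro γ _ hγ
    rw [divPow_zero_right hγ, mul_zero]
  · intro h
    exact absurd (mem_multiIdxLT.2 (by simpa using hN)) h

/-! ### Functions with vanishing jets -/

/-- All iterated partial derivatives of order at most `s` exist near `0` (with the exception of the
last one) and vanish at `0`. -/
def FlatJet {d : ℕ} : ℕ → (EuclideanSpace ℝ (Fin d) → ℝ) → Prop
  | 0, ρ => ρ 0 = 0
  | s + 1, ρ => ρ 0 = 0 ∧ ∀ i : Fin d,
      (∀ᶠ z in 𝓝 0, LineDifferentiableAt ℝ ρ z (EuclideanSpace.single i 1)) ∧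
      FlatJet s (fun z => lineDeriv ℝ ρ z (EuclideanSpace.single i 1))

theorem FlatJet.apply_zero {d s : ℕ} {ρ : EuclideanSpace ℝ (Fin d) → ℝ} (h : FlatJet s ρ) :
    ρ 0 = 0 := by
  cases s with
  | zero => exact h
  | succ s => exact h.1

theorem eventually_lineDeriv_eq {d : ℕ} {u v : EuclideanSpace ℝ (Fin d) → ℝ} (h : u =ᶠ[𝓝 0] v)
    (e : EuclideanSpace ℝ (Fin d)) :
    (fun z => lineDeriv ℝ u z e) =ᶠ[𝓝 0] fun z => lineDeriv ℝ v z e := by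
  filter_upwards [eventually_eventually_nhds.2 h] with z hz
  exact Filter.EventuallyEq.lineDeriv_eq hz

theorem FlatJet.congr {d s : ℕ} {ρ ρ' : EuclideanSpace ℝ (Fin d) → ℝ} (h : FlatJet s ρ)
    (he : ρ =ᶠ[𝓝 0] ρ') : FlatJet s ρ' := by
  induction s generalizing ρ ρ' with
  | zero => exact he.eq_of_nhds.symm.trans h
  | succ s ih =>
    refine ⟨he.eq_of_nhds.symm.trans h.1, fun i => ⟨?_, ih (h.2 i).2 (eventually_lineDeriv_eq he _)⟩⟩
    filter_upwards [(h.2 i).1, eventually_eventually_nhds.2 he] with z h1 h2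
    exact (Filter.EventuallyEq.lineDifferentiableAt_iff h2).1 h1

theorem FlatJet.add {d s : ℕ} {ρ ρ' : EuclideanSpace ℝ (Fin d) → ℝ} (h : FlatJet s ρ)
    (h' : FlatJet s ρ') : FlatJet s (fun z => ρ z + ρ' z) := by
  induction s generalizing ρ ρ' with
  | zero =>
    have h1 : ρ 0 = 0 := h
    have h2 : ρ' 0 = 0 := h'
    simp [FlatJet, h1, h2]
  | succ s ih =>
    refine ⟨by simp [h.1, h'.1], fun i => ⟨?_, ?_⟩⟩
    · filter_upwards [(h.2 i).1, (h'.2 i).1] with z h1 h2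
      exact DifferentiableAt.add h1 h2
    · refine (ih (h.2 i).2 (h'.2 i).2).congr ?_
      filter_upwards [(h.2 i).1, (h'.2 i).1] with z h1 h2
      have h3 : HasLineDerivAt ℝ (fun z => ρ z + ρ' z)
          (lineDeriv ℝ ρ z (EuclideanSpace.single i 1) +
            lineDeriv ℝ ρ' z (EuclideanSpace.single i 1)) z (EuclideanSpace.single i 1) :=
        HasDerivAt.add h1.hasLineDerivAt h2.hasLineDerivAt
      exact h3.lineDeriv.symm

/-- Functions of the form `z ↦ z^γ / γ! * ‖z‖^e * ψ(‖z‖)`. -/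
noncomputable def radialTerm {d : ℕ} (γ : Fin d → ℕ) (e : ℤ) (ψ : ℝ → ℝ)
    (z : EuclideanSpace ℝ (Fin d)) : ℝ :=
  divPow γ z * ‖z‖ ^ e * ψ ‖z‖

theorem radialTerm_zero {d : ℕ} {γ : Fin d → ℕ} {e : ℤ} {ψ : ℝ → ℝ} (h : 1 ≤ (∑ j, γ j : ℕ) + e) :
    radialTerm γ e ψ 0 = 0 := by
  unfold radialTerm
  by_cases hγ : γ = 0
  · subst hγ
    have : e ≠ 0 := by
      simp at h
      omega
    simp [zero_zpow _ this]
  · simp [divPow_zero_right hγ]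

theorem hasLineDerivAt_norm {d : ℕ} {z : EuclideanSpace ℝ (Fin d)} (hz : z ≠ 0) (i : Fin d) :
    HasLineDerivAt ℝ (fun z : EuclideanSpace ℝ (Fin d) => ‖z‖) (z i / ‖z‖) z
      (EuclideanSpace.single i 1) := by
  unfold HasLineDerivAt
  have h1 : HasDerivAt (fun t : ℝ => z + t • EuclideanSpace.single i (1 : ℝ))
      (EuclideanSpace.single i 1) 0 := by
    simpa using ((hasDerivAt_id (0 : ℝ)).smul_const (EuclideanSpace.single i (1 : ℝ))).const_add z
  have h2 := h1.norm_sq.sqrt (by simpa using hz)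
  have h3 : (fun t : ℝ => ‖z + t • EuclideanSpace.single i (1 : ℝ)‖)
      = fun t : ℝ => √(‖z + t • EuclideanSpace.single i (1 : ℝ)‖ ^ 2) := by
    funext t
    rw [Real.sqrt_sq (norm_nonneg _)]
  rw [h3]
  refine h2.congr_deriv ?_
  simp [EuclideanSpace.inner_single_right]
  field_simp

/-- Radial terms are closed under partial derivatives away from `0`, and the homogeneity `∑ γ + e`
drops by at most one. The factor `γ i + 1` comes from absorbing the coordinate `z i` of the gradient
of the norm into the divided power. -/
theorem hasLineDerivAt_radialTerm {d : ℕ} {γ : Fin d → ℕ} {e : ℤ} {ψ : ℝ → ℝ}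
    {z : EuclideanSpace ℝ (Fin d)} (hz : z ≠ 0) (hψ : DifferentiableAt ℝ ψ ‖z‖) (i : Fin d) :
    HasLineDerivAt ℝ (radialTerm γ e ψ)
      ((if γ i = 0 then 0 else radialTerm (γ - Pi.single i 1) e ψ z) +
        (radialTerm (γ + Pi.single i 1) (e - 2) (fun t => e * (γ i + 1) * ψ t) z +
        radialTerm (γ + Pi.single i 1) (e - 1) (fun t => (γ i + 1) * deriv ψ t) z)) z
      (EuclideanSpace.single i 1) := by
  have hn : ‖z‖ ≠ 0 := norm_ne_zero_iff.2 hz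
  have hN := hasLineDerivAt_norm hz i
  unfold HasLineDerivAt at hN ⊢
  have hz0 : z + (0 : ℝ) • EuclideanSpace.single i (1 : ℝ) = z := by simp
  have h1 : HasDerivAt (fun t : ℝ => ‖z + t • EuclideanSpace.single i (1 : ℝ)‖ ^ e)
      (e * ‖z‖ ^ (e - 1) * (z i / ‖z‖)) 0 := by
    have := hasDerivAt_zpow e ‖z‖ (Or.inl hn)
    rw [← hz0] at this
    have := HasDerivAt.comp (0 : ℝ) this hN
    rwa [hz0] at this
  have h2 : HasDerivAt (fun t : ℝ => ψ ‖z + t • EuclideanSpace.single i (1 : ℝ)‖)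
      (deriv ψ ‖z‖ * (z i / ‖z‖)) 0 := by
    have := hψ.hasDerivAt
    rw [← hz0] at this
    have := HasDerivAt.comp (0 : ℝ) this hN
    rwa [hz0] at this
  have h3 := ((hasLineDerivAt_divPow γ i z).mul h1).mul h2
  refine h3.congr_deriv ?_
  symm
  simp only [hz0, radialTerm]
  have hc := coord_mul_divPow γ i z
  have e1 : ‖z‖ ^ (e - 1) = ‖z‖ ^ (e - 2) * ‖z‖ := by
    rw [← zpow_add_one₀ hn]; congr 1; ring
  have e2 : ‖z‖ ^ e = ‖z‖ ^ (e - 2) * ‖z‖ * ‖z‖ := by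
    rw [← zpow_add_one₀ hn, ← zpow_add_one₀ hn]; congr 1; ring
  simp only [Pi.mul_apply, hz0, e1, e2]
  have e3 : z i / ‖z‖ * ‖z‖ = z i := div_mul_cancel₀ _ hn
  split_ifs
  · linear_combination (-(e * ‖z‖ ^ (e - 2) * ψ ‖z‖ + ‖z‖ ^ (e - 2) * ‖z‖ * deriv ψ ‖z‖)) * hc
      - divPow γ z * (e * ‖z‖ ^ (e - 2) * ψ ‖z‖ + ‖z‖ ^ (e - 2) * ‖z‖ * deriv ψ ‖z‖) * e3
  · linear_combination (-(e * ‖z‖ ^ (e - 2) * ψ ‖z‖ + ‖z‖ ^ (e - 2) * ‖z‖ * deriv ψ ‖z‖)) * hc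
      - divPow γ z * (e * ‖z‖ ^ (e - 2) * ψ ‖z‖ + ‖z‖ ^ (e - 2) * ‖z‖ * deriv ψ ‖z‖) * e3

/-- Homogeneity at least two makes the function `O(‖z‖ ^ 2)`, which settles the origin, where the
product rule is not available. -/
theorem hasLineDerivAt_radialTerm_zero {d : ℕ} {γ : Fin d → ℕ} {e : ℤ} {ψ : ℝ → ℝ}
    (h : 2 ≤ (∑ j, γ j : ℕ) + e) (hψ : ContinuousAt ψ 0) (v : EuclideanSpace ℝ (Fin d)) :
    HasLineDerivAt ℝ (radialTerm γ e ψ) 0 0 v := by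
  have hO : radialTerm γ e ψ =O[𝓝 0] fun z : EuclideanSpace ℝ (Fin d) => ‖z - 0‖ ^ 2 := by
    have hψ' : Tendsto (fun z : EuclideanSpace ℝ (Fin d) => ψ ‖z‖) (𝓝 0) (𝓝 (ψ 0)) := by
      refine hψ.tendsto.comp ?_
      simpa using (continuous_norm (E := EuclideanSpace ℝ (Fin d))).tendsto 0
    have hb := hψ'.abs.eventually (gt_mem_nhds (lt_add_one |ψ 0|))
    refine Asymptotics.IsBigO.of_bound (|ψ 0| + 1) ?_
    filter_upwards [hb, Metric.ball_mem_nhds (0 : EuclideanSpace ℝ (Fin d)) one_pos] with z h1 h2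
    rw [sub_zero, norm_pow, norm_norm, Real.norm_eq_abs]
    by_cases hz : z = 0
    · subst hz
      rw [radialTerm_zero (by omega)]
      simp
    · have hn : 0 < ‖z‖ := norm_pos_iff.2 hz
      have hn1 : ‖z‖ ≤ 1 := by simpa using (mem_ball_zero_iff.1 h2).le
      unfold radialTerm
      rw [abs_mul, abs_mul, abs_of_pos (zpow_pos hn e), mul_comm]
      have h3 : |divPow γ z| * ‖z‖ ^ e ≤ ‖z‖ ^ 2 := by
        calc |divPow γ z| * ‖z‖ ^ e ≤ ‖z‖ ^ (∑ j, γ j) * ‖z‖ ^ e := by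
              gcongr; exact abs_divPow_le γ z
          _ = ‖z‖ ^ (((∑ j, γ j : ℕ) : ℤ) + e) := by rw [zpow_add₀ hn.ne', zpow_natCast]
          _ ≤ ‖z‖ ^ (2 : ℤ) := zpow_le_zpow_right_of_le_one₀ hn hn1 h
          _ = ‖z‖ ^ 2 := by norm_cast
      gcongr
  have h1 : HasFDerivAt (radialTerm γ e ψ) (0 : EuclideanSpace ℝ (Fin d) →L[ℝ] ℝ) 0 :=
    hO.hasFDerivAt (by norm_num)
  simpa using h1.hasLineDerivAt v

/-- Each derivative costs at most one unit of homogeneity. The exponent `e` may become negative and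
`ψ` is replaced by its derivative along the way, so the induction needs both general. Applied to `γ
= 0`, `e = 2R - 1`, it says that the remainder of the kernel is invisible to derivatives of order at
most `2R - 2`. -/
theorem flatJet_radialTerm {d s : ℕ} (γ : Fin d → ℕ) (e : ℤ) {ψ : ℝ → ℝ} (hψ : AnalyticAt ℝ ψ 0)
    (h : (s : ℤ) + 1 ≤ (∑ j, γ j : ℕ) + e) : FlatJet s (radialTerm γ e ψ) := by
  induction s generalizing γ e ψ with
  | zero => exact radialTerm_zero (by simpa using h)
  | succ s ih =>
    have hnorm : Tendsto (fun z : EuclideanSpace ℝ (Fin d) => ‖z‖) (𝓝 0) (𝓝 0) := by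
      simpa using (continuous_norm (E := EuclideanSpace ℝ (Fin d))).tendsto 0
    have hdiff : ∀ᶠ z : EuclideanSpace ℝ (Fin d) in 𝓝 0, DifferentiableAt ℝ ψ ‖z‖ :=
      hnorm.eventually (hψ.eventually_analyticAt.mono fun t ht => ht.differentiableAt)
    refine ⟨radialTerm_zero (by omega), fun i => ?_⟩
    have hψ' : AnalyticAt ℝ (deriv ψ) 0 := hψ.deriv
    have hs1 := sum_add_single γ i
    have hev : ∀ᶠ z : EuclideanSpace ℝ (Fin d) in 𝓝 0, HasLineDerivAt ℝ (radialTerm γ e ψ)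
      ((if γ i = 0 then 0 else radialTerm (γ - Pi.single i 1) e ψ z) +
        (radialTerm (γ + Pi.single i 1) (e - 2) (fun t => e * (γ i + 1) * ψ t) z +
        radialTerm (γ + Pi.single i 1) (e - 1) (fun t => (γ i + 1) * deriv ψ t) z)) z
      (EuclideanSpace.single i 1) := by
      filter_upwards [hdiff] with z hz
      by_cases hz0 : z = 0
      · subst hz0
        rw [radialTerm_zero (γ := γ + Pi.single i 1) (e := e - 2) (by rw [hs1]; omega),
          radialTerm_zero (γ := γ + Pi.single i 1) (e := e - 1) (by rw [hs1]; omega)]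
        have : (if γ i = 0 then 0 else radialTerm (γ - Pi.single i 1) e ψ 0) = 0 := by
          split_ifs with hi
          · rfl
          · have := sum_add_single (γ - Pi.single i 1) i
            rw [sub_single_add_single hi] at this
            exact radialTerm_zero (by omega)
        rw [this, add_zero, add_zero]
        exact hasLineDerivAt_radialTerm_zero (by omega) hψ.continuousAt _
      · exact hasLineDerivAt_radialTerm hz0 hz i
    refine ⟨hev.mono fun z hz => HasLineDerivAt.lineDifferentiableAt hz, ?_⟩
    have hsum : FlatJet s (fun z : EuclideanSpace ℝ (Fin d) =>
        (if γ i = 0 then 0 else radialTerm (γ - Pi.single i 1) e ψ z) +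
        (radialTerm (γ + Pi.single i 1) (e - 2) (fun t => e * (γ i + 1) * ψ t) z +
        radialTerm (γ + Pi.single i 1) (e - 1) (fun t => (γ i + 1) * deriv ψ t) z)) := by
      refine FlatJet.add ?_ (FlatJet.add ?_ ?_)
      · by_cases hi : γ i = 0
        · simp only [hi, if_true]
          -- The zero function is obtained as a radial term with zero profile.
          have := ih (γ + Pi.single i 1) e (ψ := fun _ => 0) analyticAt_const
            (by rw [hs1]; omega)
          refine this.congr (Eventually.of_forall fun z => ?_)
          simp [radialTerm]
        · simp only [hi, if_false]
          have := sum_add_single (γ - Pi.single i 1) i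
          rw [sub_single_add_single hi] at this
          exact ih _ _ hψ (by omega)
      · exact ih _ _ (analyticAt_const.mul hψ) (by rw [hs1]; omega)
      · exact ih _ _ (analyticAt_const.mul hψ.deriv) (by rw [hs1]; omega)
    exact hsum.congr (hev.mono fun z hz => (HasLineDerivAt.lineDeriv hz).symm)

/-! ### Jets and iterated partial derivatives -/

/-- Near `0`, the function `u` is the polynomial with Taylor coefficients `q`, up to a function
that is flat to order `s`. -/
def HasJet {d : ℕ} (N s : ℕ) (q : (Fin d → ℕ) → ℝ) (u : EuclideanSpace ℝ (Fin d) → ℝ) : Prop :=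
  ∃ ρ, FlatJet s ρ ∧ u =ᶠ[𝓝 0] fun z => jetPoly N q z + ρ z

theorem HasJet.apply_zero {d N s : ℕ} (hN : 0 < N) {q : (Fin d → ℕ) → ℝ}
    {u : EuclideanSpace ℝ (Fin d) → ℝ} (h : HasJet N s q u) : u 0 = q 0 := by
  obtain ⟨ρ, h1, h2⟩ := h
  rw [h2.eq_of_nhds, h1.apply_zero, add_zero, jetPoly_zero hN]

theorem HasJet.lineDeriv {d N s : ℕ} {q : (Fin d → ℕ) → ℝ}
    (hq : ∀ γ, N ≤ ∑ j, γ j → q γ = 0)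
    {u : EuclideanSpace ℝ (Fin d) → ℝ} (h : HasJet N (s + 1) q u) (i : Fin d) :
    HasJet N s (fun γ => q (γ + Pi.single i 1))
      (fun z => lineDeriv ℝ u z (EuclideanSpace.single i 1)) := by
  obtain ⟨ρ, h1, h2⟩ := h
  refine ⟨_, (h1.2 i).2, (eventually_lineDeriv_eq h2 _).trans ?_⟩
  filter_upwards [(h1.2 i).1] with z hz
  exact HasLineDerivAt.lineDeriv
    (HasDerivAt.add (hasLineDerivAt_jetPoly hq i z) hz.hasLineDerivAt)

theorem HasJet.iterate_lineDeriv {d N s : ℕ} {q : (Fin d → ℕ) → ℝ}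
    (hq : ∀ γ, N ≤ ∑ j, γ j → q γ = 0)
    {u : EuclideanSpace ℝ (Fin d) → ℝ} (i : Fin d) (k : ℕ) (h : HasJet N (s + k) q u) :
    HasJet N s (fun γ => q (γ + k • Pi.single i 1))
      ((fun (u : EuclideanSpace ℝ (Fin d) → ℝ) y =>
        _root_.lineDeriv ℝ u y (EuclideanSpace.single i 1))^[k] u) := by
  induction k generalizing q u with
  | zero => simpa using h
  | succ k ih =>
    rw [Function.iterate_succ_apply]
    have h1 := HasJet.lineDeriv hq (s := s + k) (by rwa [add_assoc]) i
    have h2 := ih (q := fun γ => q (γ + Pi.single i 1))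
      (fun γ hγ => hq _ (by rw [sum_add_single]; omega)) h1
    convert h2 using 2 with γ
    rw [succ_nsmul, add_assoc]

theorem HasJet.foldr_lineDeriv {d N s : ℕ} {q : (Fin d → ℕ) → ℝ}
    (hq : ∀ γ, N ≤ ∑ j, γ j → q γ = 0) {u : EuclideanSpace ℝ (Fin d) → ℝ} (α : Fin d → ℕ)
    (l : List (Fin d)) (h : HasJet N (s + (l.map α).sum) q u) :
    HasJet N s (fun γ => q (γ + (l.map fun i => α i • Pi.single i 1).sum))
      (l.foldr (fun i h => (fun (u : EuclideanSpace ℝ (Fin d) → ℝ) y =>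
        _root_.lineDeriv ℝ u y (EuclideanSpace.single i 1))^[α i] h) u) := by
  induction l generalizing s with
  | nil => simpa using h
  | cons i l ih =>
    have h1 := ih (s := s + α i) (by
      rw [List.map_cons, List.sum_cons] at h
      rwa [add_assoc])
    have h2 := HasJet.iterate_lineDeriv
      (q := fun γ => q (γ + (l.map fun i => α i • (Pi.single i 1 : Fin d → ℕ)).sum)) (fun γ hγ => hq _ (hγ.trans (Finset.sum_le_sum fun j _ => Nat.le_add_right _ _))) i (α i) h1
    have e : (fun γ => q (γ + ((i :: l).map fun i => α i • (Pi.single i 1 : Fin d → ℕ)).sum))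
        = fun γ => q (γ + α i • Pi.single i 1 +
          (l.map fun i => α i • (Pi.single i 1 : Fin d → ℕ)).sum) := by
      funext γ
      rw [List.map_cons, List.sum_cons, add_assoc]
    rw [e]
    exact h2

theorem HasJet.multiDeriv {d N s : ℕ} {q : (Fin d → ℕ) → ℝ}
    (hq : ∀ γ, N ≤ ∑ j, γ j → q γ = 0) {u : EuclideanSpace ℝ (Fin d) → ℝ} (α : Fin d → ℕ)
    (h : HasJet N (s + ∑ j, α j) q u) :
    HasJet N s (fun γ => q (γ + α)) (multiDeriv α u) := by
  have h1 := HasJet.foldr_lineDeriv hq α (List.finRange d) (by rwa [← Fin.sum_univ_def])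
  have e : ((List.finRange d).map fun i => α i • (Pi.single i 1 : Fin d → ℕ)).sum = α := by
    rw [← Fin.sum_univ_def]
    funext j
    simp [Finset.sum_apply, Pi.single_apply]
  rw [e] at h1
  exact h1

/-- No differentiability is needed: `lineDeriv` is a one-variable `deriv`, and both reflection and
constant multiples commute with it unconditionally. -/
theorem multiDeriv_comp_sub_left {d : ℕ} (β : Fin d → ℕ) (g : EuclideanSpace ℝ (Fin d) → ℝ)
    (x : EuclideanSpace ℝ (Fin d)) :
    multiDeriv β (fun y => g (x - y)) = fun y => (-1) ^ (∑ j, β j) * multiDeriv β g (x - y) := by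
  have h1 : ∀ (c : ℝ) (h : EuclideanSpace ℝ (Fin d) → ℝ) (v : EuclideanSpace ℝ (Fin d)),
      (fun y => lineDeriv ℝ (fun y => c * h (x - y)) y v)
        = fun y => (c * -1) * lineDeriv ℝ h (x - y) v := by
    intro c h v
    funext y
    unfold lineDeriv
    rw [deriv_const_mul_field, mul_assoc, neg_one_mul]
    congr 1
    have h2 : (fun t : ℝ => h (x - (y + t • v))) = fun t : ℝ => (fun t => h (x - y + t • v)) (-t) := by
      funext t
      congr 1
      simp only [neg_smul]
      abel
    rw [h2, deriv_comp_neg (fun t : ℝ => h (x - y + t • v)), neg_zero]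
  have h2 : ∀ (i : Fin d) (k : ℕ) (c : ℝ) (h : EuclideanSpace ℝ (Fin d) → ℝ),
      (fun (u : EuclideanSpace ℝ (Fin d) → ℝ) y =>
        lineDeriv ℝ u y (EuclideanSpace.single i 1))^[k] (fun y => c * h (x - y))
      = fun y => (c * (-1) ^ k) * (fun (u : EuclideanSpace ℝ (Fin d) → ℝ) y =>
        lineDeriv ℝ u y (EuclideanSpace.single i 1))^[k] h (x - y) := by
    intro i k
    induction k with
    | zero => intro c h; simp
    | succ k ih =>
      intro c h
      rw [Function.iterate_succ_apply, h1]
      refine (ih (c * -1) fun z => lineDeriv ℝ h z (EuclideanSpace.single i 1)).trans ?_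
      funext y
      rw [Function.iterate_succ_apply]
      ring
  have h3 : ∀ l : List (Fin d),
      l.foldr (fun i h => (fun (u : EuclideanSpace ℝ (Fin d) → ℝ) y =>
        lineDeriv ℝ u y (EuclideanSpace.single i 1))^[β i] h) (fun y => g (x - y))
      = fun y => (-1) ^ (l.map β).sum * l.foldr (fun i h =>
        (fun (u : EuclideanSpace ℝ (Fin d) → ℝ) y =>
        lineDeriv ℝ u y (EuclideanSpace.single i 1))^[β i] h) g (x - y) := by
    intro l
    induction l with
    | nil => simp
    | cons i l ih =>
      rw [List.foldr_cons, ih, h2]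
      funext y
      rw [List.foldr_cons, List.map_cons, List.sum_cons, pow_add]
      ring
  unfold multiDeriv
  rw [h3, Fin.sum_univ_def]

theorem multiDeriv_const_mul {d : ℕ} (β : Fin d → ℕ) (c : ℝ) (g : EuclideanSpace ℝ (Fin d) → ℝ) :
    multiDeriv β (fun y => c * g y) = fun y => c * multiDeriv β g y := by
  have h2 : ∀ (i : Fin d) (k : ℕ) (h : EuclideanSpace ℝ (Fin d) → ℝ),
      (fun (u : EuclideanSpace ℝ (Fin d) → ℝ) y =>
        lineDeriv ℝ u y (EuclideanSpace.single i 1))^[k] (fun y => c * h y)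
      = fun y => c * (fun (u : EuclideanSpace ℝ (Fin d) → ℝ) y =>
        lineDeriv ℝ u y (EuclideanSpace.single i 1))^[k] h y := by
    intro i k
    induction k with
    | zero => intro h; simp
    | succ k ih =>
      intro h
      have h1 : (fun y => lineDeriv ℝ (fun y => c * h y) y (EuclideanSpace.single i 1))
          = fun y => c * lineDeriv ℝ h y (EuclideanSpace.single i 1) := by
        funext y
        unfold lineDeriv
        rw [deriv_const_mul_field]
      rw [Function.iterate_succ_apply, h1, ih]
      rfl
  unfold multiDeriv
  induction List.finRange d with
  | nil => simp
  | cons i l ih => rw [List.foldr_cons, ih, h2]; rfl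

/-! ### Homogeneous polynomial functions -/

/-- The homogeneous polynomial functions of degree `p`. -/
noncomputable def homPoly (d p : ℕ) : Submodule ℝ (EuclideanSpace ℝ (Fin d) → ℝ) :=
  Submodule.span ℝ (monomialFun '' (multiIdxEq d p : Set (Fin d → ℕ)))

theorem monomialFun_mul {d : ℕ} (α β : Fin d → ℕ) :
    (monomialFun α * monomialFun β : EuclideanSpace ℝ (Fin d) → ℝ) = monomialFun (α + β) := by
  funext x
  simp [monomialFun, pow_add, Finset.prod_mul_distrib]

theorem mul_mem_homPoly {d p q : ℕ} {F G : EuclideanSpace ℝ (Fin d) → ℝ} (hF : F ∈ homPoly d p)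
    (hG : G ∈ homPoly d q) : F * G ∈ homPoly d (p + q) := by
  have h := Submodule.mul_mem_mul hF hG
  unfold homPoly at h
  rw [Submodule.span_mul_span] at h
  refine Submodule.span_mono ?_ h
  rintro _ ⟨_, ⟨α, hα, rfl⟩, _, ⟨β, hβ, rfl⟩, rfl⟩
  refine ⟨α + β, ?_, (monomialFun_mul α β).symm⟩
  rw [Finset.mem_coe, mem_multiIdxEq] at hα hβ ⊢
  simp [Finset.sum_add_distrib, hα, hβ]

theorem one_mem_homPoly (d : ℕ) : (1 : EuclideanSpace ℝ (Fin d) → ℝ) ∈ homPoly d 0 := by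
  refine Submodule.subset_span ⟨0, ?_, ?_⟩
  · rw [Finset.mem_coe, mem_multiIdxEq]; simp
  · funext x; simp [monomialFun]

theorem pow_mem_homPoly {d p : ℕ} {F : EuclideanSpace ℝ (Fin d) → ℝ} (hF : F ∈ homPoly d p)
    (k : ℕ) : F ^ k ∈ homPoly d (k * p) := by
  induction k with
  | zero => simpa using one_mem_homPoly d
  | succ k ih =>
    rw [pow_succ, add_mul, one_mul]
    exact mul_mem_homPoly ih hF

theorem coord_mem_homPoly {d : ℕ} (i : Fin d) :
    (fun x : EuclideanSpace ℝ (Fin d) => x i) ∈ homPoly d 1 := by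
  refine Submodule.subset_span ⟨Pi.single i 1, ?_, ?_⟩
  · rw [Finset.mem_coe, mem_multiIdxEq]; simp
  · funext x
    unfold monomialFun
    rw [Finset.prod_eq_single i]
    · simp
    · intro j _ hj; simp [hj]
    · simp

theorem normSq_mem_homPoly (d : ℕ) :
    (fun x : EuclideanSpace ℝ (Fin d) => ‖x‖ ^ 2) ∈ homPoly d 2 := by
  have h : (fun x : EuclideanSpace ℝ (Fin d) => ‖x‖ ^ 2)
      = ∑ i, (fun x : EuclideanSpace ℝ (Fin d) => x i) * fun x => x i := by
    funext x
    rw [EuclideanSpace.real_norm_sq_eq]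
    simp [pow_two]
  rw [h]
  exact Submodule.sum_mem _ fun i _ => 
    mul_mem_homPoly (p := 1) (q := 1) (coord_mem_homPoly i) (coord_mem_homPoly i)

theorem inner_mem_homPoly {d : ℕ} (X : EuclideanSpace ℝ (Fin d)) :
    (fun x : EuclideanSpace ℝ (Fin d) => inner ℝ X x) ∈ homPoly d 1 := by
  have h : (fun x : EuclideanSpace ℝ (Fin d) => inner ℝ X x)
      = ∑ i, X i • (fun x : EuclideanSpace ℝ (Fin d) => x i) := by
    funext x
    simp [PiLp.inner_apply, mul_comm]
  rw [h]
  exact Submodule.sum_mem _ fun i _ => Submodule.smul_mem _ _ (coord_mem_homPoly i)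

theorem exists_eq_sum_of_mem_homPoly {d p : ℕ} {F : EuclideanSpace ℝ (Fin d) → ℝ}
    (hF : F ∈ homPoly d p) :
    ∃ q : (Fin d → ℕ) → ℝ, ∀ x, F x = ∑ γ ∈ multiIdxEq d p, q γ * monomialFun γ x := by
  classical
  obtain ⟨c, hc⟩ := (Submodule.mem_span_image_finset_iff_exists_fun ℝ).1 hF
  refine ⟨fun γ => if h : γ ∈ multiIdxEq d p then c ⟨γ, h⟩ else 0, fun x => ?_⟩
  rw [← hc, ← Finset.sum_coe_sort (multiIdxEq d p)]
  simp [Finset.sum_apply]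

/-! ### Taylor expansion of the radial profile -/

/-- Each `dslope` at `0` strips one Taylor coefficient and preserves analyticity. As the slope
identity is algebraic, the expansion holds for every `t`, not only near `0`. -/
theorem AnalyticAt.exists_taylor {f : ℝ → ℝ} (hf : AnalyticAt ℝ f 0) (N : ℕ) :
    ∃ ψ : ℝ → ℝ, AnalyticAt ℝ ψ 0 ∧ ψ 0 = iteratedDeriv N f 0 / N.factorial ∧
      ∀ t, f t = ∑ i ∈ Finset.range N, iteratedDeriv i f 0 / i.factorial * t ^ i + t ^ N * ψ t := by
  have hp := hf.hasFPowerSeriesAt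
  set p := FormalMultilinearSeries.ofScalars ℝ (fun n ↦ iteratedDeriv n f 0 / n.factorial)
    with hpdef
  have hpc : ∀ n, p.coeff n = iteratedDeriv n f 0 / n.factorial := by
    intro n
    simp [hpdef, FormalMultilinearSeries.coeff_ofScalars]
  have hval : ∀ n, (Function.swap dslope (0 : ℝ))^[n] f 0 = iteratedDeriv n f 0 / n.factorial := by
    intro n
    have h := (hp.has_fpower_series_iterate_dslope_fslope n).coeff_zero 1
    rw [← h, ← hpc n]
    have := FormalMultilinearSeries.coeff_iterate_fslope (p := p) n 0
    rw [zero_add] at this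
    rw [← this]
    rfl
  refine ⟨(Function.swap dslope (0 : ℝ))^[N] f,
    ⟨_, hp.has_fpower_series_iterate_dslope_fslope N⟩, hval N, fun t => ?_⟩
  induction N with
  | zero => simp
  | succ N ih =>
    rw [ih, Finset.sum_range_succ, Function.iterate_succ_apply', add_assoc]
    congr 1
    have h := sub_smul_dslope ((Function.swap dslope (0 : ℝ))^[N] f) 0 t
    rw [hval N, sub_zero, smul_eq_mul] at h
    have h' : (Function.swap dslope (0 : ℝ))^[N] f t = iteratedDeriv N f 0 / N.factorial +
        t * dslope ((Function.swap dslope (0 : ℝ))^[N] f) 0 t := by linarith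
    rw [h']
    simp only [Function.swap]
    ring

theorem iteratedDeriv_eq_zero_of_lt_smoothnessOrder {f : ℝ → ℝ} {i : ℕ} (hi : Odd i)
    {R : ℕ} (hR : (R : ℕ∞) ≤ smoothnessOrder f) (h : i < 2 * R - 1) : iteratedDeriv i f 0 = 0 := by
  obtain ⟨k, rfl⟩ := hi
  by_contra hne
  have h1 : smoothnessOrder f ≤ ((k + 1 : ℕ) : ℕ∞) := by
    unfold smoothnessOrder
    refine iInf₂_le (k + 1) ⟨by omega, ?_⟩
    rwa [show 2 * (k + 1) - 1 = 2 * k + 1 by omega]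
  have := hR.trans h1
  have : R ≤ k + 1 := by exact_mod_cast this
  omega

/-- Even powers of the norm are homogeneous polynomials, and odd powers below `2R - 1` have
coefficient zero because `R` does not exceed the smoothness order. -/
theorem exists_jetPoly_add {d : ℕ} {f : ℝ → ℝ} (hf : AnalyticAt ℝ f 0) {R : ℕ}
    (hR : (R : ℕ∞) ≤ smoothnessOrder f) :
    ∃ (ψ : ℝ → ℝ) (q : (Fin d → ℕ) → ℝ), AnalyticAt ℝ ψ 0 ∧
      ψ 0 = iteratedDeriv (2 * R - 1) f 0 / (2 * R - 1).factorial ∧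
      (∀ γ, 2 * R - 1 ≤ ∑ j, γ j → q γ = 0) ∧ (∀ γ, Odd (∑ j, γ j) → q γ = 0) ∧
      ∀ z : EuclideanSpace ℝ (Fin d),
        f ‖z‖ = jetPoly (2 * R - 1) q z + ‖z‖ ^ (2 * R - 1) * ψ ‖z‖ := by
  classical
  obtain ⟨ψ, hψ, hψ0, hexp⟩ := hf.exists_taylor (2 * R - 1)
  have hq : ∀ i : ℕ, ∃ q : (Fin d → ℕ) → ℝ, i < 2 * R - 1 →
      (Odd i → ∀ γ, q γ = 0) ∧ ∀ z : EuclideanSpace ℝ (Fin d),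
        iteratedDeriv i f 0 / i.factorial * ‖z‖ ^ i = ∑ γ ∈ multiIdxEq d i, q γ * divPow γ z := by
    intro i
    rcases Nat.even_or_odd i with hi | hi
    · obtain ⟨k, rfl⟩ := hi
      have h1 := pow_mem_homPoly (normSq_mem_homPoly d) k
      rw [show k * 2 = k + k by ring] at h1
      obtain ⟨q, hq⟩ := exists_eq_sum_of_mem_homPoly h1
      refine ⟨fun γ => iteratedDeriv (k + k) f 0 / (k + k).factorial * q γ *
        ∏ j, ((γ j).factorial : ℝ), fun _ => ⟨fun ho => ?_, fun z => ?_⟩⟩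
      · exact absurd ho (by simp)
      · have h2 := hq z
        simp only [Pi.pow_apply] at h2
        rw [show k + k = 2 * k by ring, pow_mul, h2, Finset.mul_sum]
        rw [show k + k = 2 * k by ring] 
        refine Finset.sum_congr rfl fun γ _ => ?_
        rw [divPow_eq]
        have : (∏ j, ((γ j).factorial : ℝ)) ≠ 0 :=
          Finset.prod_ne_zero_iff.2 fun j _ => by positivity
        field_simp
    · refine ⟨0, fun h => ⟨fun _ _ => rfl, fun z => ?_⟩⟩
      rw [iteratedDeriv_eq_zero_of_lt_smoothnessOrder hi hR h]
      simp
  choose q hq using hq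
  refine ⟨ψ, fun γ => if ∑ j, γ j < 2 * R - 1 then q (∑ j, γ j) γ else 0, hψ, hψ0,
    fun γ hγ => if_neg (by omega), fun γ hγ => ?_, fun z => ?_⟩
  · show (if _ then _ else _) = _
    split_ifs with h
    · exact (hq _ h).1 hγ γ
    · rfl
  · rw [hexp]
    congr 1
    unfold jetPoly
    rw [← Finset.sum_fiberwise_of_maps_to (s := multiIdxLT d (2 * R - 1))
      (t := Finset.range (2 * R - 1)) (g := fun γ => ∑ j, γ j)
      (fun γ hγ => Finset.mem_range.2 (mem_multiIdxLT.1 hγ))]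
    refine Finset.sum_congr rfl fun i hi => ?_
    rw [(hq i (Finset.mem_range.1 hi)).2 z]
    have hset : (multiIdxLT d (2 * R - 1)).filter (fun γ => ∑ j, γ j = i) = multiIdxEq d i := by
      ext γ
      rw [Finset.mem_filter, mem_multiIdxLT, mem_multiIdxEq]
      have := Finset.mem_range.1 hi
      omega
    rw [hset]
    refine Finset.sum_congr rfl fun γ hγ => ?_
    rw [mem_multiIdxEq] at hγ
    simp only [hγ]
    rw [if_pos (Finset.mem_range.1 hi)]

/-! ### The Wronskian entries and the expansion of the kernel -/

/-- The entry of the Wronskian matrix with row `α` and column `β`. -/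
noncomputable def wronskianEntry {d : ℕ}
    (κ : EuclideanSpace ℝ (Fin d) → EuclideanSpace ℝ (Fin d) → ℝ) (α β : Fin d → ℕ) : ℝ :=
  multiDeriv α (fun x => multiDeriv β (fun y => κ x y) 0) 0 /
      ((∏ i, ((α i).factorial : ℝ)) * ∏ i, ((β i).factorial : ℝ))

/-- The `y`-derivatives contribute the sign, and the combined derivative of order `α + β` at `0`
reads off one coefficient of the jet. -/
theorem wronskianEntry_stationaryKernel {d N : ℕ} {f : ℝ → ℝ} {q : (Fin d → ℕ) → ℝ}
    (hq : ∀ γ, N ≤ ∑ j, γ j → q γ = 0) {α β : Fin d → ℕ}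
    (h : HasJet N (∑ j, α j + ∑ j, β j) q fun z : EuclideanSpace ℝ (Fin d) => f ‖z‖)
    (hN : 0 < N) :
    wronskianEntry (stationaryKernel d f) α β = (-1) ^ (∑ j, β j) * q (α + β) /
      ((∏ i, ((α i).factorial : ℝ)) * ∏ i, ((β i).factorial : ℝ)) := by
  unfold wronskianEntry stationaryKernel
  congr 1
  have h1 : (fun x : EuclideanSpace ℝ (Fin d) => multiDeriv β (fun y => f ‖x - y‖) 0)
      = fun x => (-1) ^ (∑ j, β j) *
        multiDeriv β (fun z : EuclideanSpace ℝ (Fin d) => f ‖z‖) x := by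
    funext x
    have := congrFun (multiDeriv_comp_sub_left β (fun z : EuclideanSpace ℝ (Fin d) => f ‖z‖) x) 0
    simpa using this
  rw [h1, multiDeriv_const_mul]
  dsimp only
  congr 1
  have h2 := HasJet.multiDeriv hq β h
  have h3 := HasJet.multiDeriv (s := 0) (q := fun γ => q (γ + β))
    (fun γ hγ => hq _ (hγ.trans (Finset.sum_le_sum fun j _ => Nat.le_add_right _ _))) α
    (by rwa [zero_add])
  rw [h3.apply_zero hN, zero_add]

theorem divPow_sub {d : ℕ} (γ : Fin d → ℕ) (x y : EuclideanSpace ℝ (Fin d)) :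
    divPow γ (x - y) = ∑ p ∈ Fintype.piFinset fun i => Finset.HasAntidiagonal.antidiagonal (γ i),
      (-1) ^ (∑ j, (p j).2) * divPow (fun j => (p j).1) x * divPow (fun j => (p j).2) y := by
  have h1 : ∀ (a b : ℝ) (n : ℕ), (a - b) ^ n / (n.factorial : ℝ)
      = ∑ p ∈ Finset.HasAntidiagonal.antidiagonal n,
        (-1) ^ p.2 * (a ^ p.1 / (p.1.factorial : ℝ)) * (b ^ p.2 / (p.2.factorial : ℝ)) := by
    intro a b n
    rw [sub_eq_add_neg, (Commute.all a (-b)).add_pow', Finset.sum_div]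
    refine Finset.sum_congr rfl fun p hp => ?_
    obtain rfl := Finset.HasAntidiagonal.mem_antidiagonal.1 hp
    rw [nsmul_eq_mul, Nat.choose_symm_add, Nat.add_choose, Nat.cast_div (Nat.factorial_mul_factorial_dvd_factorial_add _ _)
      (by positivity), neg_pow]
    push_cast
    field_simp
  unfold divPow
  simp only [PiLp.sub_apply, h1]
  rw [Finset.prod_univ_sum]
  refine Finset.sum_congr rfl fun p _ => ?_
  rw [Finset.prod_mul_distrib, Finset.prod_mul_distrib, Finset.prod_pow_eq_pow_sum]

/-- The binomial theorem for divided powers carries no binomial coefficients, so expanding at `x -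
y` amounts to splitting each `γ` as `α + β`. -/
theorem jetPoly_sub {d N : ℕ} (q : (Fin d → ℕ) → ℝ) (x y : EuclideanSpace ℝ (Fin d)) :
    jetPoly N q (x - y) = ∑ α ∈ multiIdxLT d N, ∑ β ∈ multiIdxLT d N,
      if ∑ j, α j + ∑ j, β j < N then
        (-1) ^ (∑ j, β j) * q (α + β) * divPow α x * divPow β y else 0 := by
  unfold jetPoly
  simp only [divPow_sub, Finset.mul_sum]
  rw [Finset.sum_sigma', ← Finset.sum_product', ← Finset.sum_filter]
  refine Finset.sum_nbij' (fun p => (fun j => (p.2 j).1, fun j => (p.2 j).2))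
    (fun p => ⟨p.1 + p.2, fun j => (p.1 j, p.2 j)⟩) ?_ ?_ ?_ ?_ ?_
  · rintro ⟨γ, p⟩ hp
    simp only [Finset.mem_sigma, mem_multiIdxLT, Fintype.mem_piFinset, Finset.HasAntidiagonal.mem_antidiagonal,
      Finset.mem_filter, Finset.mem_product] at hp ⊢
    have h1 : ∑ j, (p j).1 + ∑ j, (p j).2 = ∑ j, γ j := by
      rw [← Finset.sum_add_distrib]
      exact Finset.sum_congr rfl fun j _ => hp.2 j
    omega
  · rintro ⟨α, β⟩ hp
    simp only [Finset.mem_sigma, mem_multiIdxLT, Fintype.mem_piFinset, Finset.HasAntidiagonal.mem_antidiagonal,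
      Finset.mem_filter, Finset.mem_product] at hp ⊢
    refine ⟨?_, fun j => rfl⟩
    simpa [Finset.sum_add_distrib] using hp.2
  · rintro ⟨γ, p⟩ hp
    simp only [Finset.mem_sigma, Fintype.mem_piFinset, Finset.HasAntidiagonal.mem_antidiagonal] at hp
    have : ((fun j => (p j).1) + fun j => (p j).2) = γ := funext hp.2
    simp [this]
  · rintro ⟨α, β⟩ _
    rfl
  · rintro ⟨γ, p⟩ hp
    simp only [Finset.mem_sigma, Fintype.mem_piFinset, Finset.HasAntidiagonal.mem_antidiagonal] at hp
    have : ((fun j => (p j).1) + fun j => (p j).2) = γ := funext hp.2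
    simp only [this]
    ring

/-- The function `ψ` is the remainder of the expansion of the radial kernel with profile `f`
into monomials of total degree `< 2 * R - 1`. -/
structure KernelExpansion (d : ℕ) (f : ℝ → ℝ) (R : ℕ) (ψ : ℝ → ℝ) : Prop where
  pos : 1 ≤ R
  continuousAt : ContinuousAt ψ 0
  apply_zero : ψ 0 = iteratedDeriv (2 * R - 1) f 0 / (2 * R - 1).factorial
  symm : ∀ α β : Fin d → ℕ, ∑ j, α j + ∑ j, β j < 2 * R - 1 →
    wronskianEntry (stationaryKernel d f) α β = wronskianEntry (stationaryKernel d f) β α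
  eq : ∀ x y : EuclideanSpace ℝ (Fin d),
    stationaryKernel d f x y = (∑ α ∈ multiIdxLT d (2 * R - 1), ∑ β ∈ multiIdxLT d (2 * R - 1),
      if ∑ j, α j + ∑ j, β j < 2 * R - 1 then
        wronskianEntry (stationaryKernel d f) α β * monomialFun α x * monomialFun β y else 0) +
      ‖x - y‖ ^ (2 * R - 1) * ψ ‖x - y‖

theorem exists_kernelExpansion {d : ℕ} {f : ℝ → ℝ} (hf : AnalyticAt ℝ f 0) {R : ℕ} (hR1 : 1 ≤ R)
    (hR : (R : ℕ∞) ≤ smoothnessOrder f) : ∃ ψ : ℝ → ℝ, KernelExpansion d f R ψ := by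
  obtain ⟨ψ, q, hψ, hψ0, hq, hodd, hexp⟩ := exists_jetPoly_add (d := d) hf hR
  have hw : ∀ α β : Fin d → ℕ, ∑ j, α j + ∑ j, β j < 2 * R - 1 →
      wronskianEntry (stationaryKernel d f) α β = (-1) ^ (∑ j, β j) * q (α + β) /
      ((∏ i, ((α i).factorial : ℝ)) * ∏ i, ((β i).factorial : ℝ)) := by
    intro α β h
    refine wronskianEntry_stationaryKernel hq ?_ (by omega)
    refine ⟨radialTerm 0 ((2 * R - 1 : ℕ) : ℤ) ψ, flatJet_radialTerm _ _ hψ ?_,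
      Eventually.of_forall fun z => ?_⟩
    · simp only [Pi.zero_apply, Finset.sum_const_zero]
      omega
    · simp only [radialTerm, divPow_zero_left, one_mul, zpow_natCast]
      exact hexp z
  refine ⟨ψ, hR1, hψ.continuousAt, hψ0, fun α β h => ?_, fun x y => ?_⟩
  · rw [hw α β h, hw β α (by omega), add_comm β α, mul_comm (∏ i, ((β i).factorial : ℝ))]
    congr 1
    -- Exchanging `α` and `β` changes only the sign `(-1) ^ |β|` into `(-1) ^ |α|`; the two differ
    -- exactly when `|α + β|` is odd, and there `q` vanishes.
    by_cases ho : Odd (∑ j, (α + β) j)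
    · rw [hodd _ ho, mul_zero, mul_zero]
    · congr 1
      simp only [Pi.add_apply, Finset.sum_add_distrib, Nat.not_odd_iff_even] at ho
      have h1 : (-1 : ℝ) ^ (∑ j, α j) * (-1) ^ (∑ j, β j) = 1 := by
        rw [← pow_add]; exact ho.neg_one_pow
      have h2 : (-1 : ℝ) ^ (∑ j, β j) * (-1) ^ (∑ j, β j) = 1 := by
        rw [← mul_pow]; simp
      exact (mul_right_cancel₀ (by positivity) (h1.trans h2.symm)).symm
  · show f ‖x - y‖ = _
    rw [hexp, jetPoly_sub]
    congr 1
    refine Finset.sum_congr rfl fun α _ => Finset.sum_congr rfl fun β _ => ?_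
    split_ifs with h
    · rw [hw α β h, divPow_eq, divPow_eq]
      have h1 : (∏ j, ((α j).factorial : ℝ)) ≠ 0 :=
        Finset.prod_ne_zero_iff.2 fun j _ => by positivity
      have h2 : (∏ j, ((β j).factorial : ℝ)) ≠ 0 :=
        Finset.prod_ne_zero_iff.2 fun j _ => by positivity
      field_simp
    · rfl

/-! ### Quadratic forms of weighted point families -/

/-- Weights are added up over coinciding points. Families with repetitions are needed later, when
two configurations are joined by `Sum.elim` and may overlap. -/
theorem IsPosSemidefKernel.sum_nonneg {E : Type*} {κ : E → E → ℝ} (h : IsPosSemidefKernel κ)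
    {ι : Type*} [Fintype ι] (y : ι → E) (c : ι → ℝ) :
    0 ≤ ∑ i, ∑ j, c i * c j * κ (y i) (y j) := by
  classical
  have h1 := h (Finset.univ.image y) fun x => ∑ i with y i = x, c i
  convert h1 using 1
  have hfib : ∀ g : ι → ℝ, ∑ i, g i = ∑ x ∈ Finset.univ.image y, ∑ i with y i = x, g i := fun g =>
    (Finset.sum_fiberwise_of_maps_to (fun i _ => Finset.mem_image_of_mem y (Finset.mem_univ i)) g).symm
  rw [hfib]
  refine Finset.sum_congr rfl fun x _ => ?_
  have h2 : ∑ i with y i = x, ∑ j, c i * c j * κ (y i) (y j)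
      = ∑ i with y i = x, ∑ j, c i * c j * κ x (y j) :=
    Finset.sum_congr rfl fun i hi => by rw [(Finset.mem_filter.1 hi).2]
  rw [h2, Finset.sum_comm, hfib]
  refine Finset.sum_congr rfl fun x' _ => ?_
  rw [Finset.sum_mul_sum, Finset.sum_mul, Finset.sum_comm]
  refine Finset.sum_congr rfl fun i _ => ?_
  rw [Finset.sum_mul]
  refine Finset.sum_congr rfl fun j hj => ?_
  rw [(Finset.mem_filter.1 hj).2]

/-- The moment of order `α` of the weights `c` at the points `y`. -/
noncomputable def moment {d : ℕ} {ι : Type*} [Fintype ι] (y : ι → EuclideanSpace ℝ (Fin d))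
    (c : ι → ℝ) (α : Fin d → ℕ) : ℝ :=
  ∑ i, c i * monomialFun α (y i)

/-- The quadratic form of the matrix of the `p`-th powers of the distances. -/
noncomputable def distForm {d : ℕ} {ι : Type*} [Fintype ι] (p : ℕ)
    (y : ι → EuclideanSpace ℝ (Fin d)) (c : ι → ℝ) : ℝ :=
  ∑ i, ∑ j, c i * c j * ‖y i - y j‖ ^ p

/-- The quadratic form of a Wronskian matrix, truncated to total degree `< N`. -/
noncomputable def truncForm {d : ℕ} (N : ℕ) (w : (Fin d → ℕ) → (Fin d → ℕ) → ℝ)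
    (a : (Fin d → ℕ) → ℝ) : ℝ :=
  ∑ α ∈ multiIdxLT d N, ∑ β ∈ multiIdxLT d N,
    if ∑ j, α j + ∑ j, β j < N then w α β * a α * a β else 0

theorem truncForm_const_mul {d N : ℕ} (w : (Fin d → ℕ) → (Fin d → ℕ) → ℝ) (c : ℝ)
    (a : (Fin d → ℕ) → ℝ) : truncForm N w (fun α => c * a α) = c ^ 2 * truncForm N w a := by
  unfold truncForm
  rw [Finset.mul_sum]
  refine Finset.sum_congr rfl fun α _ => ?_
  rw [Finset.mul_sum]
  refine Finset.sum_congr rfl fun β _ => ?_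
  split_ifs <;> ring

theorem truncForm_congr {d N : ℕ} (w : (Fin d → ℕ) → (Fin d → ℕ) → ℝ)
    {a b : (Fin d → ℕ) → ℝ} (h : ∀ α, ∑ j, α j < N → a α = b α) :
    truncForm N w a = truncForm N w b := by
  unfold truncForm
  refine Finset.sum_congr rfl fun α hα => Finset.sum_congr rfl fun β hβ => ?_
  rw [h α (mem_multiIdxLT.1 hα), h β (mem_multiIdxLT.1 hβ)]

/-- A pair of degrees with sum below `2R - 1` has one member below `R`. -/
theorem truncForm_eq_zero {d R : ℕ} (w : (Fin d → ℕ) → (Fin d → ℕ) → ℝ)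
    {a : (Fin d → ℕ) → ℝ} (h : ∀ α, ∑ j, α j < R → a α = 0) :
    truncForm (2 * R - 1) w a = 0 := by
  unfold truncForm
  refine Finset.sum_eq_zero fun α _ => Finset.sum_eq_zero fun β _ => ?_
  split_ifs with h1
  · rcases lt_or_ge (∑ j, α j) R with h2 | h2
    · rw [h α h2]; ring
    · rw [h β (by omega)]; ring
  · rfl

/-- Two degrees below `R` add up to at most `2R - 2`, so the truncation is inactive. -/
theorem truncForm_eq_sum {d R : ℕ} (w : (Fin d → ℕ) → (Fin d → ℕ) → ℝ)
    {a : (Fin d → ℕ) → ℝ} (h : ∀ α, R ≤ ∑ j, α j → a α = 0) :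
    truncForm (2 * R - 1) w a = ∑ α ∈ multiIdxLT d R, ∑ β ∈ multiIdxLT d R, w α β * a α * a β := by
  unfold truncForm
  have hsub : multiIdxLT d R ⊆ multiIdxLT d (2 * R - 1) := fun α hα => by
    rw [mem_multiIdxLT] at hα ⊢
    omega
  rw [← Finset.sum_subset hsub]
  · refine Finset.sum_congr rfl fun α hα => ?_
    rw [← Finset.sum_subset hsub]
    · refine Finset.sum_congr rfl fun β hβ => ?_
      rw [mem_multiIdxLT] at hα hβ
      rw [if_pos (by omega)]
    · intro β _ hβ
      rw [mem_multiIdxLT, not_lt] at hβ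
      rw [h β hβ, mul_zero, ite_self]
  · intro α _ hα
    rw [mem_multiIdxLT, not_lt] at hα
    refine Finset.sum_eq_zero fun β _ => ?_
    rw [h α hα, mul_zero, zero_mul, ite_self]

theorem monomialFun_smul {d : ℕ} (α : Fin d → ℕ) (c : ℝ) (x : EuclideanSpace ℝ (Fin d)) :
    monomialFun α (c • x) = c ^ (∑ j, α j) * monomialFun α x := by
  simp [monomialFun, mul_pow, Finset.prod_mul_distrib, Finset.prod_pow_eq_pow_sum]

theorem moment_smul_points {d : ℕ} {ι : Type*} [Fintype ι] (y : ι → EuclideanSpace ℝ (Fin d))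
    (c : ι → ℝ) (α : Fin d → ℕ) (t : ℝ) :
    moment (fun i => t • y i) c α = t ^ (∑ j, α j) * moment y c α := by
  unfold moment
  rw [Finset.mul_sum]
  refine Finset.sum_congr rfl fun i _ => ?_
  rw [monomialFun_smul]
  ring

theorem moment_const_mul {d : ℕ} {ι : Type*} [Fintype ι] (y : ι → EuclideanSpace ℝ (Fin d))
    (c : ι → ℝ) (α : Fin d → ℕ) (t : ℝ) :
    moment y (fun i => t * c i) α = t * moment y c α := by
  unfold moment
  rw [Finset.mul_sum]
  exact Finset.sum_congr rfl fun i _ => by ring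

theorem moment_sum {d : ℕ} {ι σ : Type*} [Fintype ι] (y : ι → EuclideanSpace ℝ (Fin d))
    (s : Finset σ) (c : σ → ι → ℝ) (α : Fin d → ℕ) :
    moment y (fun i => ∑ k ∈ s, c k i) α = ∑ k ∈ s, moment y (c k) α := by
  unfold moment
  rw [Finset.sum_comm]
  exact Finset.sum_congr rfl fun i _ => by rw [Finset.sum_mul]

theorem moment_sumElim {d : ℕ} {ι σ : Type*} [Fintype ι] [Fintype σ]
    (y : ι → EuclideanSpace ℝ (Fin d)) (z : σ → EuclideanSpace ℝ (Fin d))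
    (c : ι → ℝ) (b : σ → ℝ) (α : Fin d → ℕ) :
    moment (Sum.elim y z) (Sum.elim c b) α = moment y c α + moment z b α := by
  simp [moment]

theorem distForm_sumElim {d p : ℕ} {ι σ : Type*} [Fintype ι] [Fintype σ]
    (y : ι → EuclideanSpace ℝ (Fin d)) (z : σ → EuclideanSpace ℝ (Fin d))
    (c : ι → ℝ) (b : σ → ℝ) :
    distForm p (Sum.elim y z) (Sum.elim c b) = distForm p y c +
      2 * (∑ i, ∑ j, c i * b j * ‖y i - z j‖ ^ p) + distForm p z b := by
  unfold distForm
  simp only [Fintype.sum_sum_type, Sum.elim_inl, Sum.elim_inr, Finset.sum_add_distrib]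
  have h : ∑ j, ∑ i, b j * c i * ‖z j - y i‖ ^ p = ∑ i, ∑ j, c i * b j * ‖y i - z j‖ ^ p := by
    rw [Finset.sum_comm]
    refine Finset.sum_congr rfl fun i _ => Finset.sum_congr rfl fun j _ => ?_
    rw [norm_sub_rev]
    ring
  rw [h]
  ring

theorem distForm_const_mul {d p : ℕ} {ι : Type*} [Fintype ι]
    (y : ι → EuclideanSpace ℝ (Fin d)) (c : ι → ℝ) (t : ℝ) :
    distForm p y (fun i => t * c i) = t ^ 2 * distForm p y c := by
  unfold distForm
  rw [Finset.mul_sum]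
  refine Finset.sum_congr rfl fun i _ => ?_
  rw [Finset.mul_sum]
  exact Finset.sum_congr rfl fun j _ => by ring

theorem distForm_smul_points {d p : ℕ} {ι : Type*} [Fintype ι]
    (y : ι → EuclideanSpace ℝ (Fin d)) (c : ι → ℝ) {t : ℝ} (ht : 0 ≤ t) :
    distForm p (fun i => t • y i) c = t ^ p * distForm p y c := by
  unfold distForm
  rw [Finset.mul_sum]
  refine Finset.sum_congr rfl fun i _ => ?_
  rw [Finset.mul_sum]
  refine Finset.sum_congr rfl fun j _ => ?_
  rw [← smul_sub, norm_smul, Real.norm_of_nonneg ht, mul_pow]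
  ring

theorem distForm_sumElim_zero {d p : ℕ} {ι σ : Type*} [Fintype ι] [Fintype σ]
    (y : ι → EuclideanSpace ℝ (Fin d)) (z : σ → EuclideanSpace ℝ (Fin d)) (c : ι → ℝ) :
    distForm p (Sum.elim y z) (Sum.elim c fun _ => 0) = distForm p y c := by
  rw [distForm_sumElim]
  simp [distForm]

/-- The polynomial part sees the weights only through their moments, so it can be controlled by
prescribing moments. -/
theorem KernelExpansion.sum_eq {d R : ℕ} {f ψ : ℝ → ℝ} (h : KernelExpansion d f R ψ) {ι : Type*}
    [Fintype ι] (y : ι → EuclideanSpace ℝ (Fin d)) (c : ι → ℝ) {ε : ℝ} (hε : 0 ≤ ε) :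
    ∑ i, ∑ j, c i * c j * stationaryKernel d f (ε • y i) (ε • y j) =
      truncForm (2 * R - 1) (wronskianEntry (stationaryKernel d f))
        (fun α => ε ^ (∑ j, α j) * moment y c α) +
      ε ^ (2 * R - 1) * ∑ i, ∑ j, c i * c j * ‖y i - y j‖ ^ (2 * R - 1) * ψ (ε * ‖y i - y j‖) := by
  have h1 : ∀ i j, c i * c j * stationaryKernel d f (ε • y i) (ε • y j) =
      (∑ α ∈ multiIdxLT d (2 * R - 1), ∑ β ∈ multiIdxLT d (2 * R - 1),
      if ∑ j, α j + ∑ j, β j < 2 * R - 1 then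
        wronskianEntry (stationaryKernel d f) α β * (ε ^ (∑ j, α j) * (c i * monomialFun α (y i))) *
          (ε ^ (∑ j, β j) * (c j * monomialFun β (y j))) else 0) +
      ε ^ (2 * R - 1) * (c i * c j * ‖y i - y j‖ ^ (2 * R - 1) * ψ (ε * ‖y i - y j‖)) := by
    intro i j
    rw [h.eq, mul_add, Finset.mul_sum]
    congr 1
    · refine Finset.sum_congr rfl fun α _ => ?_
      rw [Finset.mul_sum]
      refine Finset.sum_congr rfl fun β _ => ?_
      rw [monomialFun_smul, monomialFun_smul]
      split_ifs
      · ring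
      · ring
    · rw [← smul_sub, norm_smul, Real.norm_of_nonneg hε, mul_pow]
      ring
  simp only [h1, Finset.sum_add_distrib, ← Finset.mul_sum]
  congr 1
  unfold truncForm moment
  have h2 : ∀ i, ∑ j, ∑ α ∈ multiIdxLT d (2 * R - 1), ∑ β ∈ multiIdxLT d (2 * R - 1),
      (if ∑ j, α j + ∑ j, β j < 2 * R - 1 then
        wronskianEntry (stationaryKernel d f) α β * (ε ^ (∑ j, α j) * (c i * monomialFun α (y i))) *
          (ε ^ (∑ j, β j) * (c j * monomialFun β (y j))) else 0)
      = ∑ α ∈ multiIdxLT d (2 * R - 1), ∑ β ∈ multiIdxLT d (2 * R - 1), ∑ j,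
      (if ∑ j, α j + ∑ j, β j < 2 * R - 1 then
        wronskianEntry (stationaryKernel d f) α β * (ε ^ (∑ j, α j) * (c i * monomialFun α (y i))) *
          (ε ^ (∑ j, β j) * (c j * monomialFun β (y j))) else 0) := by
    intro i
    rw [Finset.sum_comm]
    exact Finset.sum_congr rfl fun α _ => Finset.sum_comm
  simp only [h2]
  rw [Finset.sum_comm]
  refine Finset.sum_congr rfl fun α _ => ?_
  rw [Finset.sum_comm]
  refine Finset.sum_congr rfl fun β _ => ?_
  split_ifs
  · rw [Finset.mul_sum, Finset.mul_sum, Finset.mul_sum, Finset.sum_mul]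
    refine Finset.sum_congr rfl fun i _ => ?_
    rw [Finset.mul_sum]
  · simp

theorem KernelExpansion.tendsto_remainder {d R : ℕ} {f ψ : ℝ → ℝ} (h : KernelExpansion d f R ψ)
    (r : ℝ) : Tendsto (fun ε => ψ (ε * r)) (𝓝[>] 0) (𝓝 (ψ 0)) := by
  refine h.continuousAt.tendsto.comp ?_
  have : Tendsto (fun ε : ℝ => ε * r) (𝓝 0) (𝓝 (0 * r)) :=
    (continuous_id.mul continuous_const).tendsto 0
  rw [zero_mul] at this
  exact this.mono_left nhdsWithin_le_nhds

/-- The inequality `ε ^ (2l) A + ε ^ (2R - 1) Ψ ε ≥ 0` is divided by its leading power: either `A`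
dominates, or `A = 0` and the limit of `Ψ` is nonnegative. The weights may depend on `ε` so as to
compensate the scaling of the moments. -/
theorem KernelExpansion.nonneg_of_truncForm_eq {d R : ℕ} {f ψ : ℝ → ℝ}
    (h : KernelExpansion d f R ψ) (hpos : IsPosSemidefKernel (stationaryKernel d f)) {ι : Type*}
    [Fintype ι] (y : ι → EuclideanSpace ℝ (Fin d)) {c : ℝ → ι → ℝ} {c₀ : ι → ℝ}
    (hc : Tendsto c (𝓝[>] 0) (𝓝 c₀)) {l : ℕ} {A : ℝ}
    (hA : ∀ ε : ℝ, 0 < ε → truncForm (2 * R - 1) (wronskianEntry (stationaryKernel d f))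
        (fun α => ε ^ (∑ j, α j) * moment y (c ε) α) = (ε ^ l) ^ 2 * A) :
    (2 * l < 2 * R - 1 → 0 ≤ A) ∧ (A = 0 → 0 ≤ ψ 0 * distForm (2 * R - 1) y c₀) := by
  set Ψ : ℝ → ℝ := fun ε =>
    ∑ i, ∑ j, c ε i * c ε j * ‖y i - y j‖ ^ (2 * R - 1) * ψ (ε * ‖y i - y j‖) with hΨ
  have hlim : Tendsto Ψ (𝓝[>] 0) (𝓝 (ψ 0 * distForm (2 * R - 1) y c₀)) := by
    have : ψ 0 * distForm (2 * R - 1) y c₀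
        = ∑ i, ∑ j, c₀ i * c₀ j * ‖y i - y j‖ ^ (2 * R - 1) * ψ 0 := by
      unfold distForm
      rw [mul_comm, Finset.sum_mul]
      exact Finset.sum_congr rfl fun i _ => by rw [Finset.sum_mul]
    rw [this]
    have hci := tendsto_pi_nhds.1 hc
    exact tendsto_finsetSum _ fun i _ => tendsto_finsetSum _ fun j _ =>
      (((hci i).mul (hci j)).mul_const _).mul (h.tendsto_remainder _)
  have hge : ∀ ε : ℝ, 0 < ε → 0 ≤ (ε ^ l) ^ 2 * A + ε ^ (2 * R - 1) * Ψ ε := by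
    intro ε hε
    rw [← hA ε hε, ← h.sum_eq y (c ε) hε.le]
    exact hpos.sum_nonneg (fun i => ε • y i) (c ε)
  constructor
  · intro hl
    have h1 : Tendsto (fun ε => A + ε ^ (2 * R - 1 - 2 * l) * Ψ ε) (𝓝[>] 0) 
        (𝓝 (A + 0 * (ψ 0 * distForm (2 * R - 1) y c₀))) := by
      refine tendsto_const_nhds.add (Tendsto.mul ?_ hlim)
      have : Tendsto (fun ε : ℝ => ε ^ (2 * R - 1 - 2 * l)) (𝓝 0) (𝓝 (0 ^ (2 * R - 1 - 2 * l))) :=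
        (continuous_pow _).tendsto 0
      rw [zero_pow (by omega)] at this
      exact this.mono_left nhdsWithin_le_nhds
    rw [zero_mul, add_zero] at h1
    refine ge_of_tendsto h1 ?_
    filter_upwards [self_mem_nhdsWithin] with ε hε
    have hε : 0 < ε := hε
    have h2 := hge ε hε
    have h3 : ε ^ (2 * R - 1) = (ε ^ l) ^ 2 * ε ^ (2 * R - 1 - 2 * l) := by
      rw [← pow_mul, ← pow_add]; congr 1; omega
    rw [h3, mul_assoc, ← mul_add] at h2
    exact nonneg_of_mul_nonneg_right h2 (by positivity)
  · intro hA0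
    refine ge_of_tendsto hlim ?_
    filter_upwards [self_mem_nhdsWithin] with ε hε
    have hε : 0 < ε := hε
    have h2 := hge ε hε
    rw [hA0, mul_zero, zero_add] at h2
    exact nonneg_of_mul_nonneg_right h2 (by positivity)

theorem KernelExpansion.distForm_nonneg {d R : ℕ} {f ψ : ℝ → ℝ}
    (h : KernelExpansion d f R ψ) (hpos : IsPosSemidefKernel (stationaryKernel d f)) {ι : Type*}
    [Fintype ι] (y : ι → EuclideanSpace ℝ (Fin d)) {c : ι → ℝ}
    (hc : ∀ α, ∑ j, α j < R → moment y c α = 0) :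
    0 ≤ ψ 0 * distForm (2 * R - 1) y c := by
  refine (h.nonneg_of_truncForm_eq hpos y (c := fun _ => c) tendsto_const_nhds (l := 0) (A := 0)
    fun ε _ => ?_).2 rfl
  rw [truncForm_eq_zero _ fun α hα => by rw [hc α hα, mul_zero]]
  simp

/-! ### Dual weights on grids -/

theorem exists_dual_weights_nat (N : ℕ) : ∃ u : ℕ → Fin (N + 1) → ℝ, ∀ a b, a ≤ N → b ≤ N →
    ∑ i, u a i * (i : ℝ) ^ b = if a = b then 1 else 0 := by
  set V : Matrix (Fin (N + 1)) (Fin (N + 1)) ℝ := Matrix.vandermonde fun i => (i : ℝ) with hV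
  have hdet : IsUnit V.det := by
    refine IsUnit.mk0 _ (Matrix.det_vandermonde_ne_zero_iff.2 fun i j hij => ?_)
    exact Fin.ext (by exact_mod_cast hij)
  refine ⟨fun a i => if h : a < N + 1 then V⁻¹ ⟨a, h⟩ i else 0, fun a b ha hb => ?_⟩
  have ha' : a < N + 1 := by omega
  have hb' : b < N + 1 := by omega
  have h1 := congrFun (congrFun (Matrix.nonsing_inv_mul V hdet) ⟨a, ha'⟩) ⟨b, hb'⟩
  rw [Matrix.mul_apply, Matrix.one_apply] at h1
  simpa [ha', hV, Matrix.vandermonde_apply] using h1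

/-- Tensor products of rows of an inverse Vandermonde matrix on a grid. They realise any prescribed
moments up to order `N`. -/
theorem exists_dual_weights (d N : ℕ) :
    ∃ (y : (Fin d → Fin (N + 1)) → EuclideanSpace ℝ (Fin d))
      (u : (Fin d → ℕ) → (Fin d → Fin (N + 1)) → ℝ),
      ∀ α β, ∑ j, α j ≤ N → ∑ j, β j ≤ N → moment y (u α) β = if α = β then 1 else 0 := by
  classical
  obtain ⟨u, hu⟩ := exists_dual_weights_nat N
  refine ⟨fun g => WithLp.toLp 2 fun j => ((g j : ℕ) : ℝ), fun α g => ∏ j, u (α j) (g j),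
    fun α β hα hβ => ?_⟩
  have hle : ∀ (γ : Fin d → ℕ) (j : Fin d), γ j ≤ ∑ j, γ j := fun γ j =>
    Finset.single_le_sum (f := γ) (fun _ _ => Nat.zero_le _) (Finset.mem_univ j)
  have h1 : moment (fun g : Fin d → Fin (N + 1) => WithLp.toLp 2 fun j => ((g j : ℕ) : ℝ))
      (fun g => ∏ j, u (α j) (g j)) β = ∏ j, ∑ i, u (α j) i * (i : ℝ) ^ β j := by
    rw [Finset.prod_univ_sum, Fintype.piFinset_univ]
    simp [moment, monomialFun, Finset.prod_mul_distrib]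
  rw [h1]
  rw [Finset.prod_congr rfl fun j _ => hu (α j) (β j) ((hle α j).trans hα) ((hle β j).trans hβ)]
  split_ifs with h
  · simp [h]
  · obtain ⟨j, hj⟩ := Function.ne_iff.1 h
    exact Finset.prod_eq_zero (Finset.mem_univ j) (if_neg hj)

theorem moment_sum_dual {d N : ℕ} {ι : Type*} [Fintype ι] {y : ι → EuclideanSpace ℝ (Fin d)}
    {u : (Fin d → ℕ) → ι → ℝ}
    (hu : ∀ α β, ∑ j, α j ≤ N → ∑ j, β j ≤ N → moment y (u α) β = if α = β then 1 else 0)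
    {s : Finset (Fin d → ℕ)} (hs : ∀ α ∈ s, ∑ j, α j ≤ N) (b : (Fin d → ℕ) → ℝ) (β : Fin d → ℕ)
    (hβ : ∑ j, β j ≤ N) :
    moment y (fun i => ∑ α ∈ s, b α * u α i) β = if β ∈ s then b β else 0 := by
  rw [moment_sum]
  rw [Finset.sum_congr rfl fun α hα => by rw [moment_const_mul, hu α β (hs α hα) hβ]]
  simp

/-- The test weights are chosen so that the moment of order `α`, after scaling the points by `ε`,
equals `ε ^ (R - 1) * a α`. The polynomial part is then of order `2R - 2`, just below the remainder.
-/
theorem KernelExpansion.wronskian_nonneg {d R : ℕ} {f ψ : ℝ → ℝ}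
    (h : KernelExpansion d f R ψ) (hpos : IsPosSemidefKernel (stationaryKernel d f))
    (a : (Fin d → ℕ) → ℝ) :
    0 ≤ ∑ α ∈ multiIdxLT d R, ∑ β ∈ multiIdxLT d R,
      wronskianEntry (stationaryKernel d f) α β * a α * a β := by
  have hR := h.pos
  obtain ⟨y, u, hu⟩ := exists_dual_weights d (2 * R - 1)
  set a' : (Fin d → ℕ) → ℝ := fun α => if ∑ j, α j < R then a α else 0 with ha'
  have hsum : ∑ α ∈ multiIdxLT d R, ∑ β ∈ multiIdxLT d R,
      wronskianEntry (stationaryKernel d f) α β * a α * a β =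
      truncForm (2 * R - 1) (wronskianEntry (stationaryKernel d f)) a' := by
    rw [truncForm_eq_sum _ fun α hα => if_neg (by omega)]
    refine Finset.sum_congr rfl fun α hα => Finset.sum_congr rfl fun β hβ => ?_
    rw [mem_multiIdxLT] at hα hβ
    simp [hα, hβ]
  rw [hsum]
  set c : ℝ → (Fin d → Fin (2 * R - 1 + 1)) → ℝ := fun ε i =>
    ∑ α ∈ multiIdxLT d R, (ε ^ (R - 1 - ∑ j, α j) * a α) * u α i with hc
  have hcont : Continuous c := by
    rw [hc]; fun_prop
  refine (h.nonneg_of_truncForm_eq hpos y (c := c)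
    ((hcont.tendsto 0).mono_left nhdsWithin_le_nhds) (l := R - 1) fun ε hε => ?_).1 (by omega)
  rw [← truncForm_const_mul]
  refine truncForm_congr _ fun β hβ => ?_
  rw [hc]
  rw [moment_sum_dual hu (fun α hα => by rw [mem_multiIdxLT] at hα; omega) _ β (by omega)]
  simp only [ha', mem_multiIdxLT]
  split_ifs with h1
  · rw [← mul_assoc, ← pow_add]
    congr 2
    omega
  · simp

/-- A null vector `a` of the Wronskian enlarges the space where the distance form is nonnegative:
the moments of degree `l` need not vanish, but may equal those of `a`. Auxiliary weights supply the
lower moments `ε ^ (l - |α|) * a α`, so that the scaled moments form `ε ^ l • a` and the polynomial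
part is zero; these auxiliary weights disappear as `ε → 0`. -/
theorem KernelExpansion.distForm_nonneg_of_wronskian_eq_zero {d R : ℕ} {f ψ : ℝ → ℝ}
    (h : KernelExpansion d f R ψ) (hpos : IsPosSemidefKernel (stationaryKernel d f))
    {a : (Fin d → ℕ) → ℝ}
    (ha : ∑ α ∈ multiIdxLT d R, ∑ β ∈ multiIdxLT d R,
      wronskianEntry (stationaryKernel d f) α β * a α * a β = 0)
    {l : ℕ} (hl : l < R) (hal : ∀ α, l < ∑ j, α j → a α = 0) {ι : Type*} [Fintype ι]
    (y : ι → EuclideanSpace ℝ (Fin d)) (c : ι → ℝ)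
    (hc : ∀ α, ∑ j, α j < 2 * R - 1 → moment y c α = if ∑ j, α j = l then a α else 0) :
    0 ≤ ψ 0 * distForm (2 * R - 1) y c := by
  obtain ⟨z, u, hu⟩ := exists_dual_weights d (2 * R - 1)
  rw [← truncForm_eq_sum _ fun α hα => hal α (by omega)] at ha
  set b : ℝ → (Fin d → Fin (2 * R - 1 + 1)) → ℝ := fun ε i =>
    ∑ α ∈ multiIdxLT d l, (ε ^ (l - ∑ j, α j) * a α) * u α i with hb
  have hcont : Continuous b := by
    rw [hb]; fun_prop
  have hb0 : b 0 = fun _ => 0 := by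
    funext i
    refine Finset.sum_eq_zero fun α hα => ?_
    rw [mem_multiIdxLT] at hα
    rw [zero_pow (by omega), zero_mul, zero_mul]
  have hlim : Tendsto (fun ε => Sum.elim c (b ε)) (𝓝[>] 0) (𝓝 (Sum.elim c fun _ => 0)) := by
    rw [← hb0]
    have : Continuous fun ε => (Sum.elim c (b ε) : ι ⊕ (Fin d → Fin (2 * R - 1 + 1)) → ℝ) := by
      refine continuous_pi fun i => ?_
      rcases i with i | i
      · exact continuous_const
      · exact (continuous_apply i).comp hcont
    exact (this.tendsto 0).mono_left nhdsWithin_le_nhds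
  have h1 := (h.nonneg_of_truncForm_eq hpos (Sum.elim y z) hlim (l := l) (A := 0) fun ε hε => ?_).2
    rfl
  · rwa [distForm_sumElim_zero] at h1
  · rw [← ha, ← truncForm_const_mul]
    refine truncForm_congr _ fun β hβ => ?_
    rw [moment_sumElim, hc β hβ, hb]
    rw [moment_sum_dual hu (fun α hα => by rw [mem_multiIdxLT] at hα; omega) _ β (by omega)]
    simp only [mem_multiIdxLT]
    rcases lt_trichotomy (∑ j, β j) l with h2 | h2 | h2
    · rw [if_neg h2.ne, if_pos h2, zero_add, ← mul_assoc, ← pow_add]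
      congr 2
      omega
    · rw [if_pos h2, if_neg (by omega), h2, add_zero]
    · rw [if_neg h2.ne', if_neg (by omega), hal β h2]
      simp

/-! ### Finite differences -/

/-- The weights of the `n`-th forward difference. -/
noncomputable def diffWeight (n : ℕ) (k : Fin (n + 1)) : ℝ :=
  (-1) ^ (n - (k : ℕ)) * (n.choose k : ℝ)

theorem sum_diffWeight_mul (n : ℕ) (g : ℝ → ℝ) (x : ℝ) :
    ∑ k, diffWeight n k * g (x + (k : ℕ)) = (fwdDiff (1 : ℝ))^[n] g x := by
  rw [fwdDiff_iter_eq_sum_shift, Finset.sum_range]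
  refine Finset.sum_congr rfl fun k _ => ?_
  simp [diffWeight]

theorem sum_diffWeight_polynomial {n : ℕ} {P : Polynomial ℝ} (hP : P.natDegree < n) :
    ∑ k, diffWeight n k * P.eval ((k : ℕ) : ℝ) = 0 := by
  have h := sum_diffWeight_mul n (fun x => P.eval x) 0
  simp only [zero_add] at h
  rw [h, Polynomial.fwdDiff_iter_eq_zero_of_degree_lt hP]
  rfl

theorem exists_polynomial_monomialFun_line {d : ℕ} (α : Fin d → ℕ)
    (x v : EuclideanSpace ℝ (Fin d)) :
    ∃ P : Polynomial ℝ, P.natDegree ≤ ∑ j, α j ∧ ∀ t, P.eval t = monomialFun α (x + t • v) := by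
  refine ⟨∏ j, (Polynomial.C (v j) * Polynomial.X + Polynomial.C (x j)) ^ α j, ?_, fun t => ?_⟩
  · refine (Polynomial.natDegree_prod_le _ _).trans (Finset.sum_le_sum fun j _ => ?_)
    refine Polynomial.natDegree_pow_le.trans ?_
    calc α j * _ ≤ α j * 1 := by gcongr; exact Polynomial.natDegree_linear_le
      _ = α j := mul_one _
  · rw [Polynomial.eval_prod]
    refine Finset.prod_congr rfl fun j _ => ?_
    simp only [Polynomial.eval_pow, Polynomial.eval_add, Polynomial.eval_mul, Polynomial.eval_C,
      Polynomial.eval_X, PiLp.add_apply, PiLp.smul_apply, smul_eq_mul]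
    ring

theorem moment_line {d n : ℕ} (x v : EuclideanSpace ℝ (Fin d)) {α : Fin d → ℕ}
    (hα : ∑ j, α j < n) :
    moment (fun k : Fin (n + 1) => x + ((k : ℕ) : ℝ) • v) (diffWeight n) α = 0 := by
  obtain ⟨P, hP, hPe⟩ := exists_polynomial_monomialFun_line α x v
  rw [← sum_diffWeight_polynomial (hP.trans_lt hα)]
  simp [moment, hPe]

theorem sum_diffWeight_odd_pow {n e : ℕ} (he : e < n) :
    ∑ k, diffWeight n k * (2 * ((k : ℕ) : ℝ) - 1) ^ e = 0 := by
  set P : Polynomial ℝ := (Polynomial.C 2 * Polynomial.X - Polynomial.C 1) ^ e with hP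
  have h1 : P.natDegree ≤ e := by
    refine Polynomial.natDegree_pow_le.trans ?_
    rw [sub_eq_add_neg, ← Polynomial.C_neg]
    calc e * _ ≤ e * 1 := by gcongr; exact Polynomial.natDegree_linear_le
      _ = e := mul_one _
  rw [← sum_diffWeight_polynomial (h1.trans_lt he)]
  simp [hP]

/-- On the grid `-1, 1, 3, …` the function `g` agrees with `t ^ e` except for the opposite value at
`-1`. The difference annihilates `t ^ e`, so only a nonzero multiple of the first weight is left. -/
theorem sum_diffWeight_ne_zero {n e : ℕ} (he : e < n) {g : ℝ → ℝ} (hg : ∀ t, 0 < t → g t = t ^ e)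
    (hg1 : g (-1) = -(-1) ^ e) : ∑ k, diffWeight n k * g (2 * ((k : ℕ) : ℝ) - 1) ≠ 0 := by
  have h0 := sum_diffWeight_odd_pow he
  rw [Fin.sum_univ_succ] at h0 ⊢
  have h1 : ∀ k : Fin n, g (2 * ((k.succ : ℕ) : ℝ) - 1) = (2 * ((k.succ : ℕ) : ℝ) - 1) ^ e := by
    intro k
    refine hg _ ?_
    have : (0 : ℝ) ≤ (k : ℕ) := Nat.cast_nonneg _
    simp only [Fin.val_succ, Nat.cast_add, Nat.cast_one]
    linarith
  simp only [h1]
  have h2 : (2 * (((0 : Fin (n + 1)) : ℕ) : ℝ) - 1) = -1 := by simp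
  rw [h2] at h0 ⊢
  rw [hg1]
  intro h3
  have h4 : diffWeight n 0 * (2 * (-1) ^ e) = 0 := by linear_combination h0 - h3
  have h5 : diffWeight n 0 ≠ 0 := by simp [diffWeight]
  have h6 : (2 * (-1) ^ e : ℝ) ≠ 0 := by positivity
  exact mul_ne_zero h5 h6 h4

/-! ### Positivity of B-splines at the integers -/

theorem fwdDiff_iter_id_mul (u : ℝ → ℝ) (m : ℕ) (x : ℝ) :
    (fwdDiff (1 : ℝ))^[m + 1] (fun t => t * u t) x =
      x * (fwdDiff (1 : ℝ))^[m + 1] u x + (m + 1) * (fwdDiff (1 : ℝ))^[m] u (x + 1) := by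
  induction m generalizing x with
  | zero => simp [fwdDiff]; ring
  | succ m ih =>
    rw [Function.iterate_succ_apply', fwdDiff, ih, ih,
      Function.iterate_succ_apply' (fwdDiff (1 : ℝ)) (m + 1) u, fwdDiff,
      Function.iterate_succ_apply' (fwdDiff (1 : ℝ)) m u, fwdDiff]
    rw [fwdDiff]
    push_cast
    ring

/-- The truncated power `t ↦ t₊ⁿ`. -/
noncomputable def truncPow (n : ℕ) (t : ℝ) : ℝ := if 0 < t then t ^ n else 0

/-- The recurrence for B-splines, obtained from the Leibniz rule for `t * t₊ⁿ`. -/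
theorem fwdDiff_truncPow (n : ℕ) (x : ℝ) :
    (fwdDiff (1 : ℝ))^[n + 2] (truncPow (n + 1)) x =
      (x + n + 2) * (fwdDiff (1 : ℝ))^[n + 1] (truncPow n) (x + 1) -
        x * (fwdDiff (1 : ℝ))^[n + 1] (truncPow n) x := by
  have h : truncPow (n + 1) = fun t => t * truncPow n t := by
    funext t
    unfold truncPow
    split_ifs
    · ring
    · ring
  rw [h, fwdDiff_iter_id_mul, Function.iterate_succ_apply', fwdDiff]
  push_cast
  ring

/-- Up to normalisation these are the values of a B-spline at the integers, starting from the hat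
function. Inside the support both coefficients `x + n + 2` and `-x` of the recurrence are positive,
so positivity propagates. -/
theorem fwdDiff_truncPow_sign (n : ℕ) (x : ℤ) :
    ((0 ≤ x ∨ x ≤ -(n + 2)) → (fwdDiff (1 : ℝ))^[n + 2] (truncPow (n + 1)) (x : ℝ) = 0) ∧
      (x < 0 → -(n + 2) < x → 0 < (fwdDiff (1 : ℝ))^[n + 2] (truncPow (n + 1)) (x : ℝ)) := by
  induction n generalizing x with
  | zero =>
    have h : (fwdDiff (1 : ℝ))^[0 + 2] (truncPow (0 + 1)) (x : ℝ)
        = truncPow 1 ((x + 2 : ℤ) : ℝ) - 2 * truncPow 1 ((x + 1 : ℤ) : ℝ) + truncPow 1 (x : ℝ) := by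
      simp only [zero_add, Function.iterate_succ, Function.iterate_zero, Function.comp, id, fwdDiff]
      push_cast
      rw [add_assoc (x : ℝ) 1 1]
      norm_num
      ring
    have hpos : ∀ y : ℤ, 0 ≤ y → truncPow 1 (y : ℝ) = y := by
      intro y hy
      unfold truncPow
      split_ifs with h1
      · simp
      · have h2 : (0 : ℝ) ≤ y := by exact_mod_cast hy
        linarith
    have hneg : ∀ y : ℤ, y ≤ 0 → truncPow 1 (y : ℝ) = 0 := by
      intro y hy
      have h2 : (y : ℝ) ≤ 0 := by exact_mod_cast hy
      unfold truncPow
      rw [if_neg (not_lt.2 h2)]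
    rw [h]
    constructor
    · rintro (hx | hx)
      · rw [hpos _ hx, hpos _ (by omega), hpos _ (by omega)]
        push_cast
        ring
      · rw [hneg x (by omega), hneg (x + 1) (by omega), hneg (x + 2) (by omega)]
        ring
    · intro h1 h2
      obtain rfl : x = -1 := by omega
      rw [hneg (-1) (by omega), hneg (-1 + 1) (by omega), hpos (-1 + 2) (by omega)]
      norm_num
  | succ n ih =>
    rw [fwdDiff_truncPow]
    have h1 := ih x
    have h2 := ih (x + 1)
    push_cast at h2
    constructor
    · rintro (hx | hx)
      · rw [h1.1 (Or.inl hx), h2.1 (Or.inl (by omega))]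
        ring
      · push_cast at hx
        rw [h1.1 (Or.inr (by omega))]
        rcases eq_or_lt_of_le hx with h3 | h3
        · rw [h3]
          push_cast
          ring
        · rw [h2.1 (Or.inr (by omega))]
          ring
    · intro hx0 hxn
      push_cast at hxn
      have hx0' : (x : ℝ) < 0 := by exact_mod_cast hx0
      have hxn' : (-(n + 1 + 2) : ℝ) < x := by exact_mod_cast hxn
      have hnn : ∀ y : ℤ, 0 ≤ (fwdDiff (1 : ℝ))^[n + 2] (truncPow (n + 1)) (y : ℝ) := by
        intro y
        by_cases hy : 0 ≤ y ∨ y ≤ -(n + 2)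
        · exact ((ih y).1 hy).ge
        · push Not at hy
          exact ((ih y).2 hy.1 hy.2).le
      have hn2 := hnn (x + 1)
      push_cast at hn2
      have ha : 0 < (x : ℝ) + (n + 1 : ℕ) + 2 := by push_cast; linarith
      rcases eq_or_ne x (-1) with h3 | h3
      · have h4 := h1.2 hx0 (by omega)
        have := mul_nonneg ha.le hn2
        nlinarith
      · have h4 := h2.2 (by omega) (by omega)
        have := mul_pos ha h4
        have := hnn x
        nlinarith

/-- An odd power of `|t|` is `2 t₊ⁿ - tⁿ`, and the difference of order `2r` annihilates the
polynomial. -/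
theorem fwdDiff_abs_pow_pos {r : ℕ} (hr : 1 ≤ r) :
    0 < (fwdDiff (1 : ℝ))^[2 * r] (fun t => |t| ^ (2 * r - 1)) (-(r : ℝ)) := by
  obtain ⟨s, rfl⟩ : ∃ s, r = s + 1 := ⟨r - 1, by omega⟩
  have h1 : (fun t : ℝ => |t| ^ (2 * (s + 1) - 1))
      = (2 : ℝ) • truncPow (2 * s + 1) + (-1 : ℝ) • fun t : ℝ => t ^ (2 * s + 1) := by
    funext t
    have h2 : 2 * (s + 1) - 1 = 2 * s + 1 := by omega
    simp only [Pi.add_apply, Pi.smul_apply, smul_eq_mul, truncPow, h2]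
    split_ifs with h
    · rw [abs_of_pos h]; ring
    · rw [abs_of_nonpos (not_lt.1 h), Odd.neg_pow ⟨s, rfl⟩]; ring
  rw [h1, fwdDiff_iter_add, fwdDiff_iter_const_smul, fwdDiff_iter_const_smul,
    fwdDiff_iter_pow_eq_zero_of_lt (show 2 * s + 1 < 2 * (s + 1) by omega)]
  have h3 := (fwdDiff_truncPow_sign (2 * s) (-(s + 1 : ℤ))).2 (by omega) (by push_cast; omega)
  push_cast at h3
  simp only [smul_zero, add_zero, Pi.smul_apply, smul_eq_mul]
  push_cast
  have h4 : 2 * (s + 1) = 2 * s + 2 := by ring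
  rw [h4]
  positivity

theorem diffWeight_rev (n : ℕ) (k : Fin (n + 1)) :
    diffWeight n (Fin.rev k) = (-1) ^ n * diffWeight n k := by
  unfold diffWeight
  have hk : (k : ℕ) ≤ n := by omega
  have h1 : ((Fin.rev k : Fin (n + 1)) : ℕ) = n - k := by rw [Fin.val_rev]; omega
  rw [h1, Nat.choose_symm hk, Nat.sub_sub_self hk, ← mul_assoc, ← pow_add]
  congr 1
  have h2 : n + (n - k) = k + 2 * (n - k) := by omega
  rw [h2, pow_add, pow_mul]
  simp

/-- Differencing `|s - t| ^ (2r - 1)` `r` times in each variable yields a difference of order `2r`.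
The reflection in one variable costs the sign `(-1) ^ r`. -/
theorem distForm_diffWeight {d r : ℕ} (hr : 1 ≤ r) {e : EuclideanSpace ℝ (Fin d)} (he : ‖e‖ = 1) :
    0 < (-1) ^ r * distForm (2 * r - 1)
      (fun k : Fin (r + 1) => (0 : EuclideanSpace ℝ (Fin d)) + ((k : ℕ) : ℝ) • e)
      (diffWeight r) := by
  set g : ℝ → ℝ := fun t => |t| ^ (2 * r - 1) with hg
  have h1 : distForm (2 * r - 1)
      (fun k : Fin (r + 1) => (0 : EuclideanSpace ℝ (Fin d)) + ((k : ℕ) : ℝ) • e) (diffWeight r)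
      = ∑ j, diffWeight r j * (fwdDiff (1 : ℝ))^[r] g (-((j : ℕ) : ℝ)) := by
    unfold distForm
    rw [Finset.sum_comm]
    refine Finset.sum_congr rfl fun j _ => ?_
    rw [← sum_diffWeight_mul, Finset.mul_sum]
    refine Finset.sum_congr rfl fun i _ => ?_
    rw [add_sub_add_left_eq_sub, ← sub_smul, norm_smul, he, mul_one, Real.norm_eq_abs, hg]
    dsimp only
    rw [neg_add_eq_sub]
    ring
  have h2 : ∑ j, diffWeight r j * (fwdDiff (1 : ℝ))^[r] g (-((j : ℕ) : ℝ))
      = (-1) ^ r * (fwdDiff (1 : ℝ))^[2 * r] g (-(r : ℝ)) := by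
    rw [two_mul, Function.iterate_add_apply, ← sum_diffWeight_mul, Finset.mul_sum,
      ← Equiv.sum_comp Fin.revPerm]
    refine Finset.sum_congr rfl fun j _ => ?_
    rw [Fin.revPerm_apply, diffWeight_rev, mul_assoc]
    congr 3
    have hj : (j : ℕ) ≤ r := by omega
    have h1 : ((Fin.rev j : Fin (r + 1)) : ℕ) = r - j := by rw [Fin.val_rev]; omega
    rw [h1, Nat.cast_sub hj]
    ring_nf
  rw [h1, h2, ← mul_assoc, ← mul_pow]
  simpa using fwdDiff_abs_pow_pos hr

/-- The distance form has sign `(-1) ^ R` on one weight with vanishing moments below `R`, while its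
product with `ψ 0` is nonnegative on all such weights. -/
theorem KernelExpansion.sign {d R : ℕ} {f ψ : ℝ → ℝ} (h : KernelExpansion d f R ψ)
    (hpos : IsPosSemidefKernel (stationaryKernel d f)) (hd : 0 < d) (hψ : ψ 0 ≠ 0) :
    0 < (-1) ^ R * ψ 0 := by
  have he : ‖(EuclideanSpace.single (⟨0, hd⟩ : Fin d) (1 : ℝ))‖ = 1 := by simp
  have h1 := distForm_diffWeight h.pos he
  have h2 := h.distForm_nonneg hpos _ fun α hα =>
    moment_line (n := R) 0 (EuclideanSpace.single (⟨0, hd⟩ : Fin d) (1 : ℝ)) hα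
  have h3 : ((-1 : ℝ) ^ R) * (-1) ^ R = 1 := by rw [← mul_pow]; simp
  rcases neg_one_pow_eq_or ℝ R with h4 | h4
  · rw [h4] at h1 ⊢
    rw [one_mul] at h1 ⊢
    exact lt_of_le_of_ne (nonneg_of_mul_nonneg_left h2 h1) hψ.symm
  · rw [h4] at h1 ⊢
    rw [neg_one_mul] at h1 ⊢
    have h5 : 0 ≤ (-ψ 0) * -distForm (2 * R - 1)
      (fun k : Fin (R + 1) => (0 : EuclideanSpace ℝ (Fin d)) +
        ((k : ℕ) : ℝ) • EuclideanSpace.single (⟨0, hd⟩ : Fin d) (1 : ℝ)) (diffWeight R) := by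
      rwa [neg_mul_neg]
    exact lt_of_le_of_ne (nonneg_of_mul_nonneg_left h5 h1) (neg_ne_zero.2 hψ).symm

/-! ### Strict conditional definiteness of the distance form -/

/-- The part of Cauchy–Schwarz that is needed: in a nonnegative form, a null vector has zero pairing
with everything. -/
theorem eq_zero_of_forall_quadratic_nonneg {B C : ℝ} (h : ∀ t : ℝ, 0 ≤ 2 * t * B + t ^ 2 * C) :
    B = 0 := by
  have h1 : ∀ t : ℝ, 0 ≤ C * (t * t) + 2 * B * t + 0 := fun t => by
    have := h t
    nlinarith
  have h2 := discrim_le_zero h1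
  unfold discrim at h2
  nlinarith [sq_nonneg B]

/-- The Taylor terms of degree below `n` are annihilated, so the difference is `O(δ ^ n)`. The odd
multiples of `δ` match the grid of `sum_diffWeight_ne_zero`. -/
theorem tendsto_sum_diffWeight_analytic {n : ℕ} (hn : 1 ≤ n) {φ : ℝ → ℝ} (hφ : AnalyticAt ℝ φ 0) :
    Tendsto (fun δ : ℝ => (∑ k, diffWeight n k * φ (δ * (2 * ((k : ℕ) : ℝ) - 1))) / δ ^ (n - 1))
      (𝓝[>] 0) (𝓝 0) := by
  obtain ⟨ψ, hψ, -, hexp⟩ := hφ.exists_taylor n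
  have h1 : ∀ δ : ℝ, 0 < δ →
      (∑ k, diffWeight n k * φ (δ * (2 * ((k : ℕ) : ℝ) - 1))) / δ ^ (n - 1)
      = δ * ∑ k, diffWeight n k * ((2 * ((k : ℕ) : ℝ) - 1) ^ n *
        ψ (δ * (2 * ((k : ℕ) : ℝ) - 1))) := by
    intro δ hδ
    rw [div_eq_iff (by positivity)]
    have h2 : ∑ k, diffWeight n k * ∑ i ∈ Finset.range n, iteratedDeriv i φ 0 / i.factorial *
        (δ * (2 * ((k : ℕ) : ℝ) - 1)) ^ i = 0 := by
      simp only [Finset.mul_sum]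
      rw [Finset.sum_comm]
      refine Finset.sum_eq_zero fun i hi => ?_
      have h3 := sum_diffWeight_odd_pow (Finset.mem_range.1 hi)
      have h4 : ∑ k, diffWeight n k * (iteratedDeriv i φ 0 / i.factorial *
          (δ * (2 * ((k : ℕ) : ℝ) - 1)) ^ i) = iteratedDeriv i φ 0 / i.factorial * δ ^ i *
          ∑ k, diffWeight n k * (2 * ((k : ℕ) : ℝ) - 1) ^ i := by
        rw [Finset.mul_sum]
        exact Finset.sum_congr rfl fun k _ => by rw [mul_pow]; ring
      rw [h4, h3, mul_zero]
    have h5 : ∑ k, diffWeight n k * φ (δ * (2 * ((k : ℕ) : ℝ) - 1))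
        = ∑ k, diffWeight n k * ((δ * (2 * ((k : ℕ) : ℝ) - 1)) ^ n *
          ψ (δ * (2 * ((k : ℕ) : ℝ) - 1))) := by
      rw [← sub_eq_zero, ← h2, ← Finset.sum_sub_distrib]
      refine Finset.sum_congr rfl fun k _ => ?_
      rw [hexp (δ * (2 * ((k : ℕ) : ℝ) - 1))]
      ring
    rw [h5, Finset.mul_sum, Finset.sum_mul]
    refine Finset.sum_congr rfl fun k _ => ?_
    have h6 : δ ^ n = δ * δ ^ (n - 1) := by rw [← pow_succ']; congr 1; omega
    rw [mul_pow, h6]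
    ring
  have h7 : Tendsto (fun δ : ℝ => δ * ∑ k, diffWeight n k * ((2 * ((k : ℕ) : ℝ) - 1) ^ n *
        ψ (δ * (2 * ((k : ℕ) : ℝ) - 1)))) (𝓝[>] 0) (𝓝 (0 * ∑ k, diffWeight n k *
        ((2 * ((k : ℕ) : ℝ) - 1) ^ n * ψ 0))) := by
    refine (tendsto_id.mono_left nhdsWithin_le_nhds).mul
      (tendsto_finsetSum _ fun k _ => (Tendsto.const_mul _ (Tendsto.const_mul _ ?_)))
    refine hψ.continuousAt.tendsto.comp ?_
    have : Tendsto (fun δ : ℝ => δ * (2 * ((k : ℕ) : ℝ) - 1)) (𝓝 0)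
        (𝓝 (0 * (2 * ((k : ℕ) : ℝ) - 1))) := (continuous_id.mul continuous_const).tendsto 0
    rw [zero_mul] at this
    exact this.mono_left nhdsWithin_le_nhds
  rw [zero_mul] at h7
  refine h7.congr' ?_
  filter_upwards [self_mem_nhdsWithin] with δ hδ using (h1 δ hδ).symm

theorem analyticAt_norm_sub_smul_pow {d : ℕ} {v : EuclideanSpace ℝ (Fin d)} (hv : v ≠ 0)
    (e : EuclideanSpace ℝ (Fin d)) (p : ℕ) : AnalyticAt ℝ (fun t : ℝ => ‖v - t • e‖ ^ p) 0 := by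
  -- Here `⊤` is analytic regularity, beyond all finite and infinite orders of smoothness.
  have h1 : ContDiffAt ℝ ⊤ (fun t : ℝ => v - t • e) 0 := by fun_prop
  exact ((h1.norm ℝ (by simpa using hv)).analyticAt).pow p

theorem sub_add_smul_eq {E : Type*} [AddCommGroup E] [Module ℝ E] (a b e : E) (δ k : ℝ) :
    a - ((b - δ • e) + k • ((2 * δ) • e)) = (a - b) - (δ * (2 * k - 1)) • e := by
  module

/-- By the discriminant argument, `x ↦ ∑ c i * ‖y i - x‖ ^ (2R - 1)` has vanishing differences of
order `2R` on every line through `y i₀`. At scale `δ` the terms with `i ≠ i₀` are analytic and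
contribute `o(δ ^ (2R - 1))`, while `i₀` contributes exactly `S * c i₀ * δ ^ (2R - 1)` with `S ≠ 0`.
-/
theorem KernelExpansion.eq_zero_of_distForm_eq_zero {d R : ℕ} {f ψ : ℝ → ℝ}
    (h : KernelExpansion d f R ψ) (hpos : IsPosSemidefKernel (stationaryKernel d f)) (hd : 0 < d)
    (hψ : ψ 0 ≠ 0) {ι : Type*} [Fintype ι] {y : ι → EuclideanSpace ℝ (Fin d)}
    (hy : Function.Injective y) {c : ι → ℝ} (hc : ∀ α, ∑ j, α j < R → moment y c α = 0)
    (hQ : distForm (2 * R - 1) y c = 0) : c = 0 := by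
  classical
  have hR := h.pos
  funext i₀
  set e : EuclideanSpace ℝ (Fin d) := EuclideanSpace.single (⟨0, hd⟩ : Fin d) (1 : ℝ) with hedef
  have he : ‖e‖ = 1 := by simp [hedef]
  have hcross : ∀ δ : ℝ, 0 < δ → ∑ i, c i * ∑ k : Fin (2 * R + 1), diffWeight (2 * R) k *
      ‖(y i - y i₀) - (δ * (2 * ((k : ℕ) : ℝ) - 1)) • e‖ ^ (2 * R - 1) = 0 := by
    intro δ _
    set z : Fin (2 * R + 1) → EuclideanSpace ℝ (Fin d) :=
      fun k => (y i₀ - δ • e) + ((k : ℕ) : ℝ) • ((2 * δ) • e) with hz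
    have h1 : ψ 0 * ∑ i, ∑ k, c i * diffWeight (2 * R) k * ‖y i - z k‖ ^ (2 * R - 1) = 0 := by
      refine eq_zero_of_forall_quadratic_nonneg
        (C := ψ 0 * distForm (2 * R - 1) z (diffWeight (2 * R))) fun t => ?_
      have h2 := h.distForm_nonneg hpos (Sum.elim y z)
        (c := Sum.elim c fun k => t * diffWeight (2 * R) k) fun α hα => by
          rw [moment_sumElim, hc α hα, moment_const_mul, hz, moment_line _ _ (by omega)]
          simp
      rw [distForm_sumElim, hQ, distForm_const_mul] at h2
      have h3 : ∑ i, ∑ k, c i * (t * diffWeight (2 * R) k) * ‖y i - z k‖ ^ (2 * R - 1)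
          = t * ∑ i, ∑ k, c i * diffWeight (2 * R) k * ‖y i - z k‖ ^ (2 * R - 1) := by
        rw [Finset.mul_sum]
        refine Finset.sum_congr rfl fun i _ => ?_
        rw [Finset.mul_sum]
        exact Finset.sum_congr rfl fun k _ => by ring
      rw [h3] at h2
      linarith
    have h4 := (mul_eq_zero.1 h1).resolve_left hψ
    rw [← h4]
    refine Finset.sum_congr rfl fun i _ => ?_
    rw [Finset.mul_sum]
    refine Finset.sum_congr rfl fun k _ => ?_
    rw [hz, ← sub_add_smul_eq]
    ring
  set S : ℝ := ∑ k : Fin (2 * R + 1), diffWeight (2 * R) k * |2 * ((k : ℕ) : ℝ) - 1| ^ (2 * R - 1)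
    with hS
  have hS0 : S ≠ 0 := sum_diffWeight_ne_zero (n := 2 * R) (e := 2 * R - 1) (by omega)
    (g := fun t => |t| ^ (2 * R - 1)) (fun t ht => by simp only [abs_of_pos ht])
    (by
      have : Odd (2 * R - 1) := ⟨R - 1, by omega⟩
      rw [this.neg_one_pow]
      simp)
  have hlim : Tendsto (fun δ : ℝ => ∑ i, c i * ((∑ k : Fin (2 * R + 1), diffWeight (2 * R) k *
      ‖(y i - y i₀) - (δ * (2 * ((k : ℕ) : ℝ) - 1)) • e‖ ^ (2 * R - 1)) / δ ^ (2 * R - 1)))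
      (𝓝[>] 0) (𝓝 (∑ i, c i * if i = i₀ then S else 0)) := by
    refine tendsto_finsetSum _ fun i _ => Tendsto.const_mul _ ?_
    split_ifs with hi
    · refine tendsto_const_nhds.congr' ?_
      filter_upwards [self_mem_nhdsWithin] with δ hδ
      have hδ : 0 < δ := hδ
      rw [eq_div_iff (by positivity), hS, Finset.sum_mul, hi]
      refine Finset.sum_congr rfl fun k _ => ?_
      rw [sub_self, zero_sub, norm_neg, norm_smul, he, mul_one, Real.norm_eq_abs, abs_mul,
        abs_of_pos hδ]
      ring
    · have hv : y i - y i₀ ≠ 0 := sub_ne_zero.2 fun h => hi (hy h)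
      have h7 := tendsto_sum_diffWeight_analytic (n := 2 * R)
        (φ := fun t : ℝ => ‖(y i - y i₀) - t • e‖ ^ (2 * R - 1)) (by omega)
        (analyticAt_norm_sub_smul_pow hv e (2 * R - 1))
      exact h7
  have hzero : Tendsto (fun δ : ℝ => ∑ i, c i * ((∑ k : Fin (2 * R + 1), diffWeight (2 * R) k *
      ‖(y i - y i₀) - (δ * (2 * ((k : ℕ) : ℝ) - 1)) • e‖ ^ (2 * R - 1)) / δ ^ (2 * R - 1)))
      (𝓝[>] 0) (𝓝 0) := by
    refine tendsto_const_nhds.congr' ?_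
    filter_upwards [self_mem_nhdsWithin] with δ hδ
    simp only [← mul_div_assoc]
    rw [← Finset.sum_div, hcross δ hδ, zero_div]
  have h6 := tendsto_nhds_unique hlim hzero
  simp only [mul_ite, mul_zero, Finset.sum_ite_eq', Finset.mem_univ, if_true] at h6
  exact (mul_eq_zero.1 h6).resolve_right hS0

/-! ### Definiteness of the Wronskian form -/

/-- The derivative is the falling factorial of `a`, all of whose factors are positive. -/
theorem iteratedDeriv_one_add_rpow_pos {a : ℝ} {k : ℕ} (hk : (k : ℝ) - 1 < a) :
    0 < iteratedDeriv k (fun u : ℝ => (1 + u) ^ a) 0 := by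
  rw [iteratedDeriv_comp_const_add (f := fun u : ℝ => u ^ a)]
  simp only [iteratedDeriv_eq_iterate, add_zero]
  rw [Real.iter_deriv_rpow_const, Real.one_rpow, mul_one]
  exact descPochhammer_pos hk

theorem sum_homPoly_eq_zero {d p : ℕ} {ι : Type*} [Fintype ι] {y : ι → EuclideanSpace ℝ (Fin d)}
    {c : ι → ℝ} (hc : ∀ α, ∑ j, α j = p → moment y c α = 0) {F : EuclideanSpace ℝ (Fin d) → ℝ}
    (hF : F ∈ homPoly d p) : ∑ i, c i * F (y i) = 0 := by
  obtain ⟨q, hq⟩ := exists_eq_sum_of_mem_homPoly hF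
  simp only [hq, Finset.mul_sum]
  rw [Finset.sum_comm]
  refine Finset.sum_eq_zero fun γ hγ => ?_
  have h := hc γ (mem_multiIdxEq.1 hγ)
  unfold moment at h
  calc ∑ i, c i * (q γ * monomialFun γ (y i)) = q γ * ∑ i, c i * monomialFun γ (y i) := by
        rw [Finset.mul_sum]; exact Finset.sum_congr rfl fun i _ => by ring
    _ = 0 := by rw [h, mul_zero]

/-- The multinomial theorem exhibits powers of the inner product as a sum of squares over all
moments of order `p`, with positive coefficients. -/
theorem sum_inner_pow {d : ℕ} {ι : Type*} [Fintype ι] (y : ι → EuclideanSpace ℝ (Fin d))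
    (b : ι → ℝ) (p : ℕ) :
    ∑ i, ∑ j, b i * b j * inner ℝ (y i) (y j) ^ p =
      ∑ β ∈ Finset.piAntidiag Finset.univ p,
        (Nat.multinomial Finset.univ β : ℝ) * moment y b β ^ 2 := by
  have h : ∀ i j, inner ℝ (y i) (y j) ^ p = ∑ β ∈ Finset.piAntidiag Finset.univ p,
      (Nat.multinomial Finset.univ β : ℝ) * (monomialFun β (y i) * monomialFun β (y j)) := by
    intro i j
    rw [PiLp.inner_apply, Finset.sum_pow_eq_sum_piAntidiag]
    refine Finset.sum_congr rfl fun β _ => ?_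
    unfold monomialFun
    rw [← Finset.prod_mul_distrib]
    congr 1
    refine Finset.prod_congr rfl fun k _ => ?_
    rw [← mul_pow]
    congr 1
    simp [mul_comm]
  simp only [h, Finset.mul_sum]
  rw [Finset.sum_congr rfl fun i _ => Finset.sum_comm, Finset.sum_comm]
  refine Finset.sum_congr rfl fun β _ => ?_
  rw [moment, pow_two, Finset.sum_mul_sum, Finset.mul_sum]
  refine Finset.sum_congr rfl fun i _ => ?_
  rw [Finset.mul_sum]
  exact Finset.sum_congr rfl fun j _ => by ring

theorem sum_inner_pow_nonneg {d : ℕ} {ι : Type*} [Fintype ι] (y : ι → EuclideanSpace ℝ (Fin d))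
    (b : ι → ℝ) (p : ℕ) : 0 ≤ ∑ i, ∑ j, b i * b j * inner ℝ (y i) (y j) ^ p := by
  rw [sum_inner_pow]
  exact Finset.sum_nonneg fun β _ => by positivity

theorem moment_eq_zero_of_sum_inner_pow {d p : ℕ} {ι : Type*} [Fintype ι]
    {y : ι → EuclideanSpace ℝ (Fin d)} {b : ι → ℝ}
    (h : ∑ i, ∑ j, b i * b j * inner ℝ (y i) (y j) ^ p = 0) (β : Fin d → ℕ)
    (hβ : ∑ j, β j = p) : moment y b β = 0 := by
  rw [sum_inner_pow, Finset.sum_eq_zero_iff_of_nonneg fun β _ => by positivity] at h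
  have h1 := h β (by rw [Finset.mem_piAntidiag]; exact ⟨hβ, fun i _ => Finset.mem_univ i⟩)
  have h2 : (Nat.multinomial Finset.univ β : ℝ) ≠ 0 :=
    Nat.cast_ne_zero.2 (Nat.multinomial_pos _ _).ne'
  exact pow_eq_zero_iff (two_ne_zero) |>.1 ((mul_eq_zero.1 h1).resolve_left h2)

/-- The mixed sums of powers of norms and inner products in the expansion of a distance power. -/
noncomputable def crossSum {d : ℕ} {ι : Type*} [Fintype ι] (y : ι → EuclideanSpace ℝ (Fin d))
    (c : ι → ℝ) (k j : ℕ) (X : EuclideanSpace ℝ (Fin d)) : ℝ :=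
  ∑ i, c i * ((‖y i‖ ^ 2) ^ j * inner ℝ X (y i) ^ (k - j))

theorem crossSum_smul {d : ℕ} {ι : Type*} [Fintype ι] (y : ι → EuclideanSpace ℝ (Fin d))
    (c : ι → ℝ) (k j : ℕ) (r : ℝ) (X : EuclideanSpace ℝ (Fin d)) :
    crossSum y c k j (r • X) = r ^ (k - j) * crossSum y c k j X := by
  unfold crossSum
  rw [Finset.mul_sum]
  refine Finset.sum_congr rfl fun i _ => ?_
  rw [real_inner_smul_left, mul_pow]
  ring

theorem crossSum_eq_zero {d k j : ℕ} (hj : j ≤ k) {ι : Type*} [Fintype ι]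
    {y : ι → EuclideanSpace ℝ (Fin d)} {c : ι → ℝ}
    (hc : ∀ α, ∑ i, α i = k + j → moment y c α = 0) (X : EuclideanSpace ℝ (Fin d)) :
    crossSum y c k j X = 0 := by
  have h := mul_mem_homPoly (pow_mem_homPoly (normSq_mem_homPoly d) j)
    (pow_mem_homPoly (inner_mem_homPoly X) (k - j))
  rw [show j * 2 + (k - j) * 1 = k + j by omega] at h
  exact sum_homPoly_eq_zero hc h

/-- The coefficient of order `l` in the expansion of `∑ c i ‖δ y i - X‖ ^ (2 R - 1)`, `‖X‖ = 1`. -/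
noncomputable def crossForm {d : ℕ} {ι : Type*} [Fintype ι] (R l : ℕ)
    (y : ι → EuclideanSpace ℝ (Fin d)) (c : ι → ℝ) (X : EuclideanSpace ℝ (Fin d)) : ℝ :=
  ∑ k ∈ Finset.range (l + 1),
    iteratedDeriv k (fun u : ℝ => (1 + u) ^ ((R : ℝ) - 1 / 2)) 0 / k.factorial *
      ∑ j ∈ Finset.range (k + 1),
        if k + j = l then (k.choose j : ℝ) * (-2) ^ (k - j) * crossSum y c k j X else 0

theorem crossForm_neg {d R l : ℕ} {ι : Type*} [Fintype ι] (y : ι → EuclideanSpace ℝ (Fin d))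
    (c : ι → ℝ) (X : EuclideanSpace ℝ (Fin d)) :
    crossForm R l y c (-X) = (-1) ^ l * crossForm R l y c X := by
  unfold crossForm
  rw [Finset.mul_sum]
  refine Finset.sum_congr rfl fun k _ => ?_
  rw [mul_left_comm]
  congr 1
  rw [Finset.mul_sum]
  refine Finset.sum_congr rfl fun j hj => ?_
  have hj : j < k + 1 := Finset.mem_range.1 hj
  split_ifs with h
  · rw [← neg_one_smul ℝ X, crossSum_smul]
    have h1 : ((-1 : ℝ)) ^ l = (-1) ^ (k - j) := by
      rw [show l = (k - j) + 2 * j by omega, pow_add, pow_mul]; simp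
    rw [h1]
    ring
  · rw [mul_zero]

theorem norm_smul_sub_pow {E : Type*} [NormedAddCommGroup E] [InnerProductSpace ℝ E] {R : ℕ}
    (hR : 1 ≤ R) (y : E) {X : E} (hX : ‖X‖ = 1) (δ : ℝ) :
    ‖δ • y - X‖ ^ (2 * R - 1) =
      (1 + δ * (δ * ‖y‖ ^ 2 + -2 * inner ℝ X y)) ^ ((R : ℝ) - 1 / 2) := by
  have h1 : 1 + δ * (δ * ‖y‖ ^ 2 + -2 * inner ℝ X y) = ‖δ • y - X‖ ^ 2 := by
    rw [norm_sub_sq_real, hX, norm_smul, mul_pow, Real.norm_eq_abs, sq_abs, real_inner_smul_left,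
      real_inner_comm]
    ring
  rw [h1, ← Real.rpow_natCast_mul (norm_nonneg _), ← Real.rpow_natCast]
  congr 1
  rw [Nat.cast_sub (by omega)]
  push_cast
  ring

/-- The binomial term of index `j` is homogeneous of degree `k + j` in the points, and all moments
of degree other than `l` in the relevant range vanish. -/
theorem sum_pow_mul_eq {d k l : ℕ} {ι : Type*} [Fintype ι]
    {y : ι → EuclideanSpace ℝ (Fin d)} {c : ι → ℝ}
    (hc : ∀ α, ∑ i, α i ≤ 2 * k → ∑ i, α i ≠ l → moment y c α = 0)
    (X : EuclideanSpace ℝ (Fin d)) (δ : ℝ) :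
    ∑ i, c i * (δ * (δ * ‖y i‖ ^ 2 + -2 * inner ℝ X (y i))) ^ k =
      δ ^ l * ∑ j ∈ Finset.range (k + 1),
        if k + j = l then (k.choose j : ℝ) * (-2) ^ (k - j) * crossSum y c k j X else 0 := by
  have h1 : ∀ i, c i * (δ * (δ * ‖y i‖ ^ 2 + -2 * inner ℝ X (y i))) ^ k =
      ∑ j ∈ Finset.range (k + 1), δ ^ (k + j) * ((k.choose j : ℝ) * (-2) ^ (k - j)) *
        (c i * ((‖y i‖ ^ 2) ^ j * inner ℝ X (y i) ^ (k - j))) := by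
    intro i
    rw [mul_pow, add_pow, Finset.mul_sum, Finset.mul_sum]
    refine Finset.sum_congr rfl fun j _ => ?_
    rw [mul_pow, mul_pow, pow_add]
    ring
  rw [Finset.sum_congr rfl fun i _ => h1 i, Finset.sum_comm, Finset.mul_sum]
  refine Finset.sum_congr rfl fun j hj => ?_
  have hj : j < k + 1 := Finset.mem_range.1 hj
  rw [← Finset.mul_sum]
  change _ * crossSum y c k j X = _
  split_ifs with h
  · rw [h]; ring
  · rw [crossSum_eq_zero (by omega) (fun α hα => hc α (by omega) (by omega))]
    ring

theorem tendsto_sum_norm_pow {d R l : ℕ} (hR : 1 ≤ R) {ι : Type*} [Fintype ι]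
    {y : ι → EuclideanSpace ℝ (Fin d)} {c : ι → ℝ}
    (hc : ∀ α, ∑ i, α i ≤ 2 * l → ∑ i, α i ≠ l → moment y c α = 0)
    {X : EuclideanSpace ℝ (Fin d)} (hX : ‖X‖ = 1) :
    Tendsto (fun δ : ℝ => (∑ i, c i * ‖δ • y i - X‖ ^ (2 * R - 1)) / δ ^ l) (𝓝[>] 0)
      (𝓝 (crossForm R l y c X)) := by
  have han : AnalyticAt ℝ (fun u : ℝ => (1 + u) ^ ((R : ℝ) - 1 / 2)) 0 :=
    Real.one_add_rpow_hasFPowerSeriesAt_zero.analyticAt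
  obtain ⟨φ, hφ, -, hexp⟩ := han.exists_taylor (l + 1)
  set v : ℝ → ι → ℝ := fun δ i => δ * ‖y i‖ ^ 2 + -2 * inner ℝ X (y i) with hv
  have h1 : ∀ δ : ℝ, 0 < δ → (∑ i, c i * ‖δ • y i - X‖ ^ (2 * R - 1)) / δ ^ l =
      crossForm R l y c X + δ * ∑ i, c i * (v δ i ^ (l + 1) * φ (δ * v δ i)) := by
    intro δ hδ
    rw [div_eq_iff (by positivity)]
    have h2 : ∀ i, c i * ‖δ • y i - X‖ ^ (2 * R - 1) = (∑ k ∈ Finset.range (l + 1),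
        iteratedDeriv k (fun u : ℝ => (1 + u) ^ ((R : ℝ) - 1 / 2)) 0 / k.factorial *
          (c i * (δ * v δ i) ^ k)) + c i * ((δ * v δ i) ^ (l + 1) * φ (δ * v δ i)) := by
      intro i
      rw [norm_smul_sub_pow hR (y i) hX, hexp, mul_add, Finset.mul_sum]
      congr 1
      exact Finset.sum_congr rfl fun k _ => by ring
    rw [Finset.sum_congr rfl fun i _ => h2 i, Finset.sum_add_distrib, Finset.sum_comm, add_mul]
    congr 1
    · unfold crossForm
      rw [Finset.sum_mul]
      refine Finset.sum_congr rfl fun k hk => ?_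
      have hk : k < l + 1 := Finset.mem_range.1 hk
      rw [← Finset.mul_sum, hv, sum_pow_mul_eq (l := l) (fun α hα => hc α (by omega))]
      ring
    · rw [Finset.mul_sum, Finset.sum_mul]
      refine Finset.sum_congr rfl fun i _ => ?_
      rw [mul_pow, pow_succ δ l]
      ring
  have h3 : Tendsto (fun δ : ℝ => crossForm R l y c X +
      δ * ∑ i, c i * (v δ i ^ (l + 1) * φ (δ * v δ i))) (𝓝[>] 0)
      (𝓝 (crossForm R l y c X + 0 * ∑ i, c i * (v 0 i ^ (l + 1) * φ 0))) := by
    have hvc : ∀ i, Tendsto (fun δ => v δ i) (𝓝[>] 0) (𝓝 (v 0 i)) := fun i =>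
      ((show Continuous fun δ => v δ i by rw [hv]; fun_prop).tendsto 0).mono_left
        nhdsWithin_le_nhds
    have hid : Tendsto (fun δ : ℝ => δ) (𝓝[>] 0) (𝓝 0) := tendsto_id.mono_left nhdsWithin_le_nhds
    refine tendsto_const_nhds.add (hid.mul (tendsto_finsetSum _ fun i _ =>
      Tendsto.const_mul _ (((hvc i).pow _).mul ?_)))
    refine hφ.continuousAt.tendsto.comp ?_
    simpa using hid.mul (hvc i)
  rw [zero_mul, add_zero] at h3
  refine h3.congr' ?_
  filter_upwards [self_mem_nhdsWithin] with δ hδ using (h1 δ hδ).symm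

/-- Homogeneity in `s` gives the power `2R - 1 - l`, and parity of `crossForm` gives the sign for
negative `s`. -/
theorem tendsto_sum_norm_pow_smul {d R l : ℕ} (hl : l < R) {ι : Type*} [Fintype ι]
    {y : ι → EuclideanSpace ℝ (Fin d)} {c : ι → ℝ}
    (hc : ∀ α, ∑ i, α i ≤ 2 * l → ∑ i, α i ≠ l → moment y c α = 0)
    {θ : EuclideanSpace ℝ (Fin d)} (hθ : ‖θ‖ = 1) {s : ℝ} (hs : s ≠ 0) :
    Tendsto (fun δ : ℝ => (∑ i, c i * ‖δ • y i - s • θ‖ ^ (2 * R - 1)) / δ ^ l) (𝓝[>] 0)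
      (𝓝 (|s| ^ (2 * R - 1 - l) * (if 0 < s then 1 else (-1) ^ l) * crossForm R l y c θ)) := by
  have hs' : 0 < |s| := abs_pos.2 hs
  obtain ⟨X, hX, hXs, hF⟩ : ∃ X : EuclideanSpace ℝ (Fin d), ‖X‖ = 1 ∧ s • θ = |s| • X ∧
      crossForm R l y c X = (if 0 < s then 1 else (-1) ^ l) * crossForm R l y c θ := by
    split_ifs with h
    · exact ⟨θ, hθ, by rw [abs_of_pos h], by rw [one_mul]⟩
    · exact ⟨-θ, by rw [norm_neg, hθ], by rw [abs_of_nonpos (not_lt.1 h), neg_smul_neg],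
        crossForm_neg y c θ⟩
  have h1 := tendsto_sum_norm_pow (by omega : 1 ≤ R) hc hX
  have h2 : Tendsto (fun δ : ℝ => δ / |s|) (𝓝[>] 0) (𝓝[>] 0) := by
    refine tendsto_nhdsWithin_of_tendsto_nhds_of_eventually_within _ ?_ ?_
    · have : Tendsto (fun δ : ℝ => δ / |s|) (𝓝 0) (𝓝 (0 / |s|)) :=
        (continuous_id.div_const _).tendsto 0
      rw [zero_div] at this
      exact this.mono_left nhdsWithin_le_nhds
    · filter_upwards [self_mem_nhdsWithin] with δ hδ using div_pos hδ hs'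
  have h3 := (h1.comp h2).const_mul (|s| ^ (2 * R - 1 - l))
  rw [hF, ← mul_assoc] at h3
  refine h3.congr' ?_
  filter_upwards [self_mem_nhdsWithin] with δ hδ
  have hδ : 0 < δ := hδ
  simp only [Function.comp]
  have h4 : ∀ i, ‖δ • y i - s • θ‖ = |s| * ‖(δ / |s|) • y i - X‖ := by
    intro i
    rw [hXs, ← abs_abs s, ← Real.norm_eq_abs |s|, ← norm_smul, smul_sub, smul_smul, Real.norm_eq_abs,
      abs_abs, mul_div_cancel₀ _ hs'.ne']
  simp only [h4]
  have h5 : |s| ^ (2 * R - 1) = |s| ^ (2 * R - 1 - l) * |s| ^ l := by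
    rw [← pow_add]; congr 1; omega
  rw [← mul_div_assoc, div_pow, div_div_eq_mul_div, Finset.mul_sum, Finset.sum_mul]
  congr 1
  refine Finset.sum_congr rfl fun i _ => ?_
  rw [mul_pow, h5]
  ring

/-- Place `c` at the points `δ y_i` with weights divided by `δ ^ l`, so that the moments of degree
`l` are unchanged, and add `t` times a difference of order `2R` along `θ`. The self-energy of the
first part is of order `δ ^ (2R - 1 - 2l)` and disappears because `l < R`; what remains is a
quadratic in `t` without constant term, so its linear coefficient vanishes. -/
theorem KernelExpansion.crossForm_eq_zero {d R l : ℕ} {f ψ : ℝ → ℝ} (h : KernelExpansion d f R ψ)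
    (hpos : IsPosSemidefKernel (stationaryKernel d f)) (hψ : ψ 0 ≠ 0)
    {a : (Fin d → ℕ) → ℝ} (ha : ∑ α ∈ multiIdxLT d R, ∑ β ∈ multiIdxLT d R,
      wronskianEntry (stationaryKernel d f) α β * a α * a β = 0)
    (hl : l < R) (hal : ∀ α, l < ∑ j, α j → a α = 0) {ι : Type*} [Fintype ι]
    {y : ι → EuclideanSpace ℝ (Fin d)} {c : ι → ℝ}
    (hc : ∀ α, ∑ j, α j < 2 * R - 1 → moment y c α = if ∑ j, α j = l then a α else 0)
    {θ : EuclideanSpace ℝ (Fin d)} (hθ : ‖θ‖ = 1) : crossForm R l y c θ = 0 := by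
  set g : ℝ → ℝ := fun s => |s| ^ (2 * R - 1 - l) * (if 0 < s then 1 else (-1) ^ l) with hg
  -- The odd grid avoids the origin, around which the first configuration concentrates.
  set z : Fin (2 * R + 1) → EuclideanSpace ℝ (Fin d) :=
    fun k => (-1 : ℝ) • θ + ((k : ℕ) : ℝ) • ((2 : ℝ) • θ) with hz
  have hzk : ∀ k, z k = (2 * ((k : ℕ) : ℝ) - 1) • θ := fun k => by rw [hz]; module
  set G : ℝ → Fin (2 * R + 1) → ℝ := fun δ k =>
    (∑ i, c i * ‖δ • y i - (2 * ((k : ℕ) : ℝ) - 1) • θ‖ ^ (2 * R - 1)) / δ ^ l with hG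
  have hGlim : ∀ k, Tendsto (fun δ => G δ k) (𝓝[>] 0)
      (𝓝 (g (2 * ((k : ℕ) : ℝ) - 1) * crossForm R l y c θ)) := by
    intro k
    refine tendsto_sum_norm_pow_smul hl (fun α h1 h2 => ?_) hθ ?_
    · rw [hc α (by omega), if_neg h2]
    · intro h1
      have h2 : ((2 * (k : ℕ) : ℕ) : ℝ) = (1 : ℕ) := by push_cast; linarith
      have := Nat.cast_injective h2
      omega
  set C : ℝ := ψ 0 * distForm (2 * R - 1) z (diffWeight (2 * R)) with hC
  have hineq : ∀ t δ : ℝ, 0 < δ → 0 ≤ δ ^ (2 * R - 1 - 2 * l) * (ψ 0 * distForm (2 * R - 1) y c) +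
      2 * t * (ψ 0 * ∑ k, diffWeight (2 * R) k * G δ k) + t ^ 2 * C := by
    intro t δ hδ
    have h2 := h.distForm_nonneg_of_wronskian_eq_zero hpos ha hl hal
      (Sum.elim (fun i => δ • y i) z)
      (Sum.elim (fun i => (δ ^ l)⁻¹ * c i) fun k => t * diffWeight (2 * R) k) fun α hα => by
        rw [moment_sumElim, moment_const_mul, moment_const_mul, hz, moment_line _ _ (by omega),
          moment_smul_points, hc α hα]
        split_ifs with h3
        · rw [h3, mul_zero, add_zero, ← mul_assoc, inv_mul_cancel₀ (by positivity), one_mul]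
        · simp
    rw [distForm_sumElim, distForm_const_mul, distForm_const_mul,
      distForm_smul_points _ _ hδ.le] at h2
    have h3 : ∑ i, ∑ k, (δ ^ l)⁻¹ * c i * (t * diffWeight (2 * R) k) *
        ‖δ • y i - z k‖ ^ (2 * R - 1) = t * ∑ k, diffWeight (2 * R) k * G δ k := by
      rw [Finset.sum_comm, Finset.mul_sum]
      refine Finset.sum_congr rfl fun k _ => ?_
      simp only [hG]
      rw [div_eq_inv_mul, Finset.mul_sum, Finset.mul_sum, Finset.mul_sum]
      refine Finset.sum_congr rfl fun i _ => ?_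
      rw [hzk]
      ring
    have h4 : ((δ ^ l)⁻¹) ^ 2 * (δ ^ (2 * R - 1) * distForm (2 * R - 1) y c)
        = δ ^ (2 * R - 1 - 2 * l) * distForm (2 * R - 1) y c := by
      have h5 : δ ^ (2 * R - 1) = δ ^ (2 * R - 1 - 2 * l) * (δ ^ l) ^ 2 := by
        rw [← pow_mul, ← pow_add]; congr 1; omega
      rw [h5]
      field_simp
    rw [h3, h4] at h2
    rw [hC]
    linarith
  have hlim : ∀ t : ℝ, 0 ≤ 2 * t * (ψ 0 * ∑ k, diffWeight (2 * R) k *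
      (g (2 * ((k : ℕ) : ℝ) - 1) * crossForm R l y c θ)) + t ^ 2 * C := by
    intro t
    have hp : Tendsto (fun δ : ℝ => δ ^ (2 * R - 1 - 2 * l)) (𝓝[>] 0) (𝓝 0) := by
      have h1 : Tendsto (fun δ : ℝ => δ ^ (2 * R - 1 - 2 * l)) (𝓝 0)
          (𝓝 (0 ^ (2 * R - 1 - 2 * l))) := (continuous_pow _).tendsto 0
      rw [zero_pow (by omega)] at h1
      exact h1.mono_left nhdsWithin_le_nhds
    have h1 := (((hp.mul_const (ψ 0 * distForm (2 * R - 1) y c)).add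
      (((tendsto_finsetSum Finset.univ fun k _ => (hGlim k).const_mul
        (diffWeight (2 * R) k)).const_mul (ψ 0)).const_mul (2 * t))).add_const (t ^ 2 * C))
    rw [zero_mul, zero_add] at h1
    refine ge_of_tendsto h1 ?_
    filter_upwards [self_mem_nhdsWithin] with δ hδ using hineq t δ hδ
  have h1 := (mul_eq_zero.1 (eq_zero_of_forall_quadratic_nonneg hlim)).resolve_left hψ
  simp only [← mul_assoc] at h1
  rw [← Finset.sum_mul] at h1
  refine (mul_eq_zero.1 h1).resolve_left ?_
  -- Since `2R - 1` is odd, the value of `g` at `-1`, namely `(-1) ^ l`, is opposite to `(-1) ^ (2R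
  -- - 1 - l)`, so the line factor is nonzero.
  refine sum_diffWeight_ne_zero (e := 2 * R - 1 - l) (by omega) (fun t ht => ?_) ?_
  · simp [hg, ht, abs_of_pos ht]
  · have h2 : (2 * R - 1 - l) + l = 2 * (R - 1) + 1 := by omega
    have h3 : (-1 : ℝ) ^ (2 * R - 1 - l) * (-1) ^ l = -1 := by
      rw [← pow_add, h2, pow_succ, pow_mul]; simp
    have h4 : ((-1 : ℝ) ^ l) * (-1) ^ l = 1 := by rw [← mul_pow]; simp
    have h5 : (-1 : ℝ) ^ (2 * R - 1 - l) = -(-1) ^ l := by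
      linear_combination (-1 : ℝ) ^ l * h3 - (-1 : ℝ) ^ (2 * R - 1 - l) * h4
    rw [h5]
    simp only [hg]
    norm_num

theorem exists_norm_eq_one_smul {d : ℕ} (hd : 0 < d) (X : EuclideanSpace ℝ (Fin d)) :
    ∃ θ : EuclideanSpace ℝ (Fin d), ‖θ‖ = 1 ∧ X = ‖X‖ • θ := by
  by_cases hX : X = 0
  · exact ⟨EuclideanSpace.single ⟨0, hd⟩ 1, by simp, by simp [hX]⟩
  · have h : ‖X‖ ≠ 0 := norm_ne_zero_iff.2 hX
    exact ⟨‖X‖⁻¹ • X, by rw [norm_smul, norm_inv, norm_norm, inv_mul_cancel₀ h],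
      by rw [smul_smul, mul_inv_cancel₀ h, one_smul]⟩

/-- The cross form is homogenised off the sphere, evaluated at the points `y i'`, and summed against
`(-1) ^ l * c i'`. All terms become nonnegative: the Taylor coefficients of `(1 + u) ^ (R - 1/2)` up
to order `l < R` are positive, and `k - j` has the parity of `l`. Each therefore vanishes, and the
term `k = l`, `j = 0` is a sum of squares of the moments of order `l`. -/
theorem moment_eq_zero_of_crossForm_eq_zero {d R l : ℕ} (hd : 0 < d) (hl : l < R) {ι : Type*}
    [Fintype ι] {y : ι → EuclideanSpace ℝ (Fin d)} {c : ι → ℝ}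
    (h : ∀ θ, ‖θ‖ = 1 → crossForm R l y c θ = 0) (β : Fin d → ℕ) (hβ : ∑ j, β j = l) :
    moment y c β = 0 := by
  set C : ℕ → ℝ := fun k =>
    iteratedDeriv k (fun u : ℝ => (1 + u) ^ ((R : ℝ) - 1 / 2)) 0 / k.factorial with hC
  have hCpos : ∀ k ∈ Finset.range (l + 1), 0 < C k := by
    intro k hk
    have hk : k < l + 1 := Finset.mem_range.1 hk
    refine div_pos (iteratedDeriv_one_add_rpow_pos ?_) (by positivity)
    have : (k : ℝ) + 1 ≤ R := by exact_mod_cast (by omega : k + 1 ≤ R)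
    linarith
  set S : ℕ → ℕ → ℝ := fun k j => ∑ i', ∑ i, (c i' * (‖y i'‖ ^ 2) ^ j) * (c i * (‖y i‖ ^ 2) ^ j) *
    inner ℝ (y i') (y i) ^ (k - j) with hS
  have h1 : ∀ X : EuclideanSpace ℝ (Fin d), ∑ k ∈ Finset.range (l + 1), C k *
      ∑ j ∈ Finset.range (k + 1), (if k + j = l then (k.choose j : ℝ) * (-2) ^ (k - j) *
        ((‖X‖ ^ 2) ^ j * crossSum y c k j X) else 0) = 0 := by
    intro X
    obtain ⟨θ, hθ, hX⟩ := exists_norm_eq_one_smul hd X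
    have h2 : ‖X‖ ^ l * crossForm R l y c θ = 0 := by rw [h θ hθ, mul_zero]
    refine Eq.trans ?_ h2
    rw [crossForm, Finset.mul_sum]
    -- Multiplication by `‖X‖ ^ l` distributes as `‖X‖ ^ (2j)` and `‖X‖ ^ (k - j)`, because `k + j =
    -- l`.
    refine Finset.sum_congr rfl fun k _ => ?_
    rw [mul_left_comm]
    congr 1
    rw [Finset.mul_sum]
    refine Finset.sum_congr rfl fun j hj => ?_
    have hj : j < k + 1 := Finset.mem_range.1 hj
    split_ifs with h3
    · have h4 : crossSum y c k j X = ‖X‖ ^ (k - j) * crossSum y c k j θ := by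
        conv_lhs => rw [hX]
        rw [crossSum_smul]
      have h5 : ‖X‖ ^ l = (‖X‖ ^ 2) ^ j * ‖X‖ ^ (k - j) := by
        rw [← pow_mul, ← pow_add]; congr 1; omega
      rw [h4, h5]
      ring
    · rw [mul_zero]
  have h2 : ∑ k ∈ Finset.range (l + 1), C k * ∑ j ∈ Finset.range (k + 1),
      (if k + j = l then (k.choose j : ℝ) * 2 ^ (k - j) * S k j else 0) = 0 := by
    have h3 : ∑ i', (-1) ^ l * c i' * ∑ k ∈ Finset.range (l + 1), C k *
      ∑ j ∈ Finset.range (k + 1), (if k + j = l then (k.choose j : ℝ) * (-2) ^ (k - j) *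
        ((‖y i'‖ ^ 2) ^ j * crossSum y c k j (y i')) else 0) = 0 :=
      Finset.sum_eq_zero fun i' _ => by rw [h1, mul_zero]
    refine Eq.trans ?_ h3
    simp only [Finset.mul_sum]
    rw [Finset.sum_comm]
    refine Finset.sum_congr rfl fun k _ => ?_
    rw [Finset.sum_comm]
    refine Finset.sum_congr rfl fun j hj => ?_
    have hj : j < k + 1 := Finset.mem_range.1 hj
    split_ifs with h4
    · have h5 : (2 : ℝ) ^ (k - j) = (-1) ^ l * (-2) ^ (k - j) := by
        rw [show l = (k - j) + 2 * j by omega, pow_add, pow_mul, neg_one_sq, one_pow, mul_one,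
          ← mul_pow]
        norm_num
      rw [h5, hS, Finset.mul_sum, Finset.mul_sum]
      refine Finset.sum_congr rfl fun i' _ => ?_
      unfold crossSum
      simp only [Finset.mul_sum]
      exact Finset.sum_congr rfl fun i _ => by ring
    · simp
  have hnn : ∀ k j, 0 ≤ (if k + j = l then (k.choose j : ℝ) * 2 ^ (k - j) * S k j else 0) := by
    intro k j
    split_ifs
    · have := sum_inner_pow_nonneg y (fun i => c i * (‖y i‖ ^ 2) ^ j) (k - j)
      positivity
    · exact le_rfl
  rw [Finset.sum_eq_zero_iff_of_nonneg fun k hk =>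
    mul_nonneg (hCpos k hk).le (Finset.sum_nonneg fun j _ => hnn k j)] at h2
  have hlmem : l ∈ Finset.range (l + 1) := Finset.self_mem_range_succ l
  have h3 := (mul_eq_zero.1 (h2 l hlmem)).resolve_left (hCpos l hlmem).ne'
  rw [Finset.sum_eq_zero_iff_of_nonneg fun j _ => hnn l j] at h3
  have h4 := h3 0 (by simp)
  rw [if_pos (add_zero l), Nat.choose_zero_right, Nat.cast_one, one_mul, Nat.sub_zero] at h4
  have h5 := (mul_eq_zero.1 h4).resolve_left (by positivity)
  simp only [hS, pow_zero, mul_one, Nat.sub_zero] at h5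
  exact moment_eq_zero_of_sum_inner_pow h5 β hβ

/-- Take a multi-index of maximal degree in the support of a null vector. Weights with exactly those
top-degree moments exist, and the vanishing of the cross form makes these moments zero. -/
theorem KernelExpansion.eq_zero_of_wronskian_eq_zero {d R : ℕ} {f ψ : ℝ → ℝ}
    (h : KernelExpansion d f R ψ) (hpos : IsPosSemidefKernel (stationaryKernel d f)) (hd : 0 < d)
    (hψ : ψ 0 ≠ 0) {a : (Fin d → ℕ) → ℝ} (ha : ∑ α ∈ multiIdxLT d R, ∑ β ∈ multiIdxLT d R,
      wronskianEntry (stationaryKernel d f) α β * a α * a β = 0) (α : Fin d → ℕ)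
    (hα : ∑ j, α j < R) : a α = 0 := by
  classical
  by_contra hne
  obtain ⟨α₀, hα₀, hmax⟩ := ((multiIdxLT d R).filter fun β => a β ≠ 0).exists_max_image
    (fun β => ∑ j, β j) ⟨α, Finset.mem_filter.2 ⟨mem_multiIdxLT.2 hα, hne⟩⟩
  rw [Finset.mem_filter, mem_multiIdxLT] at hα₀
  set l := ∑ j, α₀ j with hl
  -- The form only sees `a` in degrees below `R`; values outside are discarded so that `l` bounds
  -- the whole support.
  set a' : (Fin d → ℕ) → ℝ := fun β => if ∑ j, β j < R then a β else 0 with ha'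
  have ha2 : ∑ α ∈ multiIdxLT d R, ∑ β ∈ multiIdxLT d R,
      wronskianEntry (stationaryKernel d f) α β * a' α * a' β = 0 := by
    rw [← ha]
    refine Finset.sum_congr rfl fun α hα => Finset.sum_congr rfl fun β hβ => ?_
    rw [mem_multiIdxLT] at hα hβ
    simp [ha', hα, hβ]
  have hal : ∀ β, l < ∑ j, β j → a' β = 0 := by
    intro β hβ
    by_contra h1
    simp only [ha', ite_eq_right_iff, Classical.not_imp] at h1
    have := hmax β (Finset.mem_filter.2 ⟨mem_multiIdxLT.2 h1.1, h1.2⟩)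
    omega
  obtain ⟨y, u, hu⟩ := exists_dual_weights d (2 * R - 1)
  have hc : ∀ β, ∑ j, β j < 2 * R - 1 →
      moment y (fun i => ∑ α ∈ multiIdxEq d l, a' α * u α i) β =
        if ∑ j, β j = l then a' β else 0 := by
    intro β hβ
    rw [moment_sum_dual hu (fun α hα => by rw [mem_multiIdxEq] at hα; omega) _ β (by omega)]
    simp only [mem_multiIdxEq]
  have h1 := moment_eq_zero_of_crossForm_eq_zero hd hα₀.1
    (fun θ hθ => h.crossForm_eq_zero hpos hψ ha2 hα₀.1 hal hc hθ) α₀ hl.symm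
  rw [hc α₀ (by omega), if_pos hl.symm, show a' α₀ = a α₀ from if_pos hα₀.1] at h1
  exact hα₀.2 h1

/-! ### Positivity of the matrices -/

/-- A finite infimum of natural numbers is attained; otherwise `r + 1` would be a lower bound. -/
theorem iteratedDeriv_ne_zero_of_smoothnessOrder_eq {f : ℝ → ℝ} {r : ℕ}
    (h : smoothnessOrder f = r) : 1 ≤ r ∧ iteratedDeriv (2 * r - 1) f 0 ≠ 0 := by
  by_contra hne
  have h1 : ((r + 1 : ℕ) : ℕ∞) ≤ smoothnessOrder f := by
    refine le_iInf₂ fun s hs => ?_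
    have h2 : smoothnessOrder f ≤ s := iInf₂_le s hs
    rw [h] at h2
    have h3 : r ≤ s := by exact_mod_cast h2
    rcases h3.eq_or_lt with rfl | h4
    · exact absurd hs hne
    · exact_mod_cast h4
  rw [h] at h1
  have : r + 1 ≤ r := by exact_mod_cast h1
  omega

theorem one_le_smoothnessOrder (f : ℝ → ℝ) : 1 ≤ smoothnessOrder f :=
  le_iInf₂ fun s hs => by exact_mod_cast hs.1

theorem dotProduct_wronskianLT {d k : ℕ}
    (κ : EuclideanSpace ℝ (Fin d) → EuclideanSpace ℝ (Fin d) → ℝ) (a : (Fin d → ℕ) → ℝ) :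
    (fun α : multiIdxLT d k => a α) ⬝ᵥ (wronskianLT κ k *ᵥ fun α => a α) =
      ∑ α ∈ multiIdxLT d k, ∑ β ∈ multiIdxLT d k, wronskianEntry κ α β * a α * a β := by
  rw [← Finset.sum_coe_sort (multiIdxLT d k)]
  refine Finset.sum_congr rfl fun α _ => ?_
  rw [← Finset.sum_coe_sort (multiIdxLT d k), Matrix.mulVec, dotProduct, Finset.mul_sum]
  refine Finset.sum_congr rfl fun β _ => ?_
  change a α * (wronskianEntry κ α β * a β) = _
  ring

theorem exists_extension {d : ℕ} (S : Finset (Fin d → ℕ)) (v : S → ℝ) :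
    ∃ a : (Fin d → ℕ) → ℝ, (∀ α ∉ S, a α = 0) ∧ v = fun α : S => a α := by
  classical
  refine ⟨fun α => if h : α ∈ S then v ⟨α, h⟩ else 0, fun α hα => dif_neg hα, ?_⟩
  funext α
  simp

theorem KernelExpansion.wronskianLT_isHermitian {d R : ℕ} {f ψ : ℝ → ℝ}
    (h : KernelExpansion d f R ψ) : (wronskianLT (stationaryKernel d f) R).IsHermitian := by
  ext α β
  have h1 := mem_multiIdxLT.1 α.2
  have h2 := mem_multiIdxLT.1 β.2
  exact h.symm β α (by omega)

theorem KernelExpansion.wronskianLT_posSemidef {d R : ℕ} {f ψ : ℝ → ℝ}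
    (h : KernelExpansion d f R ψ) (hpos : IsPosSemidefKernel (stationaryKernel d f)) :
    (wronskianLT (stationaryKernel d f) R).PosSemidef := by
  refine .of_dotProduct_mulVec_nonneg h.wronskianLT_isHermitian fun v => ?_
  obtain ⟨a, -, rfl⟩ := exists_extension _ v
  rw [star_trivial, dotProduct_wronskianLT]
  exact h.wronskian_nonneg hpos a

theorem KernelExpansion.wronskianLT_posDef {d R : ℕ} {f ψ : ℝ → ℝ}
    (h : KernelExpansion d f R ψ) (hpos : IsPosSemidefKernel (stationaryKernel d f)) (hd : 0 < d)
    (hψ : ψ 0 ≠ 0) : (wronskianLT (stationaryKernel d f) R).PosDef := by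
  refine .of_dotProduct_mulVec_pos h.wronskianLT_isHermitian fun v hv => ?_
  obtain ⟨a, -, rfl⟩ := exists_extension _ v
  rw [star_trivial, dotProduct_wronskianLT]
  refine lt_of_le_of_ne (h.wronskian_nonneg hpos a) fun h0 => hv ?_
  funext α
  exact h.eq_zero_of_wronskian_eq_zero hpos hd hψ h0.symm α (mem_multiIdxLT.1 α.2)

theorem wronskianLT_posDef_of_le {d j k : ℕ} (hjk : j ≤ k)
    {κ : EuclideanSpace ℝ (Fin d) → EuclideanSpace ℝ (Fin d) → ℝ}
    (h : (wronskianLT κ k).PosDef) : (wronskianLT κ j).PosDef :=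
  h.submatrix (e := fun α : multiIdxLT d j =>
      (⟨α, mem_multiIdxLT.2 ((mem_multiIdxLT.1 α.2).trans_le hjk)⟩ : multiIdxLT d k))
    fun _ _ hαβ => Subtype.ext (congrArg (fun γ : multiIdxLT d k => (γ : Fin d → ℕ)) hαβ)

/-- For finite order, definiteness holds at level `r` without assumption and passes to principal
submatrices. For infinite order there is no odd term to exploit, so only semidefiniteness is
available and invertibility is assumed. -/
theorem wronskianLT_posDef {d R : ℕ} (hd : 0 < d) {f : ℝ → ℝ} (hf : AnalyticAt ℝ f 0)
    (hpos : IsPosSemidefKernel (stationaryKernel d f)) (hR1 : 1 ≤ R)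
    (hR : (R : ℕ∞) ≤ smoothnessOrder f)
    (hdet : smoothnessOrder f = ⊤ → (wronskianLT (stationaryKernel d f) R).det ≠ 0) :
    (wronskianLT (stationaryKernel d f) R).PosDef := by
  by_cases hr : smoothnessOrder f = ⊤
  · obtain ⟨ψ, h⟩ := exists_kernelExpansion (d := d) hf hR1 hR
    rw [(h.wronskianLT_posSemidef hpos).posDef_iff_isUnit, Matrix.isUnit_iff_isUnit_det]
    exact (hdet hr).isUnit
  · obtain ⟨r, hr⟩ := ENat.ne_top_iff_exists.1 hr
    obtain ⟨hr1, hr0⟩ := iteratedDeriv_ne_zero_of_smoothnessOrder_eq hr.symm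
    obtain ⟨ψ, h⟩ := exists_kernelExpansion (d := d) hf hr1 hr.le
    rw [← hr] at hR
    refine wronskianLT_posDef_of_le (by exact_mod_cast hR) (h.wronskianLT_posDef hpos hd ?_)
    rw [h.apply_zero]
    exact div_ne_zero hr0 (by positivity)

theorem kernelMatrix_eq_stationaryKernel {d n : ℕ} (f : ℝ → ℝ)
    (x : Fin n → EuclideanSpace ℝ (Fin d)) {ε : ℝ} (hε : 0 ≤ ε) (i j : Fin n) :
    kernelMatrix f x ε i j = stationaryKernel d f (ε • x i) (ε • x j) := by
  rw [stationaryKernel, ← smul_sub, norm_smul, Real.norm_eq_abs, abs_of_nonneg hε]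
  rfl

theorem kernelMatrix_posSemidef {d n : ℕ} {f : ℝ → ℝ}
    (hpos : IsPosSemidefKernel (stationaryKernel d f)) (x : Fin n → EuclideanSpace ℝ (Fin d))
    {ε : ℝ} (hε : 0 ≤ ε) : (kernelMatrix f x ε).PosSemidef := by
  refine .of_dotProduct_mulVec_nonneg ?_ fun c => ?_
  · ext i j
    simp [kernelMatrix, norm_sub_rev]
  · have h := hpos.sum_nonneg (fun i => ε • x i) c
    refine h.trans_eq ?_
    refine Finset.sum_congr rfl fun i _ => ?_
    rw [Matrix.mulVec, dotProduct, Finset.mul_sum]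
    refine Finset.sum_congr rfl fun j _ => ?_
    rw [kernelMatrix_eq_stationaryKernel f x hε, star_trivial]
    ring

/-! ### Dimension counts -/

theorem polyDim_zero (d : ℕ) : polyDim d 0 = 1 := by simp [polyDim]

theorem polyDim_strictMono {d : ℕ} (hd : 0 < d) : StrictMono (polyDim d) := by
  refine strictMono_nat_of_lt_succ fun k => ?_
  obtain ⟨e, rfl⟩ : ∃ e, d = e + 1 := ⟨d - 1, by omega⟩
  unfold polyDim
  rw [show k + 1 + (e + 1) = (k + (e + 1)) + 1 by ring, Nat.choose_succ_succ']
  have : 0 < (k + (e + 1)).choose e := Nat.choose_pos (by omega)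
  omega

theorem card_multiIdxEq (d k : ℕ) : (multiIdxEq d k).card = (d + k - 1).choose k := by
  have h : multiIdxEq d k =
      (Finset.finsuppAntidiag Finset.univ k).map Finsupp.equivFunOnFinite.toEmbedding := by
    ext α
    rw [mem_multiIdxEq, Finset.mem_map_equiv, Finset.mem_finsuppAntidiag]
    simp
  rw [h, Finset.card_map, Finset.card_finsuppAntidiag_nat_eq_choose, Finset.card_univ,
    Fintype.card_fin]

theorem card_multiIdxLT_succ (d k : ℕ) : (multiIdxLT d (k + 1)).card = polyDim d k := by
  induction k with
  | zero =>
    rw [polyDim_zero, Finset.card_eq_one]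
    refine ⟨0, ?_⟩
    ext α
    rw [mem_multiIdxLT, Finset.mem_singleton]
    simp [funext_iff]
  | succ k ih =>
    have h1 : multiIdxLT d (k + 1 + 1) = multiIdxLT d (k + 1) ∪ multiIdxEq d (k + 1) := by
      ext α
      rw [Finset.mem_union, mem_multiIdxLT, mem_multiIdxLT, mem_multiIdxEq]
      omega
    have h2 : Disjoint (multiIdxLT d (k + 1)) (multiIdxEq d (k + 1)) := by
      rw [Finset.disjoint_left]
      intro α h3 h4
      rw [mem_multiIdxLT] at h3
      rw [mem_multiIdxEq] at h4
      omega
    rw [h1, Finset.card_union_of_disjoint h2, ih, card_multiIdxEq, polyDim, polyDim,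
      ← Nat.choose_symm_add (a := k), ← Nat.choose_symm_add (a := k + 1), add_right_comm k 1 d, Nat.choose_succ_succ',
      show d + (k + 1) - 1 = k + d by omega]

theorem existsUnique_between_polyDim {d m : ℕ} (hd : 0 < d) (hm : 1 ≤ m) {r : ℕ∞} (hr : 1 ≤ r)
    (hmr : (m : ℕ∞) ≤ polyDimBelow d r) (hmag : m ∉ magicNumbers d) :
    ∃! k : ℕ, 1 ≤ k ∧ (k : ℕ∞) < r ∧ polyDim d (k - 1) < m ∧ m < polyDim d k := by
  have hmono := polyDim_strictMono hd
  have hne : ∀ k, polyDim d k ≠ m := fun k hk => hmag ⟨k, hk⟩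
  have hex : ∃ k, m < polyDim d k := ⟨m + 1, (hmono.id_le (m + 1)).trans_lt' (by simp)⟩
  classical
  have hspec := Nat.find_spec hex
  have hmin := fun j => Nat.find_min (m := j) hex
  set k := Nat.find hex with hk
  have hk1 : 1 ≤ k := by
    by_contra h0
    rw [show k = 0 by omega, polyDim_zero] at hspec
    omega
  refine ⟨k, ⟨hk1, ?_, lt_of_le_of_ne (not_lt.1 (hmin (k - 1) (by omega))) (hne _), hspec⟩, ?_⟩
  · induction r using ENat.recTopCoe with
    | top => exact ENat.natCast_lt_top k
    | coe s =>
      have h1 : m ≤ polyDim d (s - 1) := by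
        have : (m : ℕ∞) ≤ (polyDim d (s - 1) : ℕ∞) := hmr
        exact_mod_cast this
      have h2 : 1 ≤ s := by exact_mod_cast hr
      have h3 : k ≤ s - 1 := Nat.find_min' hex (lt_of_le_of_ne h1 (hne _).symm)
      exact_mod_cast (by omega : k < s)
  · rintro j ⟨hj1, -, hj2, hj3⟩
    have h1 : k < j + 1 := Nat.lt_succ_of_le (Nat.find_min' hex hj3)
    have h2 := hmono.lt_iff_lt.1 (hj2.trans hspec)
    omega

/-! ### Low-rank decompositions of the kernel matrix -/

/-- The diagonal matrix of the powers `ε ^ |α|`, `|α| < k`. -/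
noncomputable def degreeScaling (d k : ℕ) (ε : ℝ) :
    Matrix (multiIdxLT d k) (multiIdxLT d k) ℝ :=
  Matrix.diagonal fun α => ε ^ (∑ j, α.1 j)

theorem degreeScaling_transpose (d k : ℕ) (ε : ℝ) :
    (degreeScaling d k ε)ᵀ = degreeScaling d k ε :=
  Matrix.diagonal_transpose _

theorem tendsto_pow_nhdsGT_zero {p : ℕ} (hp : p ≠ 0) :
    Tendsto (fun ε : ℝ => ε ^ p) (𝓝[>] 0) (𝓝 0) := by
  have h := (continuous_pow p).tendsto (0 : ℝ)
  rw [zero_pow hp] at h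
  exact h.mono_left nhdsWithin_le_nhds

theorem isUnit_det_degreeScaling_mul {d k : ℕ} {ε : ℝ} (hε : ε ≠ 0)
    {W : Matrix (multiIdxLT d k) (multiIdxLT d k) ℝ} (hW : IsUnit W.det) :
    IsUnit (degreeScaling d k ε * W * degreeScaling d k ε).det := by
  have h : IsUnit (degreeScaling d k ε).det := by
    rw [degreeScaling, Matrix.det_diagonal]
    exact (Finset.prod_ne_zero_iff.2 fun α _ => pow_ne_zero _ hε).isUnit
  rw [Matrix.det_mul, Matrix.det_mul]
  exact (h.mul hW).mul h

/-- The entries are multiples of `ε ^ (p - |α| - |β|)`, and `|α| + |β| ≤ 2k - 2 < p`. -/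
theorem tendsto_smul_inv_degreeScaling {d k p : ℕ} (hp : 2 * k - 1 ≤ p) (hp0 : p ≠ 0) (b : ℝ)
    {W : Matrix (multiIdxLT d k) (multiIdxLT d k) ℝ} (hW : IsUnit W.det) :
    Tendsto (fun ε : ℝ => (b * ε ^ p) • (degreeScaling d k ε * W * degreeScaling d k ε)⁻¹)
      (𝓝[>] 0) (𝓝 0) := by
  set N : ℝ → Matrix (multiIdxLT d k) (multiIdxLT d k) ℝ := fun ε =>
    Matrix.of fun α β => b * ε ^ (p - (∑ j, α.1 j) - ∑ j, β.1 j) * W⁻¹ α β with hN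
  have h1 : Tendsto N (𝓝[>] 0) (𝓝 0) := by
    refine tendsto_pi_nhds.2 fun α => tendsto_pi_nhds.2 fun β => ?_
    have hα := mem_multiIdxLT.1 α.2
    have hβ := mem_multiIdxLT.1 β.2
    have h2 := ((tendsto_pow_nhdsGT_zero (p := p - (∑ j, α.1 j) - ∑ j, β.1 j)
      (by omega)).const_mul b).mul_const (W⁻¹ α β)
    rw [mul_zero, zero_mul] at h2
    exact h2
  refine h1.congr' ?_
  filter_upwards [self_mem_nhdsWithin] with ε hε
  have hε : 0 < ε := hε
  set E : Matrix (multiIdxLT d k) (multiIdxLT d k) ℝ :=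
    Matrix.diagonal fun α => (ε ^ (∑ j, α.1 j))⁻¹ with hE
  have h3 : degreeScaling d k ε * E = 1 := by
    rw [degreeScaling, hE, Matrix.diagonal_mul_diagonal, ← Matrix.diagonal_one]
    congr 1
    funext α
    exact mul_inv_cancel₀ (by positivity)
  have h4 : (degreeScaling d k ε * W * degreeScaling d k ε)⁻¹ = E * W⁻¹ * E := by
    refine Matrix.inv_eq_right_inv ?_
    calc degreeScaling d k ε * W * degreeScaling d k ε * (E * W⁻¹ * E)
        = degreeScaling d k ε * W * (degreeScaling d k ε * E) * W⁻¹ * E := by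
          simp only [Matrix.mul_assoc]
      _ = degreeScaling d k ε * (W * W⁻¹) * E := by
          rw [h3, Matrix.mul_one]; simp only [Matrix.mul_assoc]
      _ = 1 := by rw [Matrix.mul_nonsing_inv _ hW, Matrix.mul_one, h3]
  rw [h4]
  ext α β
  have hα := mem_multiIdxLT.1 α.2
  have hβ := mem_multiIdxLT.1 β.2
  rw [Matrix.smul_apply, hE, Matrix.mul_diagonal, Matrix.diagonal_mul, smul_eq_mul]
  change b * ε ^ (p - (∑ j, α.1 j) - ∑ j, β.1 j) * W⁻¹ α β = _
  have h5 : ε ^ p = ε ^ (p - (∑ j, α.1 j) - ∑ j, β.1 j) * ε ^ (∑ j, α.1 j) * ε ^ (∑ j, β.1 j) := by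
    rw [← pow_add, ← pow_add]; congr 1; omega
  rw [h5]
  field_simp

/-- At most one of the two degrees can reach `R`: the sum splits into a full square block and two
mixed blocks. -/
theorem sum_ite_add_lt_split {d R : ℕ} (F : (Fin d → ℕ) → (Fin d → ℕ) → ℝ) :
    (∑ α ∈ multiIdxLT d (2 * R - 1), ∑ β ∈ multiIdxLT d (2 * R - 1),
      if ∑ j, α j + ∑ j, β j < 2 * R - 1 then F α β else 0) =
    (∑ α ∈ multiIdxLT d R, ∑ β ∈ multiIdxLT d R, F α β) +
      (∑ α ∈ multiIdxLT d R, ∑ β ∈ multiIdxLT d (2 * R - 1),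
        if R ≤ ∑ j, β j ∧ ∑ j, α j + ∑ j, β j < 2 * R - 1 then F α β else 0) +
      ∑ α ∈ multiIdxLT d R, ∑ β ∈ multiIdxLT d (2 * R - 1),
        if R ≤ ∑ j, β j ∧ ∑ j, α j + ∑ j, β j < 2 * R - 1 then F β α else 0 := by
  set L := multiIdxLT d (2 * R - 1) with hL
  have hsub : multiIdxLT d R ⊆ L := fun α hα => by
    rw [hL, mem_multiIdxLT]
    rw [mem_multiIdxLT] at hα
    omega
  have hext : ∀ g : (Fin d → ℕ) → ℝ, ∑ α ∈ multiIdxLT d R, g α =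
      ∑ α ∈ L, if ∑ j, α j < R then g α else 0 := by
    intro g
    rw [← Finset.sum_filter]
    refine Finset.sum_congr ?_ fun _ _ => rfl
    ext α
    rw [Finset.mem_filter]
    exact ⟨fun h => ⟨hsub h, mem_multiIdxLT.1 h⟩, fun h => mem_multiIdxLT.2 h.2⟩
  have h3 : (∑ α ∈ multiIdxLT d R, ∑ β ∈ L,
        if R ≤ ∑ j, β j ∧ ∑ j, α j + ∑ j, β j < 2 * R - 1 then F β α else 0) =
      ∑ α ∈ L, ∑ β ∈ multiIdxLT d R,
        if R ≤ ∑ j, α j ∧ ∑ j, β j + ∑ j, α j < 2 * R - 1 then F α β else 0 := Finset.sum_comm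
  rw [h3, hext, hext, ← Finset.sum_add_distrib, ← Finset.sum_add_distrib]
  refine Finset.sum_congr rfl fun α _ => ?_
  rw [hext, hext]
  by_cases hα : ∑ j, α j < R
  · rw [if_pos hα, if_pos hα, ← Finset.sum_add_distrib, ← Finset.sum_add_distrib]
    refine Finset.sum_congr rfl fun β _ => ?_
    by_cases hβ : ∑ j, β j < R
    · simp [hβ, show ∑ j, α j + ∑ j, β j < 2 * R - 1 by omega, not_le.2 hα, not_le.2 hβ]
    · simp [hβ, not_lt.1 hβ]
  · rw [if_neg hα, if_neg hα, zero_add, zero_add]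
    refine Finset.sum_congr rfl fun β _ => ?_
    by_cases hβ : ∑ j, β j < R
    · simp [hβ, not_lt.1 hα, add_comm]
    · simp [hβ, show ¬ ∑ j, α j + ∑ j, β j < 2 * R - 1 by omega]

/-- Completing the square: the mixed terms `t • (V Δ Bᵀ)` and their transpose are absorbed by
shifting `V` by `G`, at the price of a term of order `t * t`. -/
theorem mul_add_smul_mul_transpose {n ι : Type*} [Fintype ι] [DecidableEq ι]
    {V G B : Matrix n ι ℝ} {Δ W : Matrix ι ι ℝ} (hW : IsUnit W.det) (hWs : Wᵀ = W)
    (hΔ : Δᵀ = Δ) {t : ℝ} (hG : G * Δ = t • (B * W⁻¹)) :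
    (V + G) * (Δ * W * Δ) * (V + G)ᵀ = (V * Δ) * W * (V * Δ)ᵀ + t • (V * Δ * Bᵀ) +
      t • (V * Δ * Bᵀ)ᵀ + (t * t) • (B * W⁻¹ * Bᵀ) := by
  have h0 : (V + G) * (Δ * W * Δ) * (V + G)ᵀ = ((V + G) * Δ) * W * ((V + G) * Δ)ᵀ := by
    rw [Matrix.transpose_mul, hΔ]
    simp only [Matrix.mul_assoc]
  have h1 : (W⁻¹)ᵀ = W⁻¹ := by rw [Matrix.transpose_nonsing_inv, hWs]
  have h2 : W * W⁻¹ = 1 := Matrix.mul_nonsing_inv _ hW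
  have h3 : W⁻¹ * W = 1 := Matrix.nonsing_inv_mul _ hW
  rw [h0, Matrix.add_mul, hG]
  simp only [Matrix.transpose_add, Matrix.transpose_smul, Matrix.transpose_mul, h1, hΔ,
    Matrix.transpose_transpose, Matrix.add_mul, Matrix.mul_add, Matrix.smul_mul, Matrix.mul_smul]
  have h4 : V * Δ * W * (W⁻¹ * Bᵀ) = V * Δ * Bᵀ := by
    rw [Matrix.mul_assoc (V * Δ), ← Matrix.mul_assoc W, h2, Matrix.one_mul]
  have h5 : B * W⁻¹ * W = B := by rw [Matrix.mul_assoc, h3, Matrix.mul_one]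
  rw [h4, h5, Matrix.mul_assoc B W⁻¹ Bᵀ]
  simp only [smul_add, smul_smul]
  abel

/-- The mixed block carries a factor `ε ^ R`, from the degrees at least `R`. Completing the square
with `t = ε ^ R` leaves an error of order `ε ^ (2R)`, one order smaller than the distance term, so
it does not affect the limit of `T`. -/
theorem KernelExpansion.exists_decomposition {d n R : ℕ} {f ψ : ℝ → ℝ}
    (h : KernelExpansion d f R ψ)
    (hW : IsUnit (wronskianLT (stationaryKernel d f) R).det)
    (x : Fin n → EuclideanSpace ℝ (Fin d)) :
    ∃ (G : ℝ → Matrix (Fin n) (multiIdxLT d R) ℝ) (T : ℝ → Matrix (Fin n) (Fin n) ℝ),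
      Tendsto G (𝓝[>] 0) (𝓝 0) ∧
      Tendsto T (𝓝[>] 0) (𝓝 (ψ 0 • distPowMatrix x (2 * R - 1))) ∧
      ∀ ε : ℝ, 0 < ε → kernelMatrix f x ε =
        (vandermondeLT x R + G ε) *
          (degreeScaling d R ε * wronskianLT (stationaryKernel d f) R * degreeScaling d R ε) *
          (vandermondeLT x R + G ε)ᵀ + ε ^ (2 * R - 1) • T ε := by
  have hR := h.pos
  set w := wronskianEntry (stationaryKernel d f) with hw
  set W := wronskianLT (stationaryKernel d f) R with hWdef
  have hWs : Wᵀ = W := h.wronskianLT_isHermitian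
  set V := vandermondeLT x R with hV
  set B : ℝ → Matrix (Fin n) (multiIdxLT d R) ℝ := fun ε => Matrix.of fun i α =>
    ∑ β ∈ multiIdxLT d (2 * R - 1), if R ≤ ∑ j, β j ∧ ∑ j, α.1 j + ∑ j, β j < 2 * R - 1 then
      w α β * ε ^ (∑ j, β j - R) * monomialFun β (x i) else 0 with hB
  have hBe : ∀ ε i α, B ε i α = ∑ β ∈ multiIdxLT d (2 * R - 1),
      if R ≤ ∑ j, β j ∧ ∑ j, α.1 j + ∑ j, β j < 2 * R - 1 then
        w α β * ε ^ (∑ j, β j - R) * monomialFun β (x i) else 0 := fun _ _ _ => rfl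
  have hBc : Continuous B := by
    refine continuous_matrix fun i α => ?_
    refine continuous_finsetSum _ fun β _ => ?_
    split_ifs <;> fun_prop
  -- The solution of `G Δ = ε ^ R • (B W⁻¹)`; it tends to `0` because every degree involved is below
  -- `R`.
  set G : ℝ → Matrix (Fin n) (multiIdxLT d R) ℝ := fun ε => Matrix.of fun i α =>
    ε ^ (R - ∑ j, α.1 j) * (B ε * W⁻¹) i α with hG
  set Ψ : ℝ → Matrix (Fin n) (Fin n) ℝ := fun ε => Matrix.of fun i j =>
    ‖x i - x j‖ ^ (2 * R - 1) * ψ (ε * ‖x i - x j‖) with hΨ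
  have hBW : Continuous fun ε => B ε * W⁻¹ := hBc.matrix_mul continuous_const
  refine ⟨G, fun ε => Ψ ε - ε • (B ε * W⁻¹ * (B ε)ᵀ), ?_, ?_, fun ε hε => ?_⟩
  · refine tendsto_pi_nhds.2 fun i => tendsto_pi_nhds.2 fun α => ?_
    have hα := mem_multiIdxLT.1 α.2
    have h1 : Tendsto (fun ε => (B ε * W⁻¹) i α) (𝓝[>] 0) (𝓝 ((B 0 * W⁻¹) i α)) :=
      ((hBW.matrix_elem i α).tendsto 0).mono_left nhdsWithin_le_nhds
    have h2 := (tendsto_pow_nhdsGT_zero (p := R - ∑ j, α.1 j) (by omega)).mul h1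
    rw [zero_mul] at h2
    exact h2
  · have h1 : Tendsto Ψ (𝓝[>] 0) (𝓝 (ψ 0 • distPowMatrix x (2 * R - 1))) := by
      refine tendsto_pi_nhds.2 fun i => tendsto_pi_nhds.2 fun j => ?_
      have h2 := (h.tendsto_remainder ‖x i - x j‖).const_mul (‖x i - x j‖ ^ (2 * R - 1))
      rw [mul_comm _ (ψ 0)] at h2
      exact h2
    have h2 : Tendsto (fun ε => ε • (B ε * W⁻¹ * (B ε)ᵀ)) (𝓝[>] 0) (𝓝 0) := by
      have h3 : Continuous fun ε => ε • (B ε * W⁻¹ * (B ε)ᵀ) :=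
        continuous_id.smul (hBW.matrix_mul hBc.matrix_transpose)
      have h4 := (h3.tendsto 0).mono_left (nhdsWithin_le_nhds (s := Set.Ioi 0))
      rwa [zero_smul] at h4
    simpa using h1.sub h2
  · have hGΔ : G ε * degreeScaling d R ε = ε ^ R • (B ε * W⁻¹) := by
      ext i α
      have hα := mem_multiIdxLT.1 α.2
      rw [degreeScaling, Matrix.mul_diagonal, Matrix.smul_apply, smul_eq_mul,
        show ε ^ R = ε ^ (R - ∑ j, α.1 j) * ε ^ (∑ j, α.1 j) by rw [← pow_add]; congr 1; omega]
      change ε ^ (R - ∑ j, α.1 j) * (B ε * W⁻¹) i α * _ = _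
      ring
    dsimp only
    rw [mul_add_smul_mul_transpose hW hWs (degreeScaling_transpose _ _ _) hGΔ, smul_sub, smul_smul,
      ← pow_succ, ← pow_add, show 2 * R - 1 + 1 = R + R by omega]
    have hVΔ : ∀ i α, (V * degreeScaling d R ε) i α = monomialFun α (ε • x i) := by
      intro i α
      rw [degreeScaling, Matrix.mul_diagonal, monomialFun_smul, mul_comm]
      rfl
    have hcross : ∀ i j, (ε ^ R • (V * degreeScaling d R ε * (B ε)ᵀ)) i j =
        ∑ α ∈ multiIdxLT d R, ∑ β ∈ multiIdxLT d (2 * R - 1),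
          if R ≤ ∑ j, β j ∧ ∑ j, α j + ∑ j, β j < 2 * R - 1 then
            w α β * monomialFun α (ε • x i) * monomialFun β (ε • x j) else 0 := by
      intro i j
      rw [Matrix.smul_apply, Matrix.mul_apply, smul_eq_mul, Finset.mul_sum,
        ← Finset.sum_coe_sort (multiIdxLT d R)]
      refine Finset.sum_congr rfl fun α _ => ?_
      rw [hVΔ, Matrix.transpose_apply, hBe, Finset.mul_sum, Finset.mul_sum]
      refine Finset.sum_congr rfl fun β _ => ?_
      split_ifs with h1
      · rw [monomialFun_smul β, show ε ^ (∑ j, β j) = ε ^ R * ε ^ (∑ j, β j - R) by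
          rw [← pow_add]; congr 1; omega]
        ring
      · simp
    have hmain : ∀ i j, (V * degreeScaling d R ε * W * (V * degreeScaling d R ε)ᵀ) i j =
        ∑ α ∈ multiIdxLT d R, ∑ β ∈ multiIdxLT d R,
          w α β * monomialFun α (ε • x i) * monomialFun β (ε • x j) := by
      intro i j
      rw [Matrix.mul_assoc, Matrix.mul_apply, ← Finset.sum_coe_sort (multiIdxLT d R)]
      refine Finset.sum_congr rfl fun α _ => ?_
      rw [hVΔ, Matrix.mul_apply, Finset.mul_sum, ← Finset.sum_coe_sort (multiIdxLT d R)]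
      refine Finset.sum_congr rfl fun β _ => ?_
      rw [Matrix.transpose_apply, hVΔ]
      change _ * (w α β * _) = _
      ring
    ext i j
    rw [kernelMatrix_eq_stationaryKernel f x hε.le, h.eq, sum_ite_add_lt_split]
    simp only [Matrix.add_apply, Matrix.sub_apply, hmain, hcross, ← Matrix.transpose_smul,
      Matrix.transpose_apply]
    have h6 : (∑ α ∈ multiIdxLT d R, ∑ β ∈ multiIdxLT d (2 * R - 1),
        if R ≤ ∑ j, β j ∧ ∑ j, α j + ∑ j, β j < 2 * R - 1 then
          w β α * monomialFun β (ε • x i) * monomialFun α (ε • x j) else 0) =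
        ∑ α ∈ multiIdxLT d R, ∑ β ∈ multiIdxLT d (2 * R - 1),
        if R ≤ ∑ j, β j ∧ ∑ j, α j + ∑ j, β j < 2 * R - 1 then
          w α β * monomialFun α (ε • x j) * monomialFun β (ε • x i) else 0 := by
      refine Finset.sum_congr rfl fun α _ => Finset.sum_congr rfl fun β _ => ?_
      split_ifs with h7
      · rw [hw, h.symm α β h7.2]
        ring
      · rfl
    have h8 : ‖ε • x i - ε • x j‖ = ε * ‖x i - x j‖ := by
      rw [← smul_sub, norm_smul, Real.norm_eq_abs, abs_of_pos hε]
    rw [h6, h8, mul_pow]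
    simp only [Matrix.smul_apply, smul_eq_mul, hΨ, Matrix.of_apply]
    ring

/-! ### Limits of the kernel ensembles -/

/-- The free constant `b` moves a scalar between `η` and `T`, so that the limit can be normalised to
have coefficient `(-1) ^ r` instead of `f_{2r-1}`. -/
theorem KernelExpansion.convergesInLaw {d n m R : ℕ} {f ψ : ℝ → ℝ}
    (h : KernelExpansion d f R ψ) (hpos : IsPosSemidefKernel (stationaryKernel d f))
    (hW : IsUnit (wronskianLT (stationaryKernel d f) R).det)
    (x : Fin n → EuclideanSpace ℝ (Fin d)) {b : ℝ} (hb : b ≠ 0)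
    (hX : ∃ X : Finset (Fin n), X.card = m ∧ extWeight
      ((b⁻¹ * ψ 0) • distPowMatrix x (2 * R - 1)) (vandermondeLT x R) X ≠ 0) :
    ConvergesInLaw (fun ε => fixedSizeLEnsemble m (kernelMatrix f x ε))
      (fixedSizeExtLEnsemble m ((b⁻¹ * ψ 0) • distPowMatrix x (2 * R - 1))
        (vandermondeLT x R)) := by
  have hR := h.pos
  obtain ⟨G, T, hG, hT, hdec⟩ := h.exists_decomposition hW x
  have hA : Tendsto (fun ε => vandermondeLT x R + G ε) (𝓝[>] 0) (𝓝 (vandermondeLT x R)) := by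
    simpa using tendsto_const_nhds.add hG
  refine convergesInLaw_of_low_rank_add (T := fun ε => b⁻¹ • T ε)
    (η := fun ε => b * ε ^ (2 * R - 1)) ?_ ?_ ?_ hA ?_
    (tendsto_smul_inv_degreeScaling le_rfl (by omega) b hW) hX
  · filter_upwards [self_mem_nhdsWithin] with ε hε using
      kernelMatrix_posSemidef hpos x (le_of_lt hε)
  · filter_upwards [self_mem_nhdsWithin] with ε hε
    rw [hdec ε hε, smul_smul, mul_right_comm, mul_inv_cancel₀ hb, one_mul]
  · filter_upwards [self_mem_nhdsWithin] with ε hε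
    have hε : 0 < ε := hε
    exact ⟨isUnit_det_degreeScaling_mul hε.ne' hW, mul_ne_zero hb (by positivity)⟩
  · have h1 := hT.const_smul b⁻¹
    rwa [smul_smul] at h1

theorem transpose_mulVec_vandermondeBlock {d n : ℕ} (x : Fin n → EuclideanSpace ℝ (Fin d))
    (S : Finset (Fin d → ℕ)) (c : Fin n → ℝ) (α : S) :
    ((vandermondeBlock x S)ᵀ *ᵥ c) α = moment x c α := by
  rw [Matrix.mulVec, dotProduct, moment]
  refine Finset.sum_congr rfl fun i _ => ?_
  rw [mul_comm]
  rfl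

theorem moment_eq_zero_of_transpose_mulVec {d n k : ℕ} {x : Fin n → EuclideanSpace ℝ (Fin d)}
    {c : Fin n → ℝ} (h : (vandermondeLT x k)ᵀ *ᵥ c = 0) (α : Fin d → ℕ) (hα : ∑ j, α j < k) :
    moment x c α = 0 := by
  have h1 := transpose_mulVec_vandermondeBlock x (multiIdxLT d k) c ⟨α, mem_multiIdxLT.2 hα⟩
  rw [← h1]
  exact congrFun h _

theorem dotProduct_distPowMatrix {d n : ℕ} (x : Fin n → EuclideanSpace ℝ (Fin d)) (p : ℕ)
    (c : Fin n → ℝ) : c ⬝ᵥ (distPowMatrix x p *ᵥ c) = distForm p x c := by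
  refine Finset.sum_congr rfl fun i _ => ?_
  rw [Matrix.mulVec, dotProduct, Finset.mul_sum]
  refine Finset.sum_congr rfl fun j _ => ?_
  change c i * (‖x i - x j‖ ^ p * c j) = _
  ring

/-- The chosen rows form an invertible square matrix, so `Vᵀ c = 0` already forces `c = 0` and no
property of the distance form is needed, not even `ψ 0 ≠ 0`. -/
theorem convergesInLaw_of_card_eq {d n R : ℕ} {f ψ : ℝ → ℝ} (h : KernelExpansion d f R ψ)
    (hpos : IsPosSemidefKernel (stationaryKernel d f))
    (hW : IsUnit (wronskianLT (stationaryKernel d f) R).det)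
    (x : Fin n → EuclideanSpace ℝ (Fin d)) (hV : LinearIndependent ℝ (vandermondeLT x R).col) :
    ConvergesInLaw
      (fun ε => fixedSizeLEnsemble (Fintype.card (multiIdxLT d R)) (kernelMatrix f x ε))
      (fixedSizeLEnsemble (Fintype.card (multiIdxLT d R))
        (vandermondeLT x R * (vandermondeLT x R)ᵀ)) := by
  set V := vandermondeLT x R with hVdef
  obtain ⟨X, hX, hli, hXV⟩ := exists_rows_of_linearIndependent_col V hV
  have hne : extWeight (((1 : ℝ)⁻¹ * ψ 0) • distPowMatrix x (2 * R - 1)) V X ≠ 0 := by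
    refine extWeight_ne_zero hXV fun c hc hVc _ => ?_
    have h2 := linearIndepOn_finset_iff.1 hli c ?_
    · funext i
      by_cases hi : i ∈ X
      · exact h2 i hi
      · exact hc i hi
    · funext α
      rw [← congrFun hVc α, Finset.sum_apply, Matrix.mulVec, dotProduct]
      rw [← Finset.sum_subset (Finset.subset_univ X) fun i _ hi => by rw [hc i hi, mul_zero]]
      exact Finset.sum_congr rfl fun i _ => mul_comm _ _
  have h1 := h.convergesInLaw hpos hW x one_ne_zero ⟨X, hX, hne⟩
  have h2 : fixedSizeExtLEnsemble (Fintype.card (multiIdxLT d R))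
      (((1 : ℝ)⁻¹ * ψ 0) • distPowMatrix x (2 * R - 1)) V =
      fixedSizeLEnsemble (Fintype.card (multiIdxLT d R)) (V * Vᵀ) :=
    fixedSizeMass_congr (c := (-1) ^ Fintype.card (multiIdxLT d R))
      (pow_ne_zero _ (by norm_num)) fun X hX => extWeight_of_card_eq _ V X hX
  rwa [h2] at h1

theorem isNonnegPair_and_convergesInLaw_of_lt {d n m r : ℕ} (hd : 0 < d)
    {x : Fin n → EuclideanSpace ℝ (Fin d)} (hx : Function.Injective x) {f ψ : ℝ → ℝ}
    (h : KernelExpansion d f r ψ) (hpos : IsPosSemidefKernel (stationaryKernel d f))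
    (hψ : ψ 0 ≠ 0) (hm : Fintype.card (multiIdxLT d r) ≤ m) (hmn : m ≤ n)
    (hV : LinearIndependent ℝ (vandermondeLT x r).col) :
    IsNonnegPair ((-1 : ℝ) ^ r • distPowMatrix x (2 * r - 1)) (vandermondeLT x r) ∧
      ConvergesInLaw (fun ε => fixedSizeLEnsemble m (kernelMatrix f x ε))
        (fixedSizeExtLEnsemble m ((-1 : ℝ) ^ r • distPowMatrix x (2 * r - 1))
          (vandermondeLT x r)) := by
  have hsign := h.sign hpos hd hψ
  have hone : ((-1 : ℝ) ^ r) * (-1) ^ r = 1 := by rw [← mul_pow]; simp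
  -- With `b = (-1) ^ r * ψ 0`, which is positive, the limit of `T` becomes `(-1) ^ r` times the
  -- distance matrix.
  have hs : ((-1 : ℝ) ^ r * ψ 0)⁻¹ * ψ 0 = (-1) ^ r := by
    rw [mul_inv, mul_assoc, inv_mul_cancel₀ hψ, mul_one, ← one_div, div_eq_iff (by simp)]
    exact hone.symm
  refine ⟨⟨hV, ?_, fun c hc => ?_⟩, ?_⟩
  · ext i j
    simp [distPowMatrix, norm_sub_rev]
  · have h1 := h.distForm_nonneg hpos x fun α hα => moment_eq_zero_of_transpose_mulVec hc α hα
    rw [Matrix.smul_mulVec, dotProduct_smul, dotProduct_distPowMatrix, smul_eq_mul, ← hs, mul_assoc]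
    exact mul_nonneg (inv_nonneg.2 hsign.le) h1
  · obtain ⟨X, hX, hXV⟩ := exists_rows_superset _ hV hm hmn
    rw [← hs]
    refine h.convergesInLaw hpos (h.wronskianLT_posDef hpos hd hψ).det_pos.ne'.isUnit x hsign.ne'
      ⟨X, hX, extWeight_ne_zero hXV fun c _ hVc hc => ?_⟩
    rw [hs, Matrix.smul_mulVec, dotProduct_smul, dotProduct_distPowMatrix, smul_eq_mul] at hc
    exact h.eq_zero_of_distForm_eq_zero hpos hd hψ hx
      (fun α hα => moment_eq_zero_of_transpose_mulVec hVc α hα)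
      ((mul_eq_zero.1 hc).resolve_left (by simp))

/-! ### Sizes between two magic numbers -/

/-- Multi-indices of degree `≤ k`, split into those of degree `< k` and those of degree `k`. -/
def multiIdxSumEquiv (d k : ℕ) : multiIdxLT d k ⊕ multiIdxEq d k ≃ multiIdxLT d (k + 1) where
  toFun := Sum.elim (fun α => ⟨α, mem_multiIdxLT.2 ((mem_multiIdxLT.1 α.2).trans k.lt_succ_self)⟩)
    fun α => ⟨α, mem_multiIdxLT.2 ((mem_multiIdxEq.1 α.2).trans_lt k.lt_succ_self)⟩
  invFun α := if h : ∑ j, α.1 j < k then Sum.inl ⟨α, mem_multiIdxLT.2 h⟩ else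
    Sum.inr ⟨α, mem_multiIdxEq.2 (by have := mem_multiIdxLT.1 α.2; omega)⟩
  left_inv := by
    rintro (α | α)
    · simp [mem_multiIdxLT.1 α.2]
    · simp [mem_multiIdxEq.1 α.2]
  right_inv α := by
    dsimp only
    split_ifs <;> rfl

theorem wronskianLT_submatrix {d k : ℕ}
    (κ : EuclideanSpace ℝ (Fin d) → EuclideanSpace ℝ (Fin d) → ℝ) :
    (wronskianLT κ (k + 1)).submatrix (multiIdxSumEquiv d k) (multiIdxSumEquiv d k) =
      Matrix.fromBlocks (wronskianLT κ k) (wronskianBlock κ (multiIdxLT d k) (multiIdxEq d k))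
        (wronskianBlock κ (multiIdxEq d k) (multiIdxLT d k))
        (wronskianBlock κ (multiIdxEq d k) (multiIdxEq d k)) := by
  ext (α | α) (β | β) <;> rfl

theorem wronskianSchur_posDef {d k : ℕ}
    {κ : EuclideanSpace ℝ (Fin d) → EuclideanSpace ℝ (Fin d) → ℝ}
    (h : (wronskianLT κ (k + 1)).PosDef) : (wronskianSchur κ k).PosDef := by
  have h1 : (wronskianLT κ k).PosDef := wronskianLT_posDef_of_le k.le_succ h
  have h2 := h.submatrix (multiIdxSumEquiv d k).injective
  have hl : (wronskianBlock κ (multiIdxLT d k) (multiIdxEq d k))ᴴ =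
      wronskianBlock κ (multiIdxEq d k) (multiIdxLT d k) := by
    ext α β
    exact h2.1.apply (Sum.inr α) (Sum.inl β)
  rw [wronskianLT_submatrix, ← hl] at h2
  have := (wronskianLT κ k).invertibleOfIsUnitDet h1.det_pos.ne'.isUnit
  have h3 := (Matrix.PosDef.fromBlocks₁₁ _ _ h1).1 h2.posSemidef
  have h4 := h2.det_pos.ne'
  rw [Matrix.det_fromBlocks₁₁, Matrix.invOf_eq_nonsing_inv] at h4
  rw [hl] at h3 h4
  exact h3.posDef_iff_det_ne_zero.2 (right_ne_zero_of_mul h4)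

/-- Block elimination in a congruence. -/
theorem mul_fromBlocks_mul_transpose {n p q : Type*} [Fintype p] [Fintype q]
    [DecidableEq p] (P : Matrix n p ℝ) (Q : Matrix n q ℝ) {W₁ : Matrix p p ℝ} (B : Matrix p q ℝ)
    (D : Matrix q q ℝ) (hW : IsUnit W₁.det) (hWs : W₁ᵀ = W₁) :
    Matrix.fromCols P Q * Matrix.fromBlocks W₁ B Bᵀ D * (Matrix.fromCols P Q)ᵀ =
      (P + Q * (Bᵀ * W₁⁻¹)) * W₁ * (P + Q * (Bᵀ * W₁⁻¹))ᵀ + Q * (D - Bᵀ * W₁⁻¹ * B) * Qᵀ := by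
  have h1 : (W₁⁻¹)ᵀ = W₁⁻¹ := by rw [Matrix.transpose_nonsing_inv, hWs]
  have h2 : ∀ Y : Matrix p n ℝ, W₁ * (W₁⁻¹ * Y) = Y := fun Y => by
    rw [← Matrix.mul_assoc, Matrix.mul_nonsing_inv _ hW, Matrix.one_mul]
  have h3 : ∀ Y : Matrix p n ℝ, W₁⁻¹ * (W₁ * Y) = Y := fun Y => by
    rw [← Matrix.mul_assoc, Matrix.nonsing_inv_mul _ hW, Matrix.one_mul]
  rw [Matrix.fromCols_mul_fromBlocks, Matrix.transpose_fromCols, Matrix.fromCols_mul_fromRows]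
  simp only [Matrix.transpose_add, Matrix.transpose_mul, Matrix.transpose_transpose, h1,
    Matrix.add_mul, Matrix.mul_add, Matrix.sub_mul, Matrix.mul_sub, Matrix.mul_assoc, h2, h3]
  abel

theorem mul_degreeScaling_submatrix {d n k : ℕ} (U : Matrix (Fin n) (multiIdxLT d (k + 1)) ℝ)
    (ε : ℝ) :
    (U * degreeScaling d (k + 1) ε).submatrix id (multiIdxSumEquiv d k) =
      Matrix.fromCols
        (U.submatrix id (multiIdxSumEquiv d k ∘ Sum.inl) * degreeScaling d k ε)
        (ε ^ k • U.submatrix id (multiIdxSumEquiv d k ∘ Sum.inr)) := by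
  ext i (α | α)
  · rw [Matrix.submatrix_apply, Matrix.fromCols_apply_inl, degreeScaling, degreeScaling,
      Matrix.mul_diagonal, Matrix.mul_diagonal]
    rfl
  · rw [Matrix.submatrix_apply, Matrix.fromCols_apply_inr, degreeScaling, Matrix.mul_diagonal,
      Matrix.smul_apply, smul_eq_mul, mul_comm]
    change ε ^ (∑ j, α.1 j) * _ = _
    rw [mem_multiIdxEq.1 α.2]
    rfl

/-- Eliminating the degree-`k` block leaves the Schur complement at the uniform scale `ε ^ (2k)`.
The correction to the lower columns carries `ε ^ (k - |α|)` with `|α| < k`, hence vanishes in the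
limit. -/
theorem mul_degreeScaling_mul_transpose_eq {d n k : ℕ}
    {κ : EuclideanSpace ℝ (Fin d) → EuclideanSpace ℝ (Fin d) → ℝ}
    (hW : (wronskianLT κ (k + 1)).PosDef) (U : Matrix (Fin n) (multiIdxLT d (k + 1)) ℝ) (ε : ℝ) :
    U * (degreeScaling d (k + 1) ε * wronskianLT κ (k + 1) * degreeScaling d (k + 1) ε) * Uᵀ =
      (U.submatrix id (multiIdxSumEquiv d k ∘ Sum.inl) +
          U.submatrix id (multiIdxSumEquiv d k ∘ Sum.inr) *
            (wronskianBlock κ (multiIdxEq d k) (multiIdxLT d k) * (wronskianLT κ k)⁻¹) *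
              Matrix.diagonal fun α : multiIdxLT d k => ε ^ (k - ∑ j, α.1 j)) *
        (degreeScaling d k ε * wronskianLT κ k * degreeScaling d k ε) *
      (U.submatrix id (multiIdxSumEquiv d k ∘ Sum.inl) +
          U.submatrix id (multiIdxSumEquiv d k ∘ Sum.inr) *
            (wronskianBlock κ (multiIdxEq d k) (multiIdxLT d k) * (wronskianLT κ k)⁻¹) *
              Matrix.diagonal fun α : multiIdxLT d k => ε ^ (k - ∑ j, α.1 j))ᵀ +
      ε ^ (2 * k) • (U.submatrix id (multiIdxSumEquiv d k ∘ Sum.inr) * wronskianSchur κ k *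
        (U.submatrix id (multiIdxSumEquiv d k ∘ Sum.inr))ᵀ) := by
  have hW₁ : (wronskianLT κ k).PosDef := wronskianLT_posDef_of_le k.le_succ hW
  have hB : wronskianBlock κ (multiIdxEq d k) (multiIdxLT d k) =
      (wronskianBlock κ (multiIdxLT d k) (multiIdxEq d k))ᵀ := by
    ext α β
    exact (hW.submatrix (multiIdxSumEquiv d k).injective).1.apply (Sum.inl β) (Sum.inr α)
  set U₁ := U.submatrix id (multiIdxSumEquiv d k ∘ Sum.inl) with hU₁
  set U₂ := U.submatrix id (multiIdxSumEquiv d k ∘ Sum.inr) with hU₂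
  set C := wronskianBlock κ (multiIdxEq d k) (multiIdxLT d k) * (wronskianLT κ k)⁻¹ with hC
  set E : Matrix (multiIdxLT d k) (multiIdxLT d k) ℝ :=
    Matrix.diagonal fun α => ε ^ (k - ∑ j, α.1 j) with hE
  have hcongr : ∀ {p : ℕ} (A : Matrix (Fin n) (multiIdxLT d p) ℝ)
      (Y : Matrix (multiIdxLT d p) (multiIdxLT d p) ℝ),
      A * (degreeScaling d p ε * Y * degreeScaling d p ε) * Aᵀ =
        (A * degreeScaling d p ε) * Y * (A * degreeScaling d p ε)ᵀ := by
    intro p A Y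
    rw [Matrix.transpose_mul, degreeScaling_transpose]
    simp only [Matrix.mul_assoc]
  have hEΔ : E * degreeScaling d k ε = ε ^ k • (1 : Matrix (multiIdxLT d k) (multiIdxLT d k) ℝ) := by
    rw [hE, degreeScaling, Matrix.diagonal_mul_diagonal, ← Matrix.diagonal_one,
      ← Matrix.diagonal_smul]
    congr 1
    funext α
    have hα := mem_multiIdxLT.1 α.2
    rw [← pow_add, show k - ∑ j, α.1 j + ∑ j, α.1 j = k by omega]
    simp
  have hA : (U₁ + U₂ * C * E) * degreeScaling d k ε =
      U₁ * degreeScaling d k ε + (ε ^ k • U₂) * C := by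
    rw [Matrix.add_mul, Matrix.mul_assoc (U₂ * C), hEΔ, Matrix.mul_smul, Matrix.mul_one,
      Matrix.smul_mul]
  have hsub : U * degreeScaling d (k + 1) ε * wronskianLT κ (k + 1) *
      (U * degreeScaling d (k + 1) ε)ᵀ =
      (U * degreeScaling d (k + 1) ε).submatrix id (multiIdxSumEquiv d k) *
        (wronskianLT κ (k + 1)).submatrix (multiIdxSumEquiv d k) (multiIdxSumEquiv d k) *
        ((U * degreeScaling d (k + 1) ε).submatrix id (multiIdxSumEquiv d k))ᵀ := by
    rw [Matrix.transpose_submatrix, Matrix.submatrix_mul_equiv, Matrix.submatrix_mul_equiv,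
      Matrix.submatrix_id_id]
  rw [hcongr, hcongr, hA, hsub, mul_degreeScaling_submatrix, wronskianLT_submatrix, hC, hB,
    mul_fromBlocks_mul_transpose _ _ _ _ hW₁.det_pos.ne'.isUnit hW₁.1]
  congr 1
  rw [wronskianSchur, hB, Matrix.transpose_smul, Matrix.smul_mul, Matrix.smul_mul, Matrix.mul_smul,
    smul_smul, ← pow_add, two_mul]

/-- The kernel is expanded one degree further, with `R = k + 1`. At scale `η = ε ^ (2k)` the Schur
complement survives and the remainder `ε ^ (2k + 1) T` contributes only `ε • T`. -/
theorem isNonnegPair_and_convergesInLaw_between {d n m k : ℕ} {f ψ : ℝ → ℝ}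
    (h : KernelExpansion d f (k + 1) ψ) (hpos : IsPosSemidefKernel (stationaryKernel d f))
    (hW : (wronskianLT (stationaryKernel d f) (k + 1)).PosDef) (hk : 1 ≤ k)
    {x : Fin n → EuclideanSpace ℝ (Fin d)} (hm : Fintype.card (multiIdxLT d k) ≤ m)
    (hV : LinearIndependent ℝ (vandermondeLT x k).col)
    (hrank : m ≤ (vandermondeLT x (k + 1)).rank) :
    IsNonnegPair
        (vandermondeEq x k * wronskianSchur (stationaryKernel d f) k * (vandermondeEq x k)ᵀ)
        (vandermondeLT x k) ∧
      ConvergesInLaw (fun ε => fixedSizeLEnsemble m (kernelMatrix f x ε))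
        (fixedSizeExtLEnsemble m
          (vandermondeEq x k * wronskianSchur (stationaryKernel d f) k * (vandermondeEq x k)ᵀ)
          (vandermondeLT x k)) := by
  set κ := stationaryKernel d f with hκ
  have hW₁ : (wronskianLT κ k).PosDef := wronskianLT_posDef_of_le k.le_succ hW
  have hS : (wronskianSchur κ k).PosDef := wronskianSchur_posDef hW
  set V₂ := vandermondeEq x k with hV₂
  have hform : ∀ c : Fin n → ℝ, c ⬝ᵥ ((V₂ * wronskianSchur κ k * V₂ᵀ) *ᵥ c) =
      star (V₂ᵀ *ᵥ c) ⬝ᵥ (wronskianSchur κ k *ᵥ (V₂ᵀ *ᵥ c)) := by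
    intro c
    rw [star_trivial, Matrix.mulVec_transpose, ← Matrix.dotProduct_mulVec, Matrix.mulVec_mulVec,
      ← Matrix.mulVec_transpose, Matrix.mulVec_mulVec, Matrix.mul_assoc]
  refine ⟨⟨hV, ?_, fun c _ => ?_⟩, ?_⟩
  · have h1 : (wronskianSchur κ k)ᵀ = wronskianSchur κ k := hS.1
    rw [Matrix.IsSymm, Matrix.transpose_mul, Matrix.transpose_mul, Matrix.transpose_transpose, h1,
      Matrix.mul_assoc]
  · rw [hform]
    exact hS.posSemidef.dotProduct_mulVec_nonneg _
  · obtain ⟨G, T, hG, hT, hdec⟩ := h.exists_decomposition hW.det_pos.ne'.isUnit x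
    set U : ℝ → Matrix (Fin n) (multiIdxLT d (k + 1)) ℝ := fun ε => vandermondeLT x (k + 1) + G ε
      with hU
    have hUlim : Tendsto U (𝓝[>] 0) (𝓝 (vandermondeLT x (k + 1))) := by
      simpa using tendsto_const_nhds.add hG
    set U₁ : ℝ → Matrix (Fin n) (multiIdxLT d k) ℝ := fun ε =>
      (U ε).submatrix id (multiIdxSumEquiv d k ∘ Sum.inl) with hU₁
    set U₂ : ℝ → Matrix (Fin n) (multiIdxEq d k) ℝ := fun ε =>
      (U ε).submatrix id (multiIdxSumEquiv d k ∘ Sum.inr) with hU₂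
    have hU₁lim : Tendsto U₁ (𝓝[>] 0) (𝓝 (vandermondeLT x k)) :=
      ((continuous_id.matrix_submatrix id (multiIdxSumEquiv d k ∘ Sum.inl)).tendsto _).comp hUlim
    have hU₂lim : Tendsto U₂ (𝓝[>] 0) (𝓝 V₂) :=
      ((continuous_id.matrix_submatrix id (multiIdxSumEquiv d k ∘ Sum.inr)).tendsto _).comp hUlim
    set C := wronskianBlock κ (multiIdxEq d k) (multiIdxLT d k) * (wronskianLT κ k)⁻¹ with hC
    have hElim : Tendsto (fun ε : ℝ => Matrix.diagonal fun α : multiIdxLT d k =>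
        ε ^ (k - ∑ j, α.1 j)) (𝓝[>] 0) (𝓝 0) := by
      have h1 : Tendsto (fun (ε : ℝ) (α : multiIdxLT d k) => ε ^ (k - ∑ j, α.1 j))
          (𝓝[>] 0) (𝓝 0) := by
        refine tendsto_pi_nhds.2 fun α => tendsto_pow_nhdsGT_zero ?_
        have hα := mem_multiIdxLT.1 α.2
        omega
      have h2 : Continuous fun v : multiIdxLT d k → ℝ => Matrix.diagonal v :=
        continuous_id.matrix_diagonal
      have h3 := (h2.tendsto 0).comp h1
      have h4 : Matrix.diagonal (0 : multiIdxLT d k → ℝ) = 0 := Matrix.diagonal_zero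
      rw [h4] at h3
      exact h3
    have hmul : ∀ {ι₁ ι₂ ι₃ : Type} [Fintype ι₂] {A : ℝ → Matrix ι₁ ι₂ ℝ} {B : ℝ → Matrix ι₂ ι₃ ℝ}
        {A₀ : Matrix ι₁ ι₂ ℝ} {B₀ : Matrix ι₂ ι₃ ℝ}, Tendsto A (𝓝[>] 0) (𝓝 A₀) →
        Tendsto B (𝓝[>] 0) (𝓝 B₀) → Tendsto (fun ε => A ε * B ε) (𝓝[>] 0) (𝓝 (A₀ * B₀)) :=
      fun {ι₁ ι₂ ι₃} _ {A B A₀ B₀} hA hB =>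
        ((continuous_fst.matrix_mul continuous_snd).tendsto (A₀, B₀)).comp (hA.prodMk_nhds hB)
    have hAlim : Tendsto (fun ε => U₁ ε + U₂ ε * C * Matrix.diagonal fun α : multiIdxLT d k =>
        ε ^ (k - ∑ j, α.1 j)) (𝓝[>] 0) (𝓝 (vandermondeLT x k)) := by
      simpa using hU₁lim.add (hmul (hmul hU₂lim (tendsto_const_nhds (x := C))) hElim)
    have hTlim : Tendsto (fun ε => U₂ ε * wronskianSchur κ k * (U₂ ε)ᵀ + ε • T ε) (𝓝[>] 0)
        (𝓝 (V₂ * wronskianSchur κ k * V₂ᵀ)) := by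
      have h1 : Tendsto (fun ε => (U₂ ε)ᵀ) (𝓝[>] 0) (𝓝 V₂ᵀ) :=
        (continuous_id.matrix_transpose.tendsto _).comp hU₂lim
      have h2 : Tendsto (fun ε : ℝ => ε) (𝓝[>] 0) (𝓝 0) := tendsto_id.mono_left nhdsWithin_le_nhds
      simpa using (hmul (hmul hU₂lim (tendsto_const_nhds (x := wronskianSchur κ k))) h1).add
        (h2.smul hT)
    refine convergesInLaw_of_low_rank_add (η := fun ε => 1 * ε ^ (2 * k)) ?_ ?_ ?_ hAlim hTlim
      (tendsto_smul_inv_degreeScaling (by omega) (by omega) 1 hW₁.det_pos.ne'.isUnit) ?_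
    · filter_upwards [self_mem_nhdsWithin] with ε hε using
        kernelMatrix_posSemidef hpos x (le_of_lt hε)
    · filter_upwards [self_mem_nhdsWithin] with ε hε
      rw [hdec ε hε, mul_degreeScaling_mul_transpose_eq hW, one_mul, smul_add, smul_smul,
        ← pow_succ, add_assoc, show 2 * (k + 1) - 1 = 2 * k + 1 by omega]
    · filter_upwards [self_mem_nhdsWithin] with ε hε
      have hε : 0 < ε := hε
      exact ⟨isUnit_det_degreeScaling_mul hε.ne' hW₁.det_pos.ne'.isUnit, by positivity⟩
    -- On `X` the rows of `V_{≤k}` are independent and those of `V_{<k}` determine coefficients. A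
    -- null weight of the Schur form also has zero moments of degree `k`, so it is annihilated by
    -- all of `V_{≤k}` and vanishes.
    · obtain ⟨X, hX, hli, hXV⟩ := exists_rows_of_le_rank (vandermondeLT x k)
        (vandermondeLT x (k + 1)) (multiIdxSumEquiv d k ∘ Sum.inl) (fun _ _ => rfl) hV hm hrank
      refine ⟨X, hX, extWeight_ne_zero hXV fun c hc hVc hSc => ?_⟩
      rw [hform, hS.posSemidef.dotProduct_mulVec_zero_iff] at hSc
      have hV₂c : V₂ᵀ *ᵥ c = 0 := by
        by_contra hne
        have := hS.dotProduct_mulVec_pos hne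
        rw [hSc, dotProduct_zero] at this
        exact lt_irrefl _ this
      have h2 := linearIndepOn_finset_iff.1 hli c ?_
      · funext i
        by_cases hi : i ∈ X
        · exact h2 i hi
        · exact hc i hi
      · funext α
        have h3 : ((vandermondeLT x (k + 1))ᵀ *ᵥ c) α = 0 := by
          obtain ⟨β, rfl⟩ := (multiIdxSumEquiv d k).surjective α
          rcases β with β | β
          · exact congrFun hVc β
          · exact congrFun hV₂c β
        rw [Pi.zero_apply, ← h3, Finset.sum_apply, Matrix.mulVec, dotProduct]
        rw [← Finset.sum_subset (Finset.subset_univ X) fun i _ hi => by rw [hc i hi, mul_zero]]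
        exact Finset.sum_congr rfl fun i _ => mul_comm _ _

/-! ### Assembly of the three cases -/

theorem mainTheorem1 {d n : ℕ} (hd : 0 < d)
    (x : Fin n → EuclideanSpace ℝ (Fin d)) (hx : Function.Injective x)
    (f : ℝ → ℝ) (hf : AnalyticAt ℝ f 0) (hpos : IsPosSemidefKernel (stationaryKernel d f))
    (m : ℕ) (hm : 1 ≤ m) (hmn : m ≤ n) :
    -- `m = P_{k,d}` is a magic number with `k ≤ r - 1`
    (∀ k : ℕ, (k : ℕ∞) < smoothnessOrder f → m = polyDim d k →
      LinearIndependent ℝ (vandermondeLT x (k + 1)).col →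
      (smoothnessOrder f = ⊤ → (wronskianLT (stationaryKernel d f) (k + 1)).det ≠ 0) →
      ConvergesInLaw (fun ε => fixedSizeLEnsemble m (kernelMatrix f x ε))
          (fixedSizeLEnsemble m (vandermondeLT x (k + 1) * (vandermondeLT x (k + 1))ᵀ)) ∧
        ∀ Q : Matrix (Fin n) (Fin (polyDim d k)) ℝ, Qᵀ * Q = 1 →
          Submodule.span ℝ (Set.range Q.col) =
            Submodule.span ℝ (Set.range (vandermondeLT x (k + 1)).col) →
          ConvergesInLaw (fun ε => fixedSizeLEnsemble m (kernelMatrix f x ε))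
            (fixedSizeLEnsemble m (Q * Qᵀ))) ∧
    -- `m ≤ P_{r-1,d}` is not a magic number
    ((m : ℕ∞) ≤ polyDimBelow d (smoothnessOrder f) → m ∉ magicNumbers d →
      (∃! k : ℕ, 1 ≤ k ∧ (k : ℕ∞) < smoothnessOrder f ∧
        polyDim d (k - 1) < m ∧ m < polyDim d k) ∧
      ∀ k : ℕ, 1 ≤ k → (k : ℕ∞) < smoothnessOrder f →
        polyDim d (k - 1) < m → m < polyDim d k →
        LinearIndependent ℝ (vandermondeLT x k).col →
        m ≤ (vandermondeLT x (k + 1)).rank →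
        (smoothnessOrder f = ⊤ → (wronskianLT (stationaryKernel d f) (k + 1)).det ≠ 0) →
        IsNonnegPair
            (vandermondeEq x k * wronskianSchur (stationaryKernel d f) k * (vandermondeEq x k)ᵀ)
            (vandermondeLT x k) ∧
          ConvergesInLaw (fun ε => fixedSizeLEnsemble m (kernelMatrix f x ε))
            (fixedSizeExtLEnsemble m
              (vandermondeEq x k * wronskianSchur (stationaryKernel d f) k * (vandermondeEq x k)ᵀ)
              (vandermondeLT x k))) ∧
    -- `m > P_{r-1,d}`
    (∀ r : ℕ, smoothnessOrder f = r → polyDim d (r - 1) < m →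
      LinearIndependent ℝ (vandermondeLT x r).col →
      IsNonnegPair ((-1 : ℝ) ^ r • distPowMatrix x (2 * r - 1)) (vandermondeLT x r) ∧
        ConvergesInLaw (fun ε => fixedSizeLEnsemble m (kernelMatrix f x ε))
          (fixedSizeExtLEnsemble m ((-1 : ℝ) ^ r • distPowMatrix x (2 * r - 1))
            (vandermondeLT x r))) := by
  refine ⟨fun k hk hmk hV hdet => ?_, fun hmr hmag => ⟨existsUnique_between_polyDim hd hm
    (one_le_smoothnessOrder f) hmr hmag, fun k hk1 hk hkm _ hV hrank hdet => ?_⟩,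
    fun r hr hrm hV => ?_⟩
  · have hkr : ((k + 1 : ℕ) : ℕ∞) ≤ smoothnessOrder f := by
      push_cast
      exact Order.add_one_le_of_lt hk
    obtain ⟨ψ, h⟩ := exists_kernelExpansion (d := d) hf (by omega) hkr
    have hW := wronskianLT_posDef hd hf hpos (by omega) hkr hdet
    have hcard : Fintype.card (multiIdxLT d (k + 1)) = m := by
      rw [Fintype.card_coe, card_multiIdxLT_succ, hmk]
    have h1 := convergesInLaw_of_card_eq h hpos hW.det_pos.ne'.isUnit x hV
    rw [hcard] at h1
    refine ⟨h1, fun Q _ hQ => ?_⟩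
    subst hmk
    rwa [fixedSizeLEnsemble_mul_transpose_of_span_eq _ Q hV hcard hQ] at h1
  · have hkr : ((k + 1 : ℕ) : ℕ∞) ≤ smoothnessOrder f := by
      push_cast
      exact Order.add_one_le_of_lt hk
    obtain ⟨ψ, h⟩ := exists_kernelExpansion (d := d) hf (by omega) hkr
    refine isNonnegPair_and_convergesInLaw_between h hpos
      (wronskianLT_posDef hd hf hpos (by omega) hkr hdet) hk1 ?_ hV hrank
    obtain ⟨l, rfl⟩ : ∃ l, k = l + 1 := ⟨k - 1, by omega⟩
    rw [Fintype.card_coe, card_multiIdxLT_succ]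
    exact hkm.le
  · obtain ⟨hr1, hr0⟩ := iteratedDeriv_ne_zero_of_smoothnessOrder_eq hr
    obtain ⟨ψ, h⟩ := exists_kernelExpansion (d := d) hf hr1 hr.ge
    refine isNonnegPair_and_convergesInLaw_of_lt hd hx h hpos ?_ ?_ hmn hV
    · rw [h.apply_zero]
      exact div_ne_zero hr0 (by positivity)
    · obtain ⟨l, rfl⟩ : ∃ l, r = l + 1 := ⟨r - 1, by omega⟩
      rw [Fintype.card_coe, card_multiIdxLT_succ]
      exact hrm.le
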